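/- Let $(V,\Omega)$ be a finite-dimensional real symplectic vector space, $\hbar>0$, $h=2\pi\hbar$, $n=\frac12\dim_{\mathbb R}V$, and let $j$ be a positive compatible complex structure: a linear map with $j^2=-1$, $\Omega(jv,jw)=\Omega(v,w)$ and $\Omega(v,jv)>0$ for $v\neq0$. Regard $V$ as a complex vector space through $j$, with Hermitean form $\langle v,w\rangle_j=\Omega(v,jw)-i\Omega(v,w)$, and let $\operatorname{Det}_j$ be the complex determinant. For $g\in Sp(V,\Omega)$ write $g=C_g+D_g$ with $C_g=\frac12(g-jgj)$ ($j$-linear, invertible) and $D_g=\frac12(g+jgj)$ ($j$-antilinear), and put $Z_g=C_g^{-1}D_g$. Let $GL(V,j)_+$ be the set of invertible $j$-linear maps $A$ with $A+A^*$ positive definite, and let $a\colon GL(V,j)_+\to\mathbb C$ be the unique smooth function with $\operatorname{Det}_jA=e^{a(A)}$ and $a(1)=0$. Let $U(V,\Omega,j)=\{g\in Sp(V,\Omega): gj=jg\}$. Let $\mathcal H$ be the Fock space of holomorphic functions $f$ on $(V,j)$ with $\|f\|^2=h^{-n}\int_V|f(z)|^2e^{-|z|_j^2/2\hbar}\,dz<\infty$,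 with coherent states $e_v(z)=e^{\langle z,v\rangle_j/2\hbar}$ and Heisenberg operators $(U_j(v,t)f)(z)=e^{-it/\hbar+\langle z,v\rangle_j/2\hbar-|v|_j^2/4\hbar}f(z-v)$. Let $Mp^c=Mp^c(V,\Omega,j)$ be the group of pairs $(U,g)$ with $U$ unitary on $\mathcal H$, $g\in Sp(V,\Omega)$ and $U_j(gv,t)=U\,U_j(v,t)\,U^{-1}$ for all $(v,t)\in V\times\mathbb R$, and $\sigma(U,g)=g$. We say that $(U,g)$ has parameters $(g,\lambda)$ if $|\lambda^2\operatorname{Det}_jC_g|=1$ and $$(Ue_v)(z)=\lambda\exp\tfrac1{4\hbar}\{2\langle C_g^{-1}z,v\rangle_j-\langle z,Z_{g^{-1}}z\rangle_j-\langle Z_gv,v\rangle_j\}\quad\text{for all } z,v\in V;$$ then $\lambda=(Ue_0)(0)$. The Lie group structure of $Mp^c$ is the one for which $(U,g)\mapsto(g,\lambda)$ is a diffeomorphism onto the submanifold $|\lambda^2\operatorname{Det}_jC_g|=1$ of $Sp(V,\Omega)\times\mathbb C$. Let $H$ be a Lie subgroup of $Sp(V,\Omega)$. A lift of $H$ to $Mp^c$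 is a smooth homomorphism $F\colon H\to Mp^c$ with $\sigma\circ F=\mathrm{Id}_H$. 1. $H$ has a lift to $Mp^c$ if and only if there is a smooth function $f\colon H\to\mathbb C$ such that, for all $g,g_1,g_2\in H$, $$f(g_1g_2)=f(g_1)f(g_2)\,e^{-\frac12a(1-Z_{g_1}Z_{g_2^{-1}})},\qquad |f(g)^2\operatorname{Det}_jC_g|=1.$$ 2. The group $\operatorname{Hom}(H,U(1))$ of smooth homomorphisms $H\to U(1)$ acts simply transitively on the set of lifts of $H$ by $(\chi\cdot F)(g)=\chi(g)F(g)$: for any two lifts $F,F'$ there is exactly one $\chi$ with $\chi\cdot F=F'$. (The set of lifts may be empty.) 3. Suppose that $H_1=H\cap U(V,\Omega,j)$ meets every connected component of $H$, and that $f\colon H\to\mathbb C^*$ is a smooth map such that (i) $f|_{H_1}$ is a homomorphism into $\mathbb C^*$ and (ii) $g\mapsto f(g)^2\operatorname{Det}_jC_g$ is a homomorphism of $H$ into $U(1)$. Then, for each $g\in H$, $(g,f(g))$ are the parameters of exactly one element $F(g)$ of $Mp^c$, and $F$ is a lift of $H$; in particular $H$ has a lift to $Mp^c$. -/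

import Mathlib

open MeasureTheory
open scoped ContDiff Manifold ComplexConjugate

set_option linter.unusedSectionVars false

namespace SympLift

/-! ### Symplectic vector spaces and positive compatible complex structures -/

/-- A symplectic form on a real vector space. -/
structure SymplecticForm (V : Type*) [AddCommGroup V] [Module ℝ V] where
  form : LinearMap.BilinForm ℝ V
  isAlt : form.IsAlt
  nondegenerate : form.Nondegenerate

/-- A positive compatible complex structure: a linear map `J` with `J² = -1`, symplectic, such
that `(v, w) ↦ Ω(v, J w)` is positive definite. -/
structure PCCS {V : Type*} [AddCommGroup V] [Module ℝ V] (Ω : SymplecticForm V) where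
  J : V →ₗ[ℝ] V
  sq : ∀ v, J (J v) = -v
  symp : ∀ v w, Ω.form (J v) (J w) = Ω.form v w
  pos : ∀ v, v ≠ 0 → 0 < Ω.form v (J v)

section Algebra

variable {V : Type*} [AddCommGroup V] [Module ℝ V] {Ω : SymplecticForm V}

theorem SymplecticForm.neg (Ω : SymplecticForm V) (v w : V) : Ω.form v w = -Ω.form w v := by
  rw [← LinearMap.IsAlt.neg Ω.isAlt w v]

theorem PCCS.form_left (j : PCCS Ω) (v w : V) : Ω.form (j.J v) w = -Ω.form v (j.J w) := by
  have h := j.symp (j.J v) w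
  rw [j.sq] at h
  simpa using h.symm

/-- The symplectic group `Sp(V, Ω)`. -/
def Sp (Ω : SymplecticForm V) : Subgroup (V ≃ₗ[ℝ] V) where
  carrier := {g | ∀ v w, Ω.form (g v) (g w) = Ω.form v w}
  one_mem' := fun _ _ => rfl
  mul_mem' := by
    intro a b ha hb v w
    simp only [LinearEquiv.mul_apply]
    rw [ha, hb]
  inv_mem' := by
    intro a ha v w
    have h := ha (a⁻¹ v) (a⁻¹ w)
    have h1 : ∀ x, a (a⁻¹ x) = x := fun x => a.apply_symm_apply x
    rw [h1, h1] at h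
    exact h.symm

/-- The unitary group `U(V, Ω, j)`: the symplectic maps that commute with `j`. -/
def unitaryGroupJ (j : PCCS Ω) : Subgroup (Sp Ω) where
  carrier := {g | ∀ v, g.1 (j.J v) = j.J (g.1 v)}
  one_mem' := fun _ => rfl
  mul_mem' := by
    intro a b ha hb v
    change a.1 (b.1 (j.J v)) = j.J (a.1 (b.1 v))
    rw [hb, ha]
  inv_mem' := by
    intro a ha v
    have h1 : ∀ x, a.1 ((a⁻¹).1 x) = x := fun x => a.1.apply_symm_apply x
    apply a.1.injective
    rw [h1, ha, h1]

/-! ### The complex Hilbert space `(V, Ω, j)` -/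

/-- The vector space `V`, seen as a complex vector space on which `i` acts as `j`. -/
def Cpx (_j : PCCS Ω) : Type _ := V

variable (j : PCCS Ω)

instance : AddCommGroup (Cpx j) := inferInstanceAs (AddCommGroup V)

/-- The identity map from `V` to `(V, Ω, j)`. -/
def toCpx : V ≃+ Cpx j := AddEquiv.refl V

instance : SMul ℂ (Cpx j) where
  smul c x := toCpx j (c.re • (toCpx j).symm x + c.im • j.J ((toCpx j).symm x))

theorem cpx_smul_def (c : ℂ) (x : V) :
    c • toCpx j x = toCpx j (c.re • x + c.im • j.J x) := rfl

instance : Module ℂ (Cpx j) where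
  one_smul x := by
    change toCpx j _ = toCpx j ((toCpx j).symm x)
    congr 1
    simp
  mul_smul a b x := by
    change toCpx j _ = toCpx j (a.re • (b.re • (toCpx j).symm x + b.im • j.J ((toCpx j).symm x))
      + a.im • j.J (b.re • (toCpx j).symm x + b.im • j.J ((toCpx j).symm x)))
    congr 1
    simp only [Complex.mul_re, Complex.mul_im, map_add, map_smul, j.sq]
    module
  smul_zero a := by
    rw [← map_zero (toCpx j), cpx_smul_def]
    simp
  zero_smul x := by
    change toCpx j _ = toCpx j 0
    congr 1
    simp
  smul_add a x y := by
    change toCpx j _ = toCpx j ((a.re • (toCpx j).symm x + a.im • j.J ((toCpx j).symm x))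
      + (a.re • (toCpx j).symm y + a.im • j.J ((toCpx j).symm y)))
    congr 1
    simp only [map_add]
    module
  add_smul a b x := by
    change toCpx j _ = toCpx j ((a.re • (toCpx j).symm x + a.im • j.J ((toCpx j).symm x))
      + (b.re • (toCpx j).symm x + b.im • j.J ((toCpx j).symm x)))
    congr 1
    simp only [Complex.add_re, Complex.add_im]
    module

/-- The Hermitean form `⟨v, w⟩_j = Ω(v, j w) - i Ω(v, w)`, complex linear in `v` and antilinear
in `w`. -/
noncomputable def herm (v w : Cpx j) : ℂ :=
  (Ω.form ((toCpx j).symm v) (j.J ((toCpx j).symm w)) : ℂ)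
    - Complex.I * (Ω.form ((toCpx j).symm v) ((toCpx j).symm w) : ℂ)

/-- Mathlib's inner products are antilinear in the first variable, so `inner ℂ v w` is
`⟨w, v⟩_j`. -/
noncomputable instance cpxCore : InnerProductSpace.Core ℂ (Cpx j) where
  inner v w := herm j w v
  conj_inner_symm x y := by
    obtain ⟨x, rfl⟩ := (toCpx j).surjective x
    obtain ⟨y, rfl⟩ := (toCpx j).surjective y
    have h1 : Ω.form x (j.J y) = Ω.form y (j.J x) := by
      rw [Ω.neg, j.form_left]; simp
    have h2 := Ω.neg x y
    apply Complex.ext <;> simp [herm, h1, h2]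
  re_inner_nonneg x := by
    obtain ⟨x, rfl⟩ := (toCpx j).surjective x
    by_cases hx : x = 0
    · simp [herm, hx]
    · simpa [herm] using (j.pos x hx).le
  add_left x y z := by
    simp only [herm, map_add, Complex.ofReal_add]
    ring
  smul_left x y r := by
    obtain ⟨x, rfl⟩ := (toCpx j).surjective x
    obtain ⟨y, rfl⟩ := (toCpx j).surjective y
    apply Complex.ext
    · simp [herm, cpx_smul_def, j.sq, sub_eq_add_neg]
    · simp [herm, cpx_smul_def, j.sq]
      try ring
  definite x hx := by
    obtain ⟨x, rfl⟩ := (toCpx j).surjective x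
    by_contra hne
    have hne' : x ≠ 0 := fun h => hne (by rw [h, map_zero])
    have h := congrArg Complex.re hx
    have hp := j.pos x hne'
    simp [herm] at h
    linarith

noncomputable instance : NormedAddCommGroup (Cpx j) :=
  @InnerProductSpace.Core.toNormedAddCommGroup ℂ (Cpx j) _ _ _ (cpxCore j)

noncomputable instance : InnerProductSpace ℂ (Cpx j) :=
  InnerProductSpace.ofCore (cpxCore j).toCore

noncomputable instance : InnerProductSpace ℝ (Cpx j) := InnerProductSpace.complexToReal

theorem inner_eq_herm (v w : Cpx j) : inner ℂ v w = herm j w v := rfl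

/-- The identity map from `V` to `(V, Ω, j)`, as a real linear map. -/
noncomputable def toCpxₗ : V ≃ₗ[ℝ] Cpx j :=
  { toCpx j with
    map_smul' := by
      intro r x
      change toCpx j (r • x) = ((r : ℝ) : ℂ) • toCpx j x
      rw [cpx_smul_def]
      simp }

instance instFDReal [FiniteDimensional ℝ V] : FiniteDimensional ℝ (Cpx j) :=
  (toCpxₗ j).finiteDimensional

instance [FiniteDimensional ℝ V] : FiniteDimensional ℂ (Cpx j) :=
  FiniteDimensional.right ℝ ℂ (Cpx j)

noncomputable instance : MeasurableSpace (Cpx j) := borel _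

instance : BorelSpace (Cpx j) := ⟨rfl⟩

/-! ### The parameters `C_g` and `Z_g` of a symplectic map -/

variable {j}

/-- The `j`-linear part `½(A - j A j)` of a real linear map `A`. -/
noncomputable def linPart (j : PCCS Ω) (A : V →ₗ[ℝ] V) : Cpx j →ₗ[ℂ] Cpx j where
  toFun x := toCpx j ((1 / 2 : ℝ) • (A ((toCpx j).symm x) - j.J (A (j.J ((toCpx j).symm x)))))
  map_add' x y := by
    change toCpx j _ = toCpx j ((1 / 2 : ℝ) • (A ((toCpx j).symm x) - j.J (A (j.J ((toCpx j).symm x))))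
      + (1 / 2 : ℝ) • (A ((toCpx j).symm y) - j.J (A (j.J ((toCpx j).symm y)))))
    congr 1
    simp only [map_add]
    module
  map_smul' c x := by
    change toCpx j ((1 / 2 : ℝ) • (A (c.re • (toCpx j).symm x + c.im • j.J ((toCpx j).symm x)) - j.J (A (j.J (c.re • (toCpx j).symm x + c.im • j.J ((toCpx j).symm x))))))
      = toCpx j (c.re • ((1 / 2 : ℝ) • (A ((toCpx j).symm x) - j.J (A (j.J ((toCpx j).symm x)))))
        + c.im • j.J ((1 / 2 : ℝ) • (A ((toCpx j).symm x) - j.J (A (j.J ((toCpx j).symm x))))))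
    congr 1
    simp only [map_add, map_sub, map_smul, map_neg, j.sq]
    module

/-- The `j`-antilinear part `½(A + j A j)` of a real linear map `A`. -/
noncomputable def antiPart (j : PCCS Ω) (A : V →ₗ[ℝ] V) : Cpx j →ₛₗ[starRingEnd ℂ] Cpx j where
  toFun x := toCpx j ((1 / 2 : ℝ) • (A ((toCpx j).symm x) + j.J (A (j.J ((toCpx j).symm x)))))
  map_add' x y := by
    change toCpx j _ = toCpx j ((1 / 2 : ℝ) • (A ((toCpx j).symm x) + j.J (A (j.J ((toCpx j).symm x))))
      + (1 / 2 : ℝ) • (A ((toCpx j).symm y) + j.J (A (j.J ((toCpx j).symm y)))))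
    congr 1
    simp only [map_add]
    module
  map_smul' c x := by
    change toCpx j ((1 / 2 : ℝ) • (A (c.re • (toCpx j).symm x + c.im • j.J ((toCpx j).symm x)) + j.J (A (j.J (c.re • (toCpx j).symm x + c.im • j.J ((toCpx j).symm x))))))
      = toCpx j (c.re • ((1 / 2 : ℝ) • (A ((toCpx j).symm x) + j.J (A (j.J ((toCpx j).symm x)))))
        + (-c.im) • j.J ((1 / 2 : ℝ) • (A ((toCpx j).symm x) + j.J (A (j.J ((toCpx j).symm x))))))
    congr 1
    simp only [map_add, map_smul, map_neg, j.sq]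
    module

theorem linPart_injective (j : PCCS Ω) (g : Sp Ω) :
    Function.Injective (linPart j (g.1 : V →ₗ[ℝ] V)) := by
  rw [injective_iff_map_eq_zero]
  intro x hx
  obtain ⟨v, rfl⟩ := (toCpx j).surjective x
  by_contra hne
  have hv : v ≠ 0 := fun h => hne (by rw [h, map_zero])
  have h0 : (1 / 2 : ℝ) • (g.1 v - j.J (g.1 (j.J v))) = 0 := hx
  have h1 : g.1 v = j.J (g.1 (j.J v)) := by
    have := (smul_eq_zero.mp h0).resolve_left (by norm_num)
    exact sub_eq_zero.mp this
  have hp := j.pos v hv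
  have hJ : j.J (g.1 v) = -g.1 (j.J v) := by rw [h1, j.sq]
  have hgv : g.1 v ≠ 0 := fun h => hv (g.1.map_eq_zero_iff.mp h)
  have h2 := j.pos _ hgv
  rw [hJ, map_neg, g.2 v (j.J v)] at h2
  linarith

variable [FiniteDimensional ℝ V]

/-- `C_g`, the `j`-linear part of a symplectic map `g`, which is invertible. -/
noncomputable def C (j : PCCS Ω) (g : Sp Ω) : Cpx j ≃ₗ[ℂ] Cpx j :=
  LinearEquiv.ofInjectiveEndo (linPart j (g.1 : V →ₗ[ℝ] V)) (linPart_injective j g)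

/-- `Z_g = C_g⁻¹ D_g`, where `D_g` is the `j`-antilinear part of `g`. -/
noncomputable def Z (j : PCCS Ω) (g : Sp Ω) : Cpx j →ₛₗ[starRingEnd ℂ] Cpx j :=
  ((C j g).symm : Cpx j →ₗ[ℂ] Cpx j).comp (antiPart j (g.1 : V →ₗ[ℝ] V))

/-- `Det_j C_g`. -/
noncomputable def detC (j : PCCS Ω) (g : Sp Ω) : ℂ :=
  LinearMap.det (C j g : Cpx j →ₗ[ℂ] Cpx j)

/-! ### The logarithm of the determinant -/

/-- `GL(V, j)₊`: the invertible complex linear maps `A` with `A + A*` positive definite, that is,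
`Re ⟨A v, v⟩ > 0` for all `v ≠ 0`. -/
def GLplus (j : PCCS Ω) : Set (Cpx j →L[ℂ] Cpx j) :=
  {A | IsUnit A ∧ ∀ v, v ≠ 0 → 0 < (herm j (A v) v).re}

/-- `a` is a smooth function on `GL(V, j)₊` with `Det_j A = e^{a(A)}` and `a(1) = 0`. The values
of `a` outside `GL(V, j)₊` play no role. -/
structure IsLogDet (j : PCCS Ω) (a : (Cpx j →L[ℂ] Cpx j) → ℂ) : Prop where
  smooth : ContDiffOn ℝ ∞ a (GLplus j)
  exp_eq : ∀ A ∈ GLplus j, A.det = Complex.exp (a A)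
  map_one : a 1 = 0

/-- The unique smooth function `a` on `GL(V, j)₊` with `Det_j A = e^{a(A)}` and `a(1) = 0`. -/
noncomputable def logDet (j : PCCS Ω) : (Cpx j →L[ℂ] Cpx j) → ℂ :=
  Classical.epsilon (IsLogDet j)

/-- `1 - Z_{g₁} Z_{g₂⁻¹}`. -/
noncomputable def oneSubZZ (j : PCCS Ω) (g₁ g₂ : Sp Ω) : Cpx j →L[ℂ] Cpx j :=
  LinearMap.toContinuousLinearMap (LinearMap.id - (Z j g₁).comp (Z j g₂⁻¹))

/-! ### The Fock space and the Heisenberg group -/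

/-- The weight `e^{-|z|²/2ħ}`. -/
noncomputable def weight (ħ : ℝ) (j : PCCS Ω) (z : Cpx j) : ℝ := Real.exp (-‖z‖ ^ 2 / (2 * ħ))

/-- The Fock space: holomorphic functions on `(V, Ω, j)` that are square integrable for the
weight `e^{-|z|²/2ħ}` and the Lebesgue measure normalised by `|·|_j`. -/
noncomputable def Fock (ħ : ℝ) (j : PCCS Ω) : Submodule ℂ (Cpx j → ℂ) where
  carrier := {f | Differentiable ℂ f ∧ Integrable (fun z => ‖f z‖ ^ 2 * weight ħ j z)}
  zero_mem' := ⟨differentiable_const 0, by simp⟩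
  add_mem' := by
    rintro f g ⟨hf, hf'⟩ ⟨hg, hg'⟩
    refine ⟨hf.add hg, ?_⟩
    have hw : Continuous (weight ħ j) := by unfold weight; fun_prop
    refine ((hf'.const_mul 2).add (hg'.const_mul 2)).mono' ?_ (Filter.Eventually.of_forall ?_)
    · have h1 := hf.continuous
      have h2 := hg.continuous
      exact Continuous.aestronglyMeasurable (by fun_prop)
    · intro z
      have hpos : 0 ≤ weight ħ j z := (Real.exp_pos _).le
      have hn : ‖f z + g z‖ ^ 2 ≤ 2 * ‖f z‖ ^ 2 + 2 * ‖g z‖ ^ 2 := by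
        have := norm_add_le (f z) (g z)
        have h0 := norm_nonneg (f z + g z)
        nlinarith [sq_nonneg (‖f z‖ - ‖g z‖)]
      simp only [Pi.add_apply]
      rw [Real.norm_of_nonneg (by positivity)]
      nlinarith
  smul_mem' := by
    rintro c f ⟨hf, hf'⟩
    refine ⟨hf.const_smul c, ?_⟩
    have : (fun z => ‖(c • f) z‖ ^ 2 * weight ħ j z)
        = fun z => ‖c‖ ^ 2 * (‖f z‖ ^ 2 * weight ħ j z) := by
      funext z
      simp [mul_pow, mul_assoc]
    rw [this]
    exact hf'.const_mul _

/-- The norm of the Fock space, `‖f‖² = h^{-n} ∫ |f(z)|² e^{-|z|²/2ħ} dz` with `h = 2πħ`. -/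
noncomputable def fockNorm (ħ : ℝ) (j : PCCS Ω) (f : Fock ħ j) : ℝ :=
  Real.sqrt (((2 * Real.pi * ħ) ^ Module.finrank ℂ (Cpx j))⁻¹ *
    ∫ z, ‖f.1 z‖ ^ 2 * weight ħ j z)

/-- The function `e^{-it/ħ + ⟨z,v⟩/2ħ - |v|²/4ħ}` of `z`. -/
noncomputable def heisFactor (ħ : ℝ) (j : PCCS Ω) (v : Cpx j) (t : ℝ) (z : Cpx j) : ℂ :=
  Complex.exp (-Complex.I * t / ħ + herm j z v / (2 * ħ) - (‖v‖ : ℂ) ^ 2 / (4 * ħ))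

theorem heisFactor_weight (ħ : ℝ) (j : PCCS Ω) (v : Cpx j) (t : ℝ) (z : Cpx j) :
    ‖heisFactor ħ j v t z‖ ^ 2 * weight ħ j z = weight ħ j (z - v) := by
  unfold heisFactor weight
  rw [Complex.norm_exp, ← Real.exp_nat_mul, ← Real.exp_add]
  congr 1
  have h1 : (-Complex.I * t / ħ + herm j z v / (2 * ħ) - (‖v‖ : ℂ) ^ 2 / (4 * ħ)).re
      = (herm j z v).re / (2 * ħ) - ‖v‖ ^ 2 / (4 * ħ) := by
    have e1 : -Complex.I * t / ħ = ((-t / ħ : ℝ) : ℂ) * Complex.I := by push_cast; ring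
    have e2 : herm j z v / (2 * ħ) = ((1 / (2 * ħ) : ℝ) : ℂ) * herm j z v := by push_cast; ring
    have e3 : (‖v‖ : ℂ) ^ 2 / (4 * ħ) = ((‖v‖ ^ 2 / (4 * ħ) : ℝ) : ℂ) := by push_cast; ring
    rw [e1, e2, e3, Complex.sub_re, Complex.add_re, Complex.re_ofReal_mul, Complex.re_ofReal_mul,
      Complex.ofReal_re, Complex.I_re]
    ring
  have h2 : ‖z - v‖ ^ 2 = ‖z‖ ^ 2 - 2 * (herm j z v).re + ‖v‖ ^ 2 := by
    have := @norm_sub_sq ℂ _ _ _ _ z v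
    rw [this, ← inner_conj_symm, inner_eq_herm]
    simp
  rw [h1, h2]
  push_cast
  ring

theorem differentiable_herm (j : PCCS Ω) (v : Cpx j) : Differentiable ℂ fun z => herm j z v :=
  (innerSL ℂ v).differentiable

theorem differentiable_herm_div (ħ : ℝ) (j : PCCS Ω) (v : Cpx j) :
    Differentiable ℂ fun z => herm j z v / (2 * (ħ : ℂ)) := by
  simp only [div_eq_mul_inv]
  exact (differentiable_herm j v).mul_const _

theorem differentiable_heisFactor (ħ : ℝ) (j : PCCS Ω) (v : Cpx j) (t : ℝ) :
    Differentiable ℂ (heisFactor ħ j v t) := by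
  unfold heisFactor
  exact (((differentiable_const _).add (differentiable_herm_div ħ j v)).sub
    (differentiable_const _)).cexp

/-- The operator `U_j(v, t)` of the Heisenberg group on the Fock space,
`(U_j(v,t) f)(z) = e^{-it/ħ + ⟨z,v⟩/2ħ - |v|²/4ħ} f(z - v)`. -/
noncomputable def heis (ħ : ℝ) (j : PCCS Ω) (v : V) (t : ℝ) : Fock ħ j →ₗ[ℂ] Fock ħ j where
  toFun f := ⟨fun z => heisFactor ħ j (toCpx j v) t z * f.1 (z - toCpx j v), by
    refine ⟨(differentiable_heisFactor ħ j _ t).mul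
      (f.2.1.comp (differentiable_id.sub_const _)), ?_⟩
    have h := f.2.2.comp_sub_right (toCpx j v)
    refine h.congr (Filter.Eventually.of_forall fun z => ?_)
    simp only [norm_mul, mul_pow]
    rw [← heisFactor_weight ħ j (toCpx j v) t z]
    ring⟩
  map_add' f g := by
    ext z
    simp [mul_add]
  map_smul' c f := by
    ext z
    simp only [SetLike.val_smul, Pi.smul_apply, smul_eq_mul, RingHom.id_apply]
    ring

/-! ### The group `Mp^c(V, Ω, j)` -/

/-- The group `Mp^c(V, Ω, j)` of pairs `(U, g)`, where `U` is a unitary operator on the Fock space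
(a linear bijection preserving the norm), `g` is symplectic and
`U_j(g v, t) U = U U_j(v, t)` for all `(v, t)` in the Heisenberg group. -/
noncomputable def Mpc (ħ : ℝ) (j : PCCS Ω) : Subgroup ((Fock ħ j ≃ₗ[ℂ] Fock ħ j) × Sp Ω) where
  carrier := {x | (∀ f, fockNorm ħ j (x.1 f) = fockNorm ħ j f) ∧
    ∀ (v : V) (t : ℝ) (f : Fock ħ j), heis ħ j (x.2.1 v) t (x.1 f) = x.1 (heis ħ j v t f)}
  one_mem' := ⟨fun _ => rfl, fun _ _ _ => rfl⟩
  mul_mem' := by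
    rintro a b ⟨ha, ha'⟩ ⟨hb, hb'⟩
    refine ⟨fun f => ?_, fun v t f => ?_⟩
    · change fockNorm ħ j (a.1 (b.1 f)) = _
      rw [ha, hb]
    · change heis ħ j (a.2.1 (b.2.1 v)) t (a.1 (b.1 f)) = a.1 (b.1 (heis ħ j v t f))
      rw [ha', hb']
  inv_mem' := by
    rintro a ⟨ha, ha'⟩
    have h1 : ∀ f, a.1 ((a⁻¹).1 f) = f := fun f => a.1.apply_symm_apply f
    have h2 : ∀ v, a.2.1 ((a⁻¹).2.1 v) = v := fun v => a.2.1.apply_symm_apply v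
    refine ⟨fun f => ?_, fun v t f => ?_⟩
    · rw [← ha, h1]
    · apply a.1.injective
      rw [← ha', h1, h1, h2]

variable {ħ : ℝ}

/-- The projection `σ : Mp^c(V, Ω, j) → Sp(V, Ω)`. -/
noncomputable def sigma (ħ : ℝ) (j : PCCS Ω) : Mpc ħ j →* Sp Ω :=
  (MonoidHom.snd _ _).comp (Mpc ħ j).subtype

/-- The inclusion of the scalars `U(1)` in `Mp^c(V, Ω, j)`. -/
noncomputable def scalar (ħ : ℝ) (j : PCCS Ω) : Circle →* Mpc ħ j where
  toFun u := ⟨(LinearEquiv.smulOfNeZero ℂ (Fock ħ j) (u : ℂ) u.coe_ne_zero, 1), by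
    refine ⟨fun f => ?_, fun v t f => ?_⟩
    · change fockNorm ħ j ((u : ℂ) • f) = _
      unfold fockNorm
      simp [Circle.norm_coe]
    · change heis ħ j v t ((u : ℂ) • f) = (u : ℂ) • heis ħ j v t f
      rw [map_smul]⟩
  map_one' := by
    apply Subtype.ext
    refine Prod.ext (LinearEquiv.ext fun f => ?_) rfl
    change ((1 : Circle) : ℂ) • f = f
    simp
  map_mul' a b := by
    apply Subtype.ext
    refine Prod.ext (LinearEquiv.ext fun f => ?_) (one_mul 1).symm
    change ((a * b : Circle) : ℂ) • f = (a : ℂ) • ((b : ℂ) • f)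
    rw [Circle.coe_mul, mul_smul]

theorem scalar_comm (u : Circle) (x : Mpc ħ j) : scalar ħ j u * x = x * scalar ħ j u := by
  apply Subtype.ext
  refine Prod.ext (LinearEquiv.ext fun f => ?_) ((one_mul _).trans (mul_one _).symm)
  change (u : ℂ) • x.1.1 f = x.1.1 ((u : ℂ) • f)
  rw [map_smul]

/-- The coherent state `e_v(z) = e^{⟨z,v⟩/2ħ}`. -/
noncomputable def coherent (ħ : ℝ) [Fact (0 < ħ)] (j : PCCS Ω) (v : Cpx j) : Fock ħ j :=
  ⟨fun z => Complex.exp (herm j z v / (2 * ħ)), by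
    have hħ : 0 < ħ := Fact.out
    refine ⟨(differentiable_herm_div ħ j v).cexp, ?_⟩
    have hG : Integrable (weight ħ j) := by
      have h := (GaussianFourier.integrable_cexp_neg_mul_sq_norm_add (V := Cpx j)
        (b := ((1 / (2 * ħ) : ℝ) : ℂ)) (by rw [Complex.ofReal_re]; positivity) 0 0).norm
      refine h.congr (Filter.Eventually.of_forall fun z => ?_)
      simp only [zero_mul, add_zero, weight, Complex.norm_exp]
      congr 1
      have : -((1 / (2 * ħ) : ℝ) : ℂ) * (‖z‖ : ℂ) ^ 2
          = ((-‖z‖ ^ 2 / (2 * ħ) : ℝ) : ℂ) := by push_cast; ring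
      rw [this, Complex.ofReal_re]
    have h := (hG.comp_sub_right v).const_mul (Real.exp (‖v‖ ^ 2 / (4 * ħ)) ^ 2)
    refine h.congr (Filter.Eventually.of_forall fun z => ?_)
    simp only
    rw [← heisFactor_weight ħ j v 0 z, ← mul_assoc, ← mul_pow]
    congr 2
    unfold heisFactor
    have e3 : (‖v‖ : ℂ) ^ 2 / (4 * ħ) = ((‖v‖ ^ 2 / (4 * ħ) : ℝ) : ℂ) := by push_cast; ring
    rw [e3, sub_eq_add_neg, Complex.exp_add, norm_mul, ← Complex.ofReal_neg,
      Complex.norm_exp_ofReal, mul_comm, mul_assoc, ← Real.exp_add]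
    simp⟩

variable [hħ : Fact (0 < ħ)]

/-- The Berezin kernel `U(z, v) = (U e_v)(z)`. -/
noncomputable def berezin (x : Mpc ħ j) (z v : Cpx j) : ℂ := (x.1.1 (coherent ħ j v)).1 z

/-- `(g, l)` are the parameters of `x = (U, g)`: `|l² Det_j C_g| = 1` and the Berezin kernel of
`U` is `l exp (1/4ħ) {2⟨C_g⁻¹ z, v⟩ - ⟨z, Z_{g⁻¹} z⟩ - ⟨Z_g v, v⟩}`. -/
def HasParameters (x : Mpc ħ j) (g : Sp Ω) (l : ℂ) : Prop :=
  sigma ħ j x = g ∧ ‖l ^ 2 * detC j g‖ = 1 ∧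
    ∀ z v, berezin x z v = l * Complex.exp (1 / (4 * ħ) *
      (2 * herm j ((C j g).symm z) v - herm j z (Z j g⁻¹ z) - herm j (Z j g v) v))

/-- The parameter `λ = (U e_0)(0)` of an element `(U, g)`. -/
noncomputable def lam (x : Mpc ħ j) : ℂ := berezin x 0 0

theorem lam_scalar_mul (u : Circle) (x : Mpc ħ j) : lam (scalar ħ j u * x) = u * lam x := rfl

end Algebra

/-! ### Lie subgroups and lifts -/

section Lie

variable {V : Type*} [NormedAddCommGroup V] [NormedSpace ℝ V] [FiniteDimensional ℝ V]
  {Ω : SymplecticForm V}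

/-- A symplectic map as an element of the normed space `End(V)`. (The norm of `V` is arbitrary;
it only serves to see `End(V)` as a manifold.) -/
noncomputable def toEnd (g : Sp Ω) : V →L[ℝ] V :=
  LinearMap.toContinuousLinearMap (g.1 : V →ₗ[ℝ] V)

variable {E : Type*} [NormedAddCommGroup E] [NormedSpace ℝ E]

/-- A subgroup `H` of `Sp(V, Ω)` with a topology and an atlas of its own is a Lie subgroup if it
is a (finite-dimensional) Lie group and the inclusion in `Sp(V, Ω) ⊆ End(V)` is a smooth
immersion. (The topology of `H` may be finer than the induced one.) -/
structure IsLieSubgroup (E : Type*) [NormedAddCommGroup E] [NormedSpace ℝ E]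
    (H : Subgroup (Sp Ω)) [TopologicalSpace H] [ChartedSpace E H] : Prop where
  finiteDimensional : FiniteDimensional ℝ E
  lieGroup : LieGroup 𝓘(ℝ, E) ∞ H
  smooth : ContMDiff 𝓘(ℝ, E) 𝓘(ℝ, V →L[ℝ] V) ∞ fun h : H => toEnd h.1
  immersion : ∀ h : H, Function.Injective
    (mfderiv 𝓘(ℝ, E) 𝓘(ℝ, V →L[ℝ] V) (fun h : H => toEnd h.1) h)

variable {H : Subgroup (Sp Ω)} [TopologicalSpace H] [ChartedSpace E H]
  {ħ : ℝ} [Fact (0 < ħ)] {j : PCCS Ω}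

variable (E) in
/-- Smooth maps into the Lie group `Mp^c(V, Ω, j)`, whose manifold structure is the one for which
`(U, g) ↦ (g, λ)` is an embedding onto the submanifold `|λ² Det_j C_g| = 1` of
`Sp(V, Ω) × ℂ ⊆ End(V) × ℂ`. -/
def SmoothToMpc (F : H → Mpc ħ j) : Prop :=
  ContMDiff 𝓘(ℝ, E) 𝓘(ℝ, (V →L[ℝ] V) × ℂ) ∞ fun h => (toEnd (sigma ħ j (F h)), lam (F h))

variable (E H ħ j) in
/-- A lift of `H` to `Mp^c(V, Ω, j)`: a smooth homomorphism `F` with `σ ∘ F = Id_H`. -/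
@[ext]
structure Lift where
  F : H →* Mpc ħ j
  smooth : SmoothToMpc E F
  sigma_eq : ∀ h, sigma ħ j (F h) = h.1

variable (E H) in
/-- `Hom(H, U(1))`: the smooth homomorphisms from `H` to the circle, under pointwise
multiplication. -/
def SmoothHom : Subgroup (H →* Circle) where
  carrier := {χ | ContMDiff 𝓘(ℝ, E) (𝓡 1) ∞ χ}
  one_mem' := contMDiff_const
  mul_mem' := by
    intro a b ha hb
    have : LieGroup (𝓡 1) ∞ Circle := LieGroup.of_le (n := ω) le_top
    exact ContMDiff.mul (I' := 𝓘(ℝ, E)) (I := 𝓡 1) ha hb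
  inv_mem' := by
    intro a ha
    have : LieGroup (𝓡 1) ∞ Circle := LieGroup.of_le (n := ω) le_top
    exact ContMDiff.inv (I' := 𝓘(ℝ, E)) (I := 𝓡 1) ha

/-- The homomorphism `h ↦ χ(h) F(h)`. -/
noncomputable def twist (χ : H →* Circle) (F : H →* Mpc ħ j) : H →* Mpc ħ j where
  toFun h := scalar ħ j (χ h) * F h
  map_one' := by simp
  map_mul' a b := by
    rw [map_mul, map_mul, map_mul, mul_assoc, mul_assoc, ← mul_assoc (F a),
      ← scalar_comm, mul_assoc]

theorem twist_apply (χ : H →* Circle) (F : H →* Mpc ħ j) (h : H) :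
    twist χ F h = scalar ħ j (χ h) * F h := rfl

theorem sigma_twist (χ : H →* Circle) (F : H →* Mpc ħ j) (h : H) :
    sigma ħ j (twist χ F h) = sigma ħ j (F h) := by
  rw [twist_apply, map_mul]
  exact one_mul _

theorem lam_twist (χ : H →* Circle) (F : H →* Mpc ħ j) (h : H) :
    lam (twist χ F h) = χ h * lam (F h) := rfl

theorem smooth_twist {χ : H →* Circle} (hχ : ContMDiff 𝓘(ℝ, E) (𝓡 1) ∞ χ)
    {F : H →* Mpc ħ j} (hF : SmoothToMpc E F) : SmoothToMpc E (twist χ F) := by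
  unfold SmoothToMpc at hF ⊢
  have h1 : ContMDiff 𝓘(ℝ, E) 𝓘(ℝ, V →L[ℝ] V) ∞ fun h => toEnd (sigma ħ j (F h)) :=
    contDiff_fst.contMDiff.comp hF
  have h2 : ContMDiff 𝓘(ℝ, E) 𝓘(ℝ, ℂ) ∞ fun h => lam (F h) :=
    contDiff_snd.contMDiff.comp hF
  have h3 : ContMDiff 𝓘(ℝ, E) 𝓘(ℝ, ℂ) ∞ fun h => (χ h : ℂ) :=
    have := Complex.finrank_real_complex_fact
    (contMDiff_coe_sphere (E := ℂ) (n := 1)).comp hχ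
  have h4 : ContMDiff 𝓘(ℝ, E) 𝓘(ℝ, ℂ) ∞ fun h => (χ h : ℂ) * lam (F h) :=
    contDiff_mul.contMDiff.comp (h3.prodMk_space h2)
  have h5 := h1.prodMk_space h4
  simp only [sigma_twist, lam_twist]
  exact h5

/-- The action of `Hom(H, U(1))` on the lifts of `H`: `(χ • F)(h) = χ(h) F(h)`. -/
noncomputable instance : SMul (SmoothHom E H) (Lift E H ħ j) where
  smul χ L :=
    { F := twist χ.1 L.F
      smooth := smooth_twist χ.2 L.smooth
      sigma_eq := fun h => (sigma_twist χ.1 L.F h).trans (L.sigma_eq h) }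

theorem smul_F (χ : SmoothHom E H) (L : Lift E H ħ j) (h : H) :
    (χ • L).F h = scalar ħ j (χ.1 h) * L.F h := rfl

noncomputable instance : MulAction (SmoothHom E H) (Lift E H ħ j) where
  one_smul L := by
    apply Lift.ext
    ext1 h
    rw [smul_F]
    simp
  mul_smul a b L := by
    apply Lift.ext
    ext1 h
    simp only [smul_F, Subgroup.coe_mul, MonoidHom.mul_apply, map_mul, mul_assoc]

end Lie

end SympLift

open SympLift

namespace SympLift

open scoped Topology

noncomputable section

/-! ### Holomorphic dependence on a parameter -/

section Param

/-! The group Mp^c is governed by parameters. The map (U, g) ↦ (g, λ) is a bijection onto the pairs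
with |λ² Det C_g| = 1 (`existsUnique_hasParameters`, `hasParameters_lam`), and λ multiplies with the
extra factor exp(-½ a(1 - Z_{g₁} Z_{g₂⁻¹})) (`lam_mul`). A lift F therefore amounts to the smooth
function f = λ ∘ F with the stated identity and norm, which is the criterion for liftability. By
Schur's lemma two elements over the same g differ by a unique central scalar (`exists_scalar_mul`),
so two lifts differ by the smooth character λ(F')/λ(F). For the sufficient criterion, both sides of
the identity for f have the same square, because C_{g₁g₂} = C_{g₁}(1 - Z_{g₁}Z_{g₂⁻¹})C_{g₂}
(`C_mul`). Their ratio is a continuous sign on each product of connected components, and it is 1 at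
points of H₁ × H₁, where Z vanishes (`mul_eq_of_unitary`).

Existence of an operator with given parameters: the prescribed images of the coherent states have a
Gram matrix proportional to that of the coherent states (`inner_kerState`). The diagonal entries
come from unitarity of the Heisenberg operators, the others by analytic continuation. Coherent
states span a dense subspace of the complete Fock space, so an isometry exists
(`exists_isometry_of_gram`), and the kernel of g⁻¹ provides its inverse.

The multiplication law is a Gaussian integral: λ(xy) = ⟨x⁻¹e₀, y e₀⟩ is the integral of exp(-(⟨Yz,
z⟩ + ⟨z, Wz⟩)/4ħ) with Y = Z_{g₁}, W = Z_{g₂⁻¹}, up to the factor λ(x)λ(y). For Y = W it is a real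
Gaussian, analytic continuation yields its square in general (`gaussInt_sq`), and shrinking Y and W
to 0 fixes the sign (`gaussInt_eq_exp`). -/

theorem differentiableOn_integral_of_dominated {α : Type*} [MeasurableSpace α] {μ : Measure α}
    {F : ℂ → α → ℂ} {S : Set ℂ} (hS : IsOpen S)
    (hmeas : ∀ τ ∈ S, AEStronglyMeasurable (F τ) μ)
    (hdiff : ∀ z, Differentiable ℂ fun τ => F τ z)
    (hbound : ∀ τ ∈ S, ∃ ε > 0, ∃ B : α → ℝ, Integrable B μ ∧
      ∀ τ' ∈ Metric.ball τ ε, ∀ z, ‖F τ' z‖ ≤ B z) :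
    DifferentiableOn ℂ (fun τ => ∫ z, F τ z ∂μ) S := by
  intro τ hτ
  obtain ⟨ε, hε, B, hB, hFB⟩ := hbound τ hτ
  -- Cauchy's estimate on the circle of radius ε/4 about τ', which stays in the ball where B
  -- dominates. A bound on the functions thus suffices.
  have hderiv : ∀ z, ∀ τ' ∈ Metric.ball τ (ε / 2), ‖deriv (fun τ => F τ z) τ'‖ ≤ B z / (ε / 4) := by
    intro z τ' hτ'
    refine Complex.norm_deriv_le_of_forall_mem_sphere_norm_le (by positivity)
      (hdiff z).diffContOnCl fun w hw => hFB w ?_ z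
    rw [Metric.mem_ball] at hτ' ⊢
    rw [Metric.mem_sphere] at hw
    have := dist_triangle w τ' τ
    linarith
  have hm : ∀ᶠ x in 𝓝 τ, AEStronglyMeasurable (F x) μ := by
    filter_upwards [hS.mem_nhds hτ] with x hx using hmeas x hx
  -- The derivative is a pointwise limit of difference quotients along a sequence, hence measurable.
  have hm' : AEStronglyMeasurable (fun z => deriv (fun τ => F τ z) τ) μ := by
    obtain ⟨δ, hδ, hδS⟩ := Metric.isOpen_iff.mp hS τ hτ
    obtain ⟨u, hu, huδ⟩ : ∃ u : ℕ → ℂ, Filter.Tendsto u Filter.atTop (𝓝[≠] 0) ∧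
        ∀ n, τ + u n ∈ Metric.ball τ δ := by
      have h1 : ∀ n : ℕ, 0 < δ / 2 * (1 / ((n : ℝ) + 1)) := fun n => by positivity
      refine ⟨fun n => ((δ / 2 * (1 / ((n : ℝ) + 1)) : ℝ) : ℂ), ?_, fun n => ?_⟩
      · rw [tendsto_nhdsWithin_iff]
        constructor
        · rw [← Complex.ofReal_zero]
          refine (Complex.continuous_ofReal.tendsto 0).comp ?_
          have := (tendsto_one_div_add_atTop_nhds_zero_nat (𝕜 := ℝ)).const_mul (δ / 2)
          rwa [mul_zero] at this
        · refine Filter.Eventually.of_forall fun n => ?_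
          exact Complex.ofReal_ne_zero.mpr (h1 n).ne'
      · rw [Metric.mem_ball, dist_self_add_left, Complex.norm_real, Real.norm_eq_abs,
          abs_of_pos (h1 n)]
        have h2 : 1 / ((n : ℝ) + 1) ≤ 1 :=
          div_le_one_of_le₀ (by linarith [n.cast_nonneg (α := ℝ)]) (by positivity)
        nlinarith
    refine aestronglyMeasurable_of_tendsto_ae Filter.atTop
      (f := fun n z => (u n)⁻¹ • (F (τ + u n) z - F τ z)) (fun n => ?_) ?_
    · have h1 : AEStronglyMeasurable (fun z => F (τ + u n) z - F τ z) μ :=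
        (hmeas _ (hδS (huδ n))).sub (hmeas τ hτ)
      exact h1.const_mul (u n)⁻¹
    · refine Filter.Eventually.of_forall fun z => ?_
      exact ((hdiff z τ).hasDerivAt.tendsto_slope_zero).comp hu
  have hF0 : Integrable (F τ) μ := hB.mono' (hmeas τ hτ)
    (Filter.Eventually.of_forall fun z => hFB τ (Metric.mem_ball_self hε) z)
  have := hasDerivAt_integral_of_dominated_loc_of_deriv_le (μ := μ) (F := F)
    (F' := fun τ z => deriv (fun τ => F τ z) τ) (bound := fun z => B z / (ε / 4))
    (Metric.ball_mem_nhds τ (half_pos hε)) hm hF0 hm'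
    (Filter.Eventually.of_forall hderiv) (hB.div_const _)
    (Filter.Eventually.of_forall fun z x _ => (hdiff z x).hasDerivAt)
  exact this.2.differentiableAt.differentiableWithinAt

/-- A holomorphic function on a convex domain is determined by its values at real points. -/
theorem eqOn_of_eq_on_reals {S : Set ℂ} (hS : IsOpen S) (hc : Convex ℝ S) (h0 : (0 : ℂ) ∈ S)
    {f g : ℂ → ℂ} (hf : DifferentiableOn ℂ f S) (hg : DifferentiableOn ℂ g S)
    (h : ∀ t : ℝ, (t : ℂ) ∈ S → f t = g t) : Set.EqOn f g S := by
  refine (hf.analyticOnNhd hS).eqOn_of_preconnected_of_frequently_eq (hg.analyticOnNhd hS)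
    hc.isPreconnected h0 ?_
  have hu : Filter.Tendsto (fun t : ℝ => (t : ℂ)) (𝓝[≠] 0) (𝓝[≠] 0) := by
    rw [tendsto_nhdsWithin_iff]
    constructor
    · have := Complex.continuous_ofReal.tendsto 0
      rw [Complex.ofReal_zero] at this
      exact this.mono_left nhdsWithin_le_nhds
    · filter_upwards [self_mem_nhdsWithin] with t ht
      simpa using ht
  refine hu.frequently (Filter.Eventually.frequently ?_)
  have : ∀ᶠ t : ℝ in 𝓝[≠] 0, (t : ℂ) ∈ S := by
    have h1 : ∀ᶠ z : ℂ in 𝓝[≠] 0, z ∈ S := nhdsWithin_le_nhds (hS.mem_nhds h0)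
    exact hu.eventually h1
  filter_upwards [this] with t ht using h t ht

end Param

/-! ### The Gaussian measure -/

section Gauss

variable (E : Type*) [NormedAddCommGroup E] [InnerProductSpace ℂ E] [FiniteDimensional ℂ E]
  [MeasurableSpace E] [BorelSpace E]

attribute [local instance] InnerProductSpace.complexToReal

/-- The density `h^{-n} e^{-|z|²/2ħ}`. -/
def gaussDensity (ħ : ℝ) (z : E) : NNReal :=
  Real.toNNReal (((2 * Real.pi * ħ) ^ Module.finrank ℂ E)⁻¹ * Real.exp (-‖z‖ ^ 2 / (2 * ħ)))

/-- The Gaussian measure `h^{-n} e^{-|z|²/2ħ} dz`. -/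
def gaussMeasure (ħ : ℝ) : Measure E :=
  volume.withDensity fun z => (gaussDensity E ħ z : ENNReal)

variable {E} {ħ : ℝ}

theorem continuous_gaussDensity : Continuous (gaussDensity E ħ) := by
  unfold gaussDensity
  fun_prop

theorem gaussDensity_coe (hħ : 0 < ħ) (z : E) : (gaussDensity E ħ z : ℝ) =
    ((2 * Real.pi * ħ) ^ Module.finrank ℂ E)⁻¹ * Real.exp (-‖z‖ ^ 2 / (2 * ħ)) :=
  Real.coe_toNNReal _ (by positivity)

theorem integral_gaussMeasure {F : Type*} [NormedAddCommGroup F] [NormedSpace ℝ F]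
    (hħ : 0 < ħ) (f : E → F) : ∫ z, f z ∂gaussMeasure E ħ =
      ((2 * Real.pi * ħ) ^ Module.finrank ℂ E)⁻¹ • ∫ z, Real.exp (-‖z‖ ^ 2 / (2 * ħ)) • f z := by
  unfold gaussMeasure
  rw [integral_withDensity_eq_integral_smul continuous_gaussDensity.measurable, ← integral_smul]
  refine integral_congr_ae (Filter.Eventually.of_forall fun z => ?_)
  simp only
  rw [NNReal.smul_def, gaussDensity_coe hħ, mul_smul]

theorem integrable_gaussMeasure_iff {F : Type*} [NormedAddCommGroup F] [NormedSpace ℝ F]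
    (hħ : 0 < ħ) (f : E → F) : Integrable f (gaussMeasure E ħ) ↔
      Integrable fun z => Real.exp (-‖z‖ ^ 2 / (2 * ħ)) • f z := by
  unfold gaussMeasure
  rw [integrable_withDensity_iff_integrable_smul continuous_gaussDensity.measurable]
  have h : (fun z => gaussDensity E ħ z • f z) = fun z =>
      ((2 * Real.pi * ħ) ^ Module.finrank ℂ E)⁻¹ • Real.exp (-‖z‖ ^ 2 / (2 * ħ)) • f z := by
    funext z
    rw [NNReal.smul_def, gaussDensity_coe hħ, mul_smul]
  have hc : ((2 * Real.pi * ħ) ^ Module.finrank ℂ E)⁻¹ ≠ 0 := by positivity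
  rw [h]
  exact integrable_fun_smul_iff hc _

theorem integrable_rexp_neg_mul_sq_norm {b : ℝ} (hb : 0 < b) :
    Integrable fun z : E => Real.exp (-b * ‖z‖ ^ 2) := by
  have h := (GaussianFourier.integrable_cexp_neg_mul_sq_norm_add (V := E)
    (b := (b : ℂ)) (by simpa using hb) 0 0).norm
  refine h.congr (Filter.Eventually.of_forall fun z => ?_)
  simp only [zero_mul, add_zero, Complex.norm_exp]
  congr 1
  have : -(b : ℂ) * (‖z‖ : ℂ) ^ 2 = ((-b * ‖z‖ ^ 2 : ℝ) : ℂ) := by push_cast; ring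
  rw [this, Complex.ofReal_re]

theorem integrable_exp_quadratic (hħ : 0 < ħ) {κ : ℝ} (hκ : κ < 1 / (2 * ħ)) (b : ℝ) :
    Integrable (fun z : E => Real.exp (κ * ‖z‖ ^ 2 + b * ‖z‖)) (gaussMeasure E ħ) := by
  rw [integrable_gaussMeasure_iff hħ]
  set δ := 1 / (2 * ħ) - κ with hδ
  have hδ0 : 0 < δ := by linarith
  refine ((integrable_rexp_neg_mul_sq_norm (E := E) (half_pos hδ0)).const_mul
    (Real.exp (b ^ 2 / (2 * δ)))).mono' (by fun_prop) (Filter.Eventually.of_forall fun z => ?_)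
  rw [smul_eq_mul, ← Real.exp_add, ← Real.exp_add, Real.norm_of_nonneg (Real.exp_pos _).le,
    Real.exp_le_exp]
  -- Completing the square absorbs the linear term into half of the gap δ; the other half keeps the
  -- Gaussian decay.
  have h1 : b * ‖z‖ ≤ δ / 2 * ‖z‖ ^ 2 + b ^ 2 / (2 * δ) := by
    have : δ / 2 * ‖z‖ ^ 2 + b ^ 2 / (2 * δ) - b * ‖z‖ = (δ * ‖z‖ - b) ^ 2 / (2 * δ) := by
      field_simp
      ring
    have h2 : 0 ≤ (δ * ‖z‖ - b) ^ 2 / (2 * δ) := by positivity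
    linarith
  have h3 : -‖z‖ ^ 2 / (2 * ħ) = -(1 / (2 * ħ)) * ‖z‖ ^ 2 := by ring
  rw [h3]
  have h4 : κ = 1 / (2 * ħ) - δ := by rw [hδ]; ring
  rw [h4]
  nlinarith

theorem isProbabilityMeasure_gaussMeasure (hħ : 0 < ħ) :
    IsProbabilityMeasure (gaussMeasure E ħ) := by
  have h0 : IsFiniteMeasure (gaussMeasure E ħ) := by
    have h := integrable_exp_quadratic (E := E) hħ (κ := 0) (by positivity) 0
    simp only [zero_mul, add_zero, Real.exp_zero] at h
    exact (integrable_const_iff.mp h).resolve_left one_ne_zero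
  constructor
  have h1 : ∫ z, (1 : ℝ) ∂gaussMeasure E ħ = 1 := by
    rw [integral_gaussMeasure hħ]
    simp only [smul_eq_mul, mul_one]
    have h2 : (fun z : E => Real.exp (-‖z‖ ^ 2 / (2 * ħ)))
        = fun z => Real.exp (-(1 / (2 * ħ)) * ‖z‖ ^ 2) := by
      funext z
      congr 1
      ring
    rw [h2, GaussianFourier.integral_rexp_neg_mul_sq_norm (by positivity)]
    rw [finrank_real_of_complex]
    have h3 : Real.pi / (1 / (2 * ħ)) = 2 * Real.pi * ħ := by field_simp
    rw [h3]
    push_cast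
    rw [mul_div_cancel_left₀ _ (two_ne_zero), Real.rpow_natCast]
    exact inv_mul_cancel₀ (by positivity)
  simp only [integral_const, smul_eq_mul, mul_one] at h1
  rwa [measureReal_def, ENNReal.toReal_eq_one_iff] at h1

/-- Full support lets a holomorphic function be recovered from its almost everywhere class. -/
theorem isOpenPosMeasure_gaussMeasure (hħ : 0 < ħ) :
    (gaussMeasure E ħ).IsOpenPosMeasure := by
  have : volume ≪ gaussMeasure E ħ := by
    refine withDensity_absolutelyContinuous' ?_ ?_
    · exact continuous_gaussDensity.measurable.coe_nnreal_ennreal.aemeasurable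
    · refine Filter.Eventually.of_forall fun z => ?_
      have : 0 < (gaussDensity E ħ z : ℝ) := by rw [gaussDensity_coe hħ]; positivity
      exact_mod_cast this.ne'
  exact this.isOpenPosMeasure

/-- The Gaussian measure is invariant under rotations, in particular by scalars of modulus one. -/
theorem integral_gaussMeasure_comp_isometry {F : Type*} [NormedAddCommGroup F] [NormedSpace ℝ F]
    (hħ : 0 < ħ) (e : E ≃ₗᵢ[ℝ] E) (f : E → F) :
    ∫ z, f (e z) ∂gaussMeasure E ħ = ∫ z, f z ∂gaussMeasure E ħ := by
  rw [integral_gaussMeasure hħ, integral_gaussMeasure hħ]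
  congr 1
  rw [← e.measurePreserving.integral_comp e.toHomeomorph.measurableEmbedding
    (fun z => Real.exp (-‖z‖ ^ 2 / (2 * ħ)) • f z)]
  simp

end Gauss

/-! ### Mean value property for the Gaussian measure. -/

section MeanValue

variable {E : Type*} [NormedAddCommGroup E] [InnerProductSpace ℂ E] [FiniteDimensional ℂ E]
  [MeasurableSpace E] [BorelSpace E] {ħ : ℝ}

attribute [local instance] InnerProductSpace.complexToReal

theorem integrable_gaussMeasure_comp_isometry (hħ : 0 < ħ) (e : E ≃ₗᵢ[ℝ] E) {f : E → ℂ}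
    (hf : Integrable f (gaussMeasure E ħ)) :
    Integrable (fun z => f (e z)) (gaussMeasure E ħ) := by
  rw [integrable_gaussMeasure_iff hħ] at hf ⊢
  have := (e.measurePreserving.integrable_comp_emb e.toHomeomorph.measurableEmbedding).mpr hf
  simpa [Function.comp_def] using this

/-- Multiplication by a complex number of modulus one. -/
def rotation (c : ℂ) (hc : ‖c‖ = 1) : E ≃ₗᵢ[ℝ] E where
  toLinearEquiv := (LinearEquiv.smulOfNeZero ℂ E c
    (fun h => by simp [h] at hc)).restrictScalars ℝ
  norm_map' z := by
    change ‖c • z‖ = ‖z‖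
    rw [norm_smul, hc, one_mul]

theorem norm_circleMap_zero_one (θ : ℝ) : ‖circleMap 0 1 θ‖ = 1 := by simp

/-- The mean value property of holomorphic functions with respect to the Gaussian measure. -/
theorem integral_gaussMeasure_of_differentiable (hħ : 0 < ħ) {f : E → ℂ}
    (hf : Differentiable ℂ f) (hi : Integrable f (gaussMeasure E ħ)) :
    ∫ z, f z ∂gaussMeasure E ħ = f 0 := by
  have := isProbabilityMeasure_gaussMeasure (E := E) hħ
  have h1 : ∀ θ : ℝ, ∫ z, f (circleMap 0 1 θ • z) ∂gaussMeasure E ħ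
      = ∫ z, f z ∂gaussMeasure E ħ := fun θ =>
    integral_gaussMeasure_comp_isometry hħ (rotation _ (norm_circleMap_zero_one θ)) f
  -- On the complex line through z the function is entire, so its mean over the unit circle is f 0.
  -- Integrating `h1` over θ and exchanging the integrals concludes.
  have h2 : ∀ z : E, ∫ θ in (0 : ℝ)..2 * Real.pi, f (circleMap 0 1 θ • z) = 2 * Real.pi * f 0 := by
    intro z
    have hd : Differentiable ℂ fun w : ℂ => f (w • z) := hf.comp (differentiable_id.smul_const z)
    have := (hd.diffContOnCl (s := Metric.ball 0 |1|)).circleAverage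
    rw [Real.circleAverage_def] at this
    simp only [zero_smul] at this
    rw [← this, Complex.real_smul]
    push_cast
    have : (Real.pi : ℂ) ≠ 0 := Complex.ofReal_ne_zero.mpr Real.pi_ne_zero
    field_simp
  have hint : Integrable (Function.uncurry fun (θ : ℝ) (z : E) => f (circleMap 0 1 θ • z))
      ((volume.restrict (Set.uIoc 0 (2 * Real.pi))).prod (gaussMeasure E ħ)) := by
    have hc : Continuous (Function.uncurry fun (θ : ℝ) (z : E) => f (circleMap 0 1 θ • z)) :=
      hf.continuous.comp (((continuous_circleMap 0 1).comp continuous_fst).smul continuous_snd)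
    rw [integrable_prod_iff hc.aestronglyMeasurable]
    constructor
    · refine Filter.Eventually.of_forall fun θ => ?_
      exact integrable_gaussMeasure_comp_isometry hħ (rotation _ (norm_circleMap_zero_one θ)) hi
    · have h3 : ∀ θ : ℝ, ∫ z, ‖f (circleMap 0 1 θ • z)‖ ∂gaussMeasure E ħ
          = ∫ z, ‖f z‖ ∂gaussMeasure E ħ :=
        fun θ => integral_gaussMeasure_comp_isometry hħ
          (rotation _ (norm_circleMap_zero_one θ)) fun z => ‖f z‖
      simp only [Function.uncurry_apply_pair, h3]
      exact integrableOn_const (by rw [Set.uIoc, Real.volume_Ioc]; exact ENNReal.ofReal_ne_top)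
  have h4 := intervalIntegral_integral_swap hint
  simp only [h1, h2] at h4
  rw [intervalIntegral.integral_const, integral_const] at h4
  have hpi : (Real.pi : ℂ) ≠ 0 := Complex.ofReal_ne_zero.mpr Real.pi_ne_zero
  simp only [sub_zero, probReal_univ, one_smul, Complex.real_smul] at h4
  push_cast at h4
  exact mul_left_cancel₀ (mul_ne_zero two_ne_zero hpi) h4

end MeanValue

/-! ### Gaussian integrals of antilinear quadratic forms: the diagonal case. -/

section GaussInt

variable {E : Type*} [NormedAddCommGroup E] [InnerProductSpace ℂ E] [FiniteDimensional ℂ E]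
  [MeasurableSpace E] [BorelSpace E] {ħ : ℝ}

attribute [local instance] InnerProductSpace.complexToReal

/-- An antilinear map `Y` is symmetric if `⟨Y x, y⟩ = ⟨Y y, x⟩`. -/
def IsSymmAnti (Y : E →SL[starRingEnd ℂ] E) : Prop :=
  ∀ x y, inner ℂ y (Y x) = inner ℂ x (Y y)

/-- The function `exp (-(⟨Y z, z⟩ + ⟨z, W z⟩) / 4ħ)`. -/
def quadExp (ħ : ℝ) (Y W : E →SL[starRingEnd ℂ] E) (z : E) : ℂ :=
  Complex.exp (-(inner ℂ z (Y z) + inner ℂ (W z) z) / (4 * ħ))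

/-- The Gaussian integral of `quadExp`. -/
def gaussInt (ħ : ℝ) (Y W : E →SL[starRingEnd ℂ] E) : ℂ :=
  ∫ z, quadExp ħ Y W z ∂gaussMeasure E ħ

theorem norm_quadExp_le (hħ : 0 < ħ) (Y W : E →SL[starRingEnd ℂ] E) (z : E) :
    ‖quadExp ħ Y W z‖ ≤ Real.exp ((‖Y‖ + ‖W‖) / (4 * ħ) * ‖z‖ ^ 2) := by
  unfold quadExp
  refine (Complex.norm_exp_le_exp_norm _).trans (Real.exp_le_exp.mpr ?_)
  rw [norm_div, norm_neg]
  have h1 : ‖(4 * ħ : ℂ)‖ = 4 * ħ := by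
    rw [norm_mul, Complex.norm_real, Real.norm_of_nonneg hħ.le]; simp
  rw [h1, div_mul_eq_mul_div]
  refine div_le_div_of_nonneg_right ?_ (by positivity)
  have h2 : ‖inner ℂ z (Y z)‖ ≤ ‖z‖ * (‖Y‖ * ‖z‖) :=
    (norm_inner_le_norm _ _).trans (mul_le_mul_of_nonneg_left (Y.le_opNorm z) (norm_nonneg _))
  have h3 : ‖inner ℂ (W z) z‖ ≤ (‖W‖ * ‖z‖) * ‖z‖ :=
    (norm_inner_le_norm _ _).trans (mul_le_mul_of_nonneg_right (W.le_opNorm z) (norm_nonneg _))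
  have := norm_add_le (inner ℂ z (Y z)) (inner ℂ (W z) z)
  nlinarith

theorem continuous_quadExp (Y W : E →SL[starRingEnd ℂ] E) : Continuous (quadExp ħ Y W) := by
  unfold quadExp
  have h1 := Y.continuous
  have h2 := W.continuous
  fun_prop

/-- The real linear map `1 + Y`. -/
def onePlus (Y : E →SL[starRingEnd ℂ] E) : E →ₗ[ℝ] E where
  toFun z := z + Y z
  map_add' x y := by rw [map_add]; abel
  map_smul' r x := by
    have : Y (r • x) = r • Y x := by
      rw [← Complex.coe_smul r x, Y.map_smulₛₗ, Complex.conj_ofReal, Complex.coe_smul]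
    rw [this, smul_add, RingHom.id_apply]

theorem onePlus_apply (Y : E →SL[starRingEnd ℂ] E) (z : E) : onePlus Y z = z + Y z := rfl

theorem isSymmetric_onePlus {Y : E →SL[starRingEnd ℂ] E} (hY : IsSymmAnti Y) :
    (onePlus Y).IsSymmetric := by
  intro x y
  rw [onePlus_apply, onePlus_apply, inner_add_left, inner_add_right]
  congr 1
  change (inner ℂ (Y x) y).re = (inner ℂ x (Y y)).re
  rw [← hY x y, ← inner_conj_symm, Complex.conj_re]

/-- Conjugation by multiplication by i turns the antilinear Y into -Y and fixes 1. -/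
theorem det_onePlus_neg (Y : E →SL[starRingEnd ℂ] E) :
    LinearMap.det (onePlus (-Y)) = LinearMap.det (onePlus Y) := by
  let e : E ≃ₗ[ℝ] E := (LinearEquiv.smulOfNeZero ℂ E Complex.I Complex.I_ne_zero).restrictScalars ℝ
  rw [← LinearMap.det_conj (onePlus Y) e]
  congr 1
  ext z
  have h1 : e.symm z = -(Complex.I • z) := by
    rw [LinearEquiv.symm_apply_eq]
    change z = Complex.I • -(Complex.I • z)
    rw [smul_neg, smul_smul, Complex.I_mul_I, neg_smul, neg_neg, one_smul]
  have h2 : ∀ w, e w = Complex.I • w := fun _ => rfl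
  simp only [LinearMap.coe_comp, LinearEquiv.coe_coe, Function.comp_apply, h1, h2, onePlus_apply,
    map_neg, Y.map_smulₛₗ, Complex.conj_I, smul_add, smul_neg, smul_smul, neg_smul,
    Complex.I_mul_I, neg_apply, one_smul, neg_neg]
  abel

/-- The product (1 + Y)(1 - Y) = 1 - Y² is complex linear, and the real determinant of a complex
linear map is the squared modulus of its complex one. Both factors have the same real determinant.
-/
theorem det_onePlus_sq (Y : E →SL[starRingEnd ℂ] E) :
    LinearMap.det (onePlus Y) ^ 2 = Complex.normSq (1 - Y.comp Y : E →L[ℂ] E).det := by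
  have h1 : onePlus Y * onePlus (-Y) = ((1 - Y.comp Y : E →L[ℂ] E) : E →ₗ[ℂ] E).restrictScalars ℝ := by
    ext z
    simp [onePlus_apply, sub_eq_add_neg]
  rw [ContinuousLinearMap.det, ← Algebra.norm_complex_apply, ← LinearMap.det_restrictScalars, ← h1,
    map_mul, det_onePlus_neg, sq]

theorem isSymmetric_one_sub_sq {Y : E →SL[starRingEnd ℂ] E} (hY : IsSymmAnti Y) :
    ((1 - Y.comp Y : E →L[ℂ] E) : E →ₗ[ℂ] E).IsSymmetric := by
  intro x y
  simp only [ContinuousLinearMap.coe_coe, sub_apply, inner_sub_left,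
    inner_sub_right, one_apply_eq_self, ContinuousLinearMap.comp_apply]
  congr 1
  rw [hY (Y y) x, ← inner_conj_symm, hY (Y x) y, inner_conj_symm]

/-- The map 1 - Y² is Hermitean, and its eigenvalues are at least 1 - ‖Y‖². -/
theorem det_one_sub_sq_pos {Y : E →SL[starRingEnd ℂ] E} (hY : IsSymmAnti Y) (h1 : ‖Y‖ < 1) :
    ∃ d : ℝ, 0 < d ∧ (1 - Y.comp Y : E →L[ℂ] E).det = d := by
  have hS := isSymmetric_one_sub_sq hY
  refine ⟨∏ i, hS.eigenvalues rfl i, Finset.prod_pos fun i _ => ?_, ?_⟩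
  · set b := hS.eigenvectorBasis rfl with hb
    have h2 := hS.apply_eigenvectorBasis rfl i
    generalize hS.eigenvalues rfl i = l at h2 ⊢
    have h3 := congrArg (fun x => (inner ℂ (b i) x).re) h2
    simp only [ContinuousLinearMap.coe_coe, sub_apply, inner_sub_right,
      one_apply_eq_self, ContinuousLinearMap.comp_apply, inner_smul_right, ← hb,
      inner_self_eq_norm_sq_to_K, b.norm_eq_one] at h3
    have h4 : ‖inner ℂ (b i) (Y (Y (b i)))‖ ≤ ‖Y‖ * ‖Y‖ := by
      refine (norm_inner_le_norm _ _).trans ?_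
      rw [b.norm_eq_one, one_mul]
      have h5 := Y.le_opNorm (Y (b i))
      have h6 := Y.le_opNorm (b i)
      rw [b.norm_eq_one, mul_one] at h6
      exact h5.trans (mul_le_mul_of_nonneg_left h6 (norm_nonneg _))
    have h7 := Complex.re_le_norm (inner ℂ (b i) (Y (Y (b i))))
    have h8 := norm_nonneg Y
    simp at h3
    nlinarith
  · rw [ContinuousLinearMap.det, hS.det_eq_prod_eigenvalues rfl]
    push_cast
    rfl

theorem sqrt_prod_eq {n : ℕ} (l : Fin n → ℝ) (hl : ∀ i, 0 < l i) (hħ : 0 < ħ) :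
    (∏ i, √(Real.pi / (l i / (2 * ħ)))) ^ 2 = (2 * Real.pi * ħ) ^ n / ∏ i, l i := by
  rw [← Finset.prod_pow]
  have : ∀ i, √(Real.pi / (l i / (2 * ħ))) ^ 2 = (2 * Real.pi * ħ) / l i := by
    intro i
    have := hl i
    rw [Real.sq_sqrt (by positivity)]
    field_simp
  simp only [this]
  rw [Finset.prod_div_distrib, Finset.prod_const, Finset.card_univ, Fintype.card_fin]

/-- In an orthonormal eigenbasis of T the integral is a product of one-dimensional Gaussians.
Squaring avoids the root of the determinant. -/
theorem integral_exp_neg_symmetric {T : E →ₗ[ℝ] E} (hT : T.IsSymmetric) (hħ : 0 < ħ)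
    (hpos : ∀ x, x ≠ 0 → 0 < inner ℝ x (T x)) :
    0 < LinearMap.det T ∧
    (∫ z : E, Real.exp (-(inner ℝ z (T z)) / (2 * ħ))) ^ 2
      = (2 * Real.pi * ħ) ^ Module.finrank ℝ E / LinearMap.det T := by
  set b := hT.eigenvectorBasis rfl with hb
  set l := hT.eigenvalues rfl with hl
  have hl0 : ∀ i, 0 < l i := by
    intro i
    have h := hpos (b i) (b.orthonormal.ne_zero i)
    rw [hb, hT.apply_eigenvectorBasis rfl i, inner_smul_right, ← hb, real_inner_self_eq_norm_sq,
      b.norm_eq_one] at h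
    simpa using h
  have hdet : LinearMap.det T = ∏ i, l i := by
    rw [hT.det_eq_prod_eigenvalues rfl]
    rfl
  rw [hdet]
  refine ⟨Finset.prod_pos fun i _ => hl0 i, ?_⟩
  rw [← sqrt_prod_eq l hl0 hħ]
  congr 1
  have h1 : ∀ x : Fin (Module.finrank ℝ E) → ℝ,
      Real.exp (-(inner ℝ (b.repr.symm (WithLp.toLp 2 x)) (T (b.repr.symm (WithLp.toLp 2 x)))) / (2 * ħ))
      = ∏ i, Real.exp (-(l i / (2 * ħ)) * x i ^ 2) := by
    intro x
    rw [← Real.exp_sum]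
    congr 1
    have h2 : T (b.repr.symm (WithLp.toLp 2 x)) = ∑ i, (x i * l i) • b i := by
      rw [← b.sum_repr_symm, map_sum]
      refine Finset.sum_congr rfl fun i _ => ?_
      rw [map_smul, hb, hT.apply_eigenvectorBasis rfl i, smul_smul]
      rfl
    rw [h2, inner_sum, ← Finset.sum_neg_distrib, Finset.sum_div]
    refine Finset.sum_congr rfl fun i _ => ?_
    rw [inner_smul_right, real_inner_comm, ← b.repr_apply_apply, LinearIsometryEquiv.apply_symm_apply]
    ring
  rw [← b.repr.symm.measurePreserving.integral_comp b.repr.symm.toHomeomorph.measurableEmbedding,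
    ← (PiLp.volume_preserving_toLp _).integral_comp
      (MeasurableEquiv.toLp 2 _).measurableEmbedding]
  simp only [h1]
  rw [volume_pi, integral_fintype_prod_eq_prod (fun i (x : ℝ) => Real.exp (-(l i / (2 * ħ)) * x ^ 2))]
  simp only [integral_gaussian]

theorem inner_onePlus_pos {Y : E →SL[starRingEnd ℂ] E} (h1 : ‖Y‖ < 1) (x : E) (hx : x ≠ 0) :
    0 < inner ℝ x (onePlus Y x) := by
  rw [onePlus_apply, inner_add_right, real_inner_self_eq_norm_sq]
  have h2 : ‖inner ℝ x (Y x)‖ ≤ ‖x‖ * (‖Y‖ * ‖x‖) :=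
    (norm_inner_le_norm _ _).trans (mul_le_mul_of_nonneg_left (Y.le_opNorm x) (norm_nonneg _))
  have h3 := neg_le_of_abs_le h2
  have h4 : 0 < ‖x‖ := norm_pos_iff.mpr hx
  have h5 : 0 < ‖x‖ ^ 2 := by positivity
  nlinarith

theorem quadExp_self (hħ : 0 < ħ) (Y : E →SL[starRingEnd ℂ] E) (z : E) :
    Real.exp (-‖z‖ ^ 2 / (2 * ħ)) • quadExp ħ Y Y z
      = ((Real.exp (-(inner ℝ z (onePlus Y z)) / (2 * ħ)) : ℝ) : ℂ) := by
  have h1 : inner ℂ z (Y z) + inner ℂ (Y z) z = ((2 * (inner ℝ z (Y z)) : ℝ) : ℂ) := by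
    rw [← inner_conj_symm (Y z) z, Complex.add_conj]
    rfl
  unfold quadExp
  rw [h1, Complex.real_smul, Complex.ofReal_exp, Complex.ofReal_exp, ← Complex.exp_add,
    onePlus_apply, inner_add_right, real_inner_self_eq_norm_sq]
  congr 1
  have : (ħ : ℂ) ≠ 0 := Complex.ofReal_ne_zero.mpr hħ.ne'
  push_cast
  field_simp
  ring

/-- The Gaussian integral on the diagonal. -/
theorem gaussInt_self_sq (hħ : 0 < ħ) {Y : E →SL[starRingEnd ℂ] E} (hY : IsSymmAnti Y)
    (h1 : ‖Y‖ < 1) : gaussInt ħ Y Y ^ 2 * (1 - Y.comp Y : E →L[ℂ] E).det = 1 := by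
  obtain ⟨hd, hint⟩ := integral_exp_neg_symmetric (isSymmetric_onePlus hY) hħ (inner_onePlus_pos h1)
  obtain ⟨d, hd0, hd1⟩ := det_one_sub_sq_pos hY h1
  have h2 := det_onePlus_sq Y
  rw [hd1, Complex.normSq_ofReal, ← sq] at h2
  -- Both numbers are positive and have equal squares, so the real determinant of 1 + Y is the
  -- complex determinant of 1 - Y².
  have h3 : LinearMap.det (onePlus Y) = d := (pow_left_inj₀ hd.le hd0.le two_ne_zero).mp h2
  unfold gaussInt
  rw [integral_gaussMeasure hħ]
  simp only [quadExp_self hħ]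
  rw [integral_complex_ofReal, Complex.real_smul, ← Complex.ofReal_mul, hd1, ← Complex.ofReal_pow,
    ← Complex.ofReal_mul, ← Complex.ofReal_one, Complex.ofReal_inj, mul_pow, hint, h3,
    finrank_real_of_complex]
  have h4 : (2 * Real.pi * ħ) ^ Module.finrank ℂ E ≠ 0 := by positivity
  field_simp
  rw [← pow_mul, mul_comm (Module.finrank ℂ E)]

end GaussInt

/-! ### Smoothness of the determinant. -/

section Det

theorem contDiff_det {𝕜 E : Type*} [NontriviallyNormedField 𝕜] [CompleteSpace 𝕜]
    [NormedAddCommGroup E] [NormedSpace 𝕜 E] [FiniteDimensional 𝕜 E] {n : WithTop ℕ∞} :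
    ContDiff 𝕜 n fun A : E →L[𝕜] E => A.det := by
  let b := Module.finBasis 𝕜 E
  have h : ∀ A : E →L[𝕜] E, A.det = ∑ σ : Equiv.Perm (Fin (Module.finrank 𝕜 E)),
      Equiv.Perm.sign σ • ∏ i, LinearMap.toMatrix b b (A : E →ₗ[𝕜] E) (σ i) i := by
    intro A
    rw [ContinuousLinearMap.det, ← LinearMap.det_toMatrix b, Matrix.det_apply]
  have h2 : ∀ i k, ContDiff 𝕜 n fun A : E →L[𝕜] E =>
      LinearMap.toMatrix b b (A : E →ₗ[𝕜] E) i k := by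
    intro i k
    let φ : (E →L[𝕜] E) →ₗ[𝕜] 𝕜 :=
      (Matrix.entryLinearMap 𝕜 𝕜 i k).comp
        ((LinearMap.toMatrix b b).toLinearMap.comp (ContinuousLinearMap.coeLM 𝕜))
    exact (LinearMap.toContinuousLinearMap φ).contDiff
  simp only [h]
  exact ContDiff.sum fun σ _ => (contDiff_prod fun i _ => h2 _ _).const_smul _

end Det

/-! ### Maps with positive real part and the logarithm of their determinant. -/

section RePos

attribute [local instance] InnerProductSpace.complexToReal

/-- The complex linear maps `A` with `Re ⟨A v, v⟩ > 0` for all `v ≠ 0`. -/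
def rePos (E : Type*) [NormedAddCommGroup E] [InnerProductSpace ℂ E] : Set (E →L[ℂ] E) :=
  {A | ∀ v, v ≠ 0 → 0 < (inner ℂ v (A v)).re}

variable {E : Type*} [NormedAddCommGroup E] [InnerProductSpace ℂ E] [FiniteDimensional ℂ E]

theorem isUnit_of_mem_rePos {A : E →L[ℂ] E} (h : A ∈ rePos E) : IsUnit A := by
  have hinj : Function.Injective (A : E →ₗ[ℂ] E) := by
    rw [injective_iff_map_eq_zero]
    intro v hv
    by_contra hne
    have h1 := h v hne
    rw [ContinuousLinearMap.coe_coe] at hv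
    simp [hv] at h1
  rw [ContinuousLinearMap.isUnit_iff_isUnit_toLinearMap, LinearMap.isUnit_iff_ker_eq_bot,
    LinearMap.ker_eq_bot]
  exact hinj

theorem one_mem_rePos : (1 : E →L[ℂ] E) ∈ rePos E := by
  intro v hv
  rw [one_apply_eq_self]
  change 0 < RCLike.re (inner ℂ v v)
  rw [inner_self_eq_norm_sq]
  have := norm_pos_iff.mpr hv
  positivity

/-- Two strict contractions give |⟨v, YWv⟩| < ‖v‖². -/
theorem one_sub_comp_mem_rePos {Y W : E →SL[starRingEnd ℂ] E} (hY : ‖Y‖ < 1)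
    (hW : ‖W‖ < 1) : (1 - Y.comp W : E →L[ℂ] E) ∈ rePos E := by
  intro v hv
  have h0 : (inner ℂ v v).re = ‖v‖ ^ 2 := inner_self_eq_norm_sq (𝕜 := ℂ) v
  rw [sub_apply, one_apply_eq_self, ContinuousLinearMap.comp_apply, inner_sub_right,
    Complex.sub_re, h0]
  have h1 := (Complex.re_le_norm _).trans (norm_inner_le_norm (𝕜 := ℂ) v (Y (W v)))
  have h2 := Y.le_opNorm (W v)
  have h3 := W.le_opNorm v
  have h4 := norm_pos_iff.mpr hv
  have h5 : ‖Y‖ * ‖W v‖ ≤ ‖W v‖ := mul_le_of_le_one_left (norm_nonneg _) hY.le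
  have h6 : ‖W‖ * ‖v‖ < ‖v‖ := mul_lt_of_lt_one_left h4 hW
  nlinarith

theorem convex_rePos : Convex ℝ (rePos E) := by
  intro A hA B hB a b ha hb hab v hv
  have h1 := hA v hv
  have h2 := hB v hv
  rw [add_apply, smul_apply, smul_apply, inner_add_right, ← Complex.coe_smul a,
    ← Complex.coe_smul b, inner_smul_right, inner_smul_right, Complex.add_re, Complex.re_ofReal_mul,
    Complex.re_ofReal_mul]
  rcases ha.eq_or_lt with rfl | ha'
  · have : b = 1 := by linarith
    subst this
    simpa using h2
  · have := mul_pos ha' h1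
    have := mul_nonneg hb h2.le
    linarith

theorem isOpen_rePos : IsOpen (rePos E) := by
  rw [Metric.isOpen_iff]
  intro A hA
  rcases subsingleton_or_nontrivial E with hs | hn
  · exact ⟨1, one_pos, fun B _ v hv => absurd (Subsingleton.elim v 0) hv⟩
  have hcont : Continuous fun v : E => (inner ℂ v (A v)).re :=
    Complex.continuous_re.comp (continuous_id.inner A.continuous)
  -- The minimum m of the real part on the compact unit sphere serves as the radius: a perturbation
  -- of norm below m cannot destroy positivity.
  obtain ⟨v₀, hv₀, hmin⟩ := (isCompact_sphere (0 : E) 1).exists_isMinOn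
    (NormedSpace.sphere_nonempty.mpr zero_le_one) hcont.continuousOn
  have hv₀' : v₀ ≠ 0 := by
    rintro rfl
    simp at hv₀
  refine ⟨_, hA v₀ hv₀', fun B hB v hv => ?_⟩
  set m := (inner ℂ v₀ (A v₀)).re with hm
  have h4 := norm_pos_iff.mpr hv
  have h1 : m * ‖v‖ ^ 2 ≤ (inner ℂ v (A v)).re := by
    have h2 : ((‖v‖⁻¹ : ℝ) : ℂ) • v ∈ Metric.sphere (0 : E) 1 := by
      rw [mem_sphere_zero_iff_norm, norm_smul, Complex.norm_real, Real.norm_of_nonneg (by positivity)]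
      field_simp
    have h3 := hmin h2
    simp only [Set.mem_ofPred_eq, map_smul, inner_smul_left, inner_smul_right, Complex.conj_ofReal,
      Complex.re_ofReal_mul] at h3
    rw [← hm] at h3
    calc m * ‖v‖ ^ 2 ≤ ‖v‖⁻¹ * (‖v‖⁻¹ * (inner ℂ v (A v)).re) * ‖v‖ ^ 2 := by gcongr
      _ = _ := by field_simp
  have h2 : ‖inner ℂ v ((A - B) v)‖ < m * ‖v‖ ^ 2 := by
    refine (norm_inner_le_norm _ _).trans_lt ?_
    rw [Metric.mem_ball, dist_comm, dist_eq_norm] at hB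
    have := (A - B).le_opNorm v
    have : ‖A - B‖ * ‖v‖ < m * ‖v‖ := mul_lt_mul_of_pos_right hB h4
    nlinarith
  have h3 := (Complex.re_le_norm _).trans_lt h2
  rw [sub_apply, inner_sub_right, Complex.sub_re] at h3
  linarith

theorem isSimplyConnected_of_convex {F : Type*} [NormedAddCommGroup F] [NormedSpace ℝ F] {s : Set F}
    (hs : Convex ℝ s) (hne : s.Nonempty) : IsSimplyConnected s := by
  have := hs.contractibleSpace hne
  exact (inferInstance : SimplyConnectedSpace s)

/-- A smooth function without zeros on a convex open set has a smooth logarithm. -/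
theorem exists_contDiffOn_log {F : Type*} [NormedAddCommGroup F] [NormedSpace ℝ F] {S : Set F}
    (hS : IsOpen S) (hc : Convex ℝ S) {x₀ : F} (hx₀ : x₀ ∈ S) {d : F → ℂ} (hd : ContDiff ℝ ∞ d)
    (hd0 : ∀ x ∈ S, d x ≠ 0) (hd1 : d x₀ = 1) : ∃ a : F → ℂ, ContDiffOn ℝ ∞ a S ∧
      (∀ x ∈ S, d x = Complex.exp (a x)) ∧ a x₀ = 0 := by
  obtain ⟨f, hf, hfe⟩ := Complex.exists_continuousOn_eqOn_exp_comp
    (isSimplyConnected_of_convex hc ⟨x₀, hx₀⟩) hS hd.continuous.continuousOn (by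
      rintro ⟨x, hx, h⟩
      exact hd0 x hx h)
  have hfe' : ∀ x ∈ S, Complex.exp (f x) = d x := fun x hx => hfe hx
  refine ⟨fun x => f x - f x₀, fun x hx => ContDiffAt.contDiffWithinAt ?_, fun x hx => ?_,
    sub_self _⟩
  · have hfx : ContinuousAt f x := hf.continuousAt (hS.mem_nhds hx)
    -- Near x the continuous logarithm f stays within π of f x, hence is given by the principal
    -- logarithm of a quotient close to 1, where that logarithm is smooth.
    have hev : (fun y => f y - f x₀) =ᶠ[𝓝 x]
        fun y => Complex.log (d y / Complex.exp (f x)) + (f x - f x₀) := by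
      filter_upwards [hS.mem_nhds hx, hfx (Metric.ball_mem_nhds _ Real.pi_pos)] with y hy hy'
      have h1 : |(f y - f x).im| < Real.pi :=
        (Complex.abs_im_le_norm _).trans_lt (by rw [← dist_eq_norm]; exact hy')
      rw [abs_lt] at h1
      rw [← hfe' y hy, ← Complex.exp_sub, Complex.log_exp h1.1 h1.2.le]
      ring
    refine ContDiffAt.congr_of_eventuallyEq ?_ hev
    refine ContDiffAt.add ?_ contDiffAt_const
    have h2 : d x / Complex.exp (f x) = 1 := by
      rw [hfe' x hx, div_self (hd0 x hx)]
    refine ContDiffAt.comp x (g := Complex.log) ?_ (hd.contDiffAt.div_const _)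
    rw [h2]
    exact (Complex.contDiffAt_log Complex.one_mem_slitPlane).restrict_scalars ℝ
  · rw [Complex.exp_sub, hfe' x₀ hx₀, hd1, div_one, hfe' x hx]

theorem contDiff_real_det : ContDiff ℝ ∞ fun A : E →L[ℂ] E => A.det :=
  (contDiff_det (𝕜 := ℂ)).restrict_scalars ℝ

theorem det_one_eq_one : (1 : E →L[ℂ] E).det = 1 := LinearMap.det_id

theorem det_ne_zero_of_mem_rePos : ∀ A ∈ rePos E, A.det ≠ 0 := fun A hA =>
  (LinearMap.isUnit_det (A : E →ₗ[ℂ] E)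
    (ContinuousLinearMap.isUnit_iff_isUnit_toLinearMap.mp (isUnit_of_mem_rePos hA))).ne_zero

variable (E) in
/-- A smooth logarithm of the determinant on the maps with positive real part. -/
theorem exists_log_det : ∃ a : (E →L[ℂ] E) → ℂ, ContDiffOn ℝ ∞ a (rePos E) ∧
      (∀ A ∈ rePos E, A.det = Complex.exp (a A)) ∧ a 1 = 0 := by
  have h1 : IsOpen (rePos E) := isOpen_rePos
  have h2 : Convex ℝ (rePos E) := convex_rePos
  obtain ⟨a, ha, hb, hc⟩ := exists_contDiffOn_log h1 h2 one_mem_rePos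
    contDiff_real_det det_ne_zero_of_mem_rePos det_one_eq_one
  exact ⟨a, ha, hb, hc⟩

theorem det_adjoint_eq_conj (A : E →ₗ[ℂ] E) :
    LinearMap.det (LinearMap.adjoint A) = conj (LinearMap.det A) := by
  have h := LinearMap.toMatrix_adjoint (stdOrthonormalBasis ℂ E) (stdOrthonormalBasis ℂ E) A
  have h1 := congrArg Matrix.det h
  rwa [Matrix.det_conjTranspose, LinearMap.det_toMatrix, LinearMap.det_toMatrix] at h1

end RePos

/-! ### Gaussian integrals in general, by analytic continuation. -/

section GaussInt

variable {E : Type*} [NormedAddCommGroup E] [InnerProductSpace ℂ E] [FiniteDimensional ℂ E]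
  [MeasurableSpace E] [BorelSpace E] {ħ : ℝ}

attribute [local instance] InnerProductSpace.complexToReal

theorem IsSymmAnti.add {Y W : E →SL[starRingEnd ℂ] E} (hY : IsSymmAnti Y) (hW : IsSymmAnti W) :
    IsSymmAnti (Y + W) := by
  intro x y
  rw [add_apply, add_apply, inner_add_right, inner_add_right, hY, hW]

theorem IsSymmAnti.smul {Y : E →SL[starRingEnd ℂ] E} (hY : IsSymmAnti Y) (c : ℂ) :
    IsSymmAnti (c • Y) := by
  intro x y
  rw [smul_apply, smul_apply, inner_smul_right, inner_smul_right, hY]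

/-- The parameters for which the Gaussian integral of a pencil of antilinear maps converges. -/
def pencilDomain (P Q P' Q' : E →SL[starRingEnd ℂ] E) : Set ℂ :=
  {τ | ‖P + τ • Q‖ + ‖P' + conj τ • Q'‖ < 2}

theorem continuous_pencil (P Q P' Q' : E →SL[starRingEnd ℂ] E) :
    Continuous fun τ : ℂ => ‖P + τ • Q‖ + ‖P' + conj τ • Q'‖ := by
  have := Complex.continuous_conj
  fun_prop

theorem isOpen_pencilDomain (P Q P' Q' : E →SL[starRingEnd ℂ] E) :
    IsOpen (pencilDomain P Q P' Q') :=
  isOpen_lt (continuous_pencil P Q P' Q') continuous_const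

theorem convex_pencilDomain (P Q P' Q' : E →SL[starRingEnd ℂ] E) :
    Convex ℝ (pencilDomain P Q P' Q') := by
  intro x hx y hy a b ha hb hab
  unfold pencilDomain at hx hy ⊢
  rw [Set.mem_ofPred_eq] at hx hy ⊢
  have hab' : (a : ℂ) + b = 1 := by exact_mod_cast hab
  have key : ∀ (R T : E →SL[starRingEnd ℂ] E) (x y : ℂ),
      ‖R + ((a : ℂ) * x + (b : ℂ) * y) • T‖ ≤ a * ‖R + x • T‖ + b * ‖R + y • T‖ := by
    intro R T x y
    have h : R + ((a : ℂ) * x + (b : ℂ) * y) • T = (a : ℂ) • (R + x • T) + (b : ℂ) • (R + y • T) := by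
      have : R = ((a : ℂ) + b) • R := by rw [hab', one_smul]
      nth_rewrite 1 [this]
      module
    rw [h]
    refine (norm_add_le _ _).trans (le_of_eq ?_)
    rw [norm_smul, norm_smul, Complex.norm_real, Complex.norm_real, Real.norm_of_nonneg ha,
      Real.norm_of_nonneg hb]
  have h1 := key P Q x y
  have h2 := key P' Q' (conj x) (conj y)
  have h3 : conj (a • x + b • y) = (a : ℂ) * conj x + (b : ℂ) * conj y := by simp
  rw [h3, Complex.real_smul, Complex.real_smul]
  rcases ha.eq_or_lt with rfl | ha'
  · have : b = 1 := by linarith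
    subst this
    simp only [zero_mul, zero_add, one_mul, Complex.ofReal_zero, Complex.ofReal_one] at *
    linarith
  · nlinarith

theorem quadExp_pencil (P Q P' Q' : E →SL[starRingEnd ℂ] E) (τ : ℂ) (z : E) :
    quadExp ħ (P + τ • Q) (P' + conj τ • Q') z =
      Complex.exp (-(inner ℂ z (P z) + inner ℂ (P' z) z
        + τ * (inner ℂ z (Q z) + inner ℂ (Q' z) z)) / (4 * ħ)) := by
  unfold quadExp
  congr 3
  simp only [add_apply, smul_apply, inner_add_left, inner_add_right, inner_smul_left,
    inner_smul_right, Complex.conj_conj]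
  ring

/-- The exponent is antilinear in the second map, so the conjugate of τ there makes it affine in τ
(`quadExp_pencil`). The norm sum below 2 keeps the growth under that of the Gaussian weight. -/
theorem differentiableOn_gaussInt_pencil (hħ : 0 < ħ) (P Q P' Q' : E →SL[starRingEnd ℂ] E) :
    DifferentiableOn ℂ (fun τ => gaussInt ħ (P + τ • Q) (P' + conj τ • Q'))
      (pencilDomain P Q P' Q') := by
  refine differentiableOn_integral_of_dominated (isOpen_pencilDomain P Q P' Q')
    (fun τ _ => (continuous_quadExp _ _).aestronglyMeasurable) (fun z => ?_) (fun τ hτ => ?_)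
  · simp only [quadExp_pencil, div_eq_mul_inv]
    fun_prop
  · obtain ⟨r, hr1, hr2⟩ := exists_between (show ‖P + τ • Q‖ + ‖P' + conj τ • Q'‖ < 2 from hτ)
    have hU : {τ : ℂ | ‖P + τ • Q‖ + ‖P' + conj τ • Q'‖ < r} ∈ 𝓝 τ :=
      (isOpen_lt (continuous_pencil P Q P' Q') continuous_const).mem_nhds hr1
    obtain ⟨ε, hε, hεU⟩ := Metric.mem_nhds_iff.mp hU
    have hκ : r / (4 * ħ) < 1 / (2 * ħ) := by
      rw [div_lt_div_iff₀ (by positivity) (by positivity)]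
      nlinarith
    refine ⟨ε, hε, _, integrable_exp_quadratic hħ hκ 0, fun τ' hτ' z => ?_⟩
    refine (norm_quadExp_le hħ _ _ z).trans (Real.exp_le_exp.mpr ?_)
    rw [zero_mul, add_zero]
    have := hεU hτ'
    rw [Set.mem_ofPred_eq] at this
    gcongr

theorem one_sub_pencil_comp (P Q : E →SL[starRingEnd ℂ] E) (τ : ℂ) :
    (1 - (P + τ • Q).comp (P + conj τ • Q) : E →L[ℂ] E)
      = 1 - P.comp P - τ • (P.comp Q + Q.comp P) - τ ^ 2 • Q.comp Q := by
  ext z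
  simp only [sub_apply, add_apply, smul_apply, ContinuousLinearMap.comp_apply, map_add,
    ContinuousLinearMap.map_smulₛₗ, Complex.conj_conj, one_apply_eq_self]
  module

/-- The Gaussian integral, up to its sign. -/
theorem gaussInt_sq (hħ : 0 < ħ) {Y W : E →SL[starRingEnd ℂ] E} (hY : IsSymmAnti Y)
    (hW : IsSymmAnti W) (hY1 : ‖Y‖ < 1) (hW1 : ‖W‖ < 1) :
    gaussInt ħ Y W ^ 2 * (1 - Y.comp W : E →L[ℂ] E).det = 1 := by
  -- Chosen so that P + iQ = Y and P - iQ = W, while real τ gives equal maps, covered by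
  -- `gaussInt_self_sq`. The identity continues from real τ to τ = i.
  set P : E →SL[starRingEnd ℂ] E := (1 / 2 : ℂ) • (Y + W) with hP
  set Q : E →SL[starRingEnd ℂ] E := (1 / (2 * Complex.I) : ℂ) • (Y + (-1 : ℂ) • W) with hQ
  have hPs : IsSymmAnti P := (hY.add hW).smul _
  have hQs : IsSymmAnti Q := (hY.add (hW.smul _)).smul _
  have e1 : P + Complex.I • Q = Y := by
    rw [hP, hQ, smul_smul]
    have : Complex.I * (1 / (2 * Complex.I)) = 1 / 2 := by
      have := Complex.I_ne_zero
      field_simp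
    rw [this]
    module
  have e2 : P + conj Complex.I • Q = W := by
    rw [hP, hQ, smul_smul]
    have : conj Complex.I * (1 / (2 * Complex.I)) = -(1 / 2) := by
      have := Complex.I_ne_zero
      rw [Complex.conj_I]
      field_simp
    rw [this]
    module
  have hI : Complex.I ∈ pencilDomain P Q P Q := by
    unfold pencilDomain
    rw [Set.mem_ofPred_eq, e1, e2]
    linarith
  have h0 : (0 : ℂ) ∈ pencilDomain P Q P Q := by
    have h1 : ‖P‖ < 1 := by
      rw [hP, norm_smul]
      have := norm_add_le Y W
      have h2 : ‖(1 / 2 : ℂ)‖ = 1 / 2 := by simp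
      rw [h2]
      linarith
    unfold pencilDomain
    simp only [Set.mem_ofPred_eq, map_zero, zero_smul, add_zero]
    linarith
  have hd := differentiableOn_gaussInt_pencil hħ P Q P Q
  have hdet : Differentiable ℂ fun τ : ℂ =>
      (1 - (P + τ • Q).comp (P + conj τ • Q) : E →L[ℂ] E).det := by
    simp only [one_sub_pencil_comp]
    refine (contDiff_det (n := 1)).differentiable one_ne_zero |>.comp ?_
    fun_prop
  have := eqOn_of_eq_on_reals (isOpen_pencilDomain P Q P Q) (convex_pencilDomain P Q P Q) h0
    ((hd.pow 2).mul hdet.differentiableOn) (differentiableOn_const 1) (fun t ht => ?_) hI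
  · simpa only [Pi.mul_apply, Pi.pow_apply, e1, e2] using this
  · unfold pencilDomain at ht
    rw [Set.mem_ofPred_eq, Complex.conj_ofReal] at ht
    simp only [Pi.mul_apply, Pi.pow_apply, Complex.conj_ofReal]
    exact gaussInt_self_sq hħ (hPs.add (hQs.smul _)) (by linarith)

/-- The sign of the Gaussian integral is determined by a continuous logarithm of the determinant
along the segment from `0`. -/
theorem gaussInt_eq_exp (hħ : 0 < ħ) {Y W : E →SL[starRingEnd ℂ] E} (hY : IsSymmAnti Y)
    (hW : IsSymmAnti W) (hY1 : ‖Y‖ < 1) (hW1 : ‖W‖ < 1) {α : ℝ → ℂ}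
    (hα : ContinuousOn α (Set.Icc 0 1)) (hα0 : α 0 = 0)
    (hexp : ∀ s ∈ Set.Icc (0 : ℝ) 1,
      (1 - ((s : ℂ) • Y).comp ((s : ℂ) • W) : E →L[ℂ] E).det = Complex.exp (α s)) :
    gaussInt ħ Y W = Complex.exp (-(1 / 2) * α 1) := by
  have hcont : ContinuousOn (fun s : ℝ => gaussInt ħ ((s : ℂ) • Y) ((s : ℂ) • W)) (Set.Icc 0 1) := by
    have h := (differentiableOn_gaussInt_pencil hħ 0 Y 0 W).continuousOn.comp
      (s := Set.Icc (0 : ℝ) 1) Complex.continuous_ofReal.continuousOn ?_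
    · refine h.congr fun s _ => ?_
      simp only [Function.comp_apply, zero_add, Complex.conj_ofReal]
    · intro s hs
      unfold pencilDomain
      simp only [Set.mem_ofPred_eq, zero_add, Complex.conj_ofReal, norm_smul, Complex.norm_real,
        Real.norm_of_nonneg hs.1]
      have h1 := mul_le_of_le_one_left (norm_nonneg Y) hs.2
      have h2 := mul_le_of_le_one_left (norm_nonneg W) hs.2
      linarith
  -- Continuous functions on an interval with equal squares and no zeros agree once they agree at a
  -- point; at s = 0 both are 1.
  have hEq := isPreconnected_Icc.eq_of_sq_eq hcont
    (g := fun s => Complex.exp (-(1 / 2) * α s)) (by fun_prop) ?_ (fun _ => Complex.exp_ne_zero _)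
    (Set.left_mem_Icc.mpr zero_le_one) ?_
  · have := hEq (Set.right_mem_Icc.mpr zero_le_one)
    simpa using this
  · intro s hs
    have hle : ∀ T : E →SL[starRingEnd ℂ] E, ‖T‖ < 1 → ‖(s : ℂ) • T‖ < 1 := by
      intro T hT
      rw [norm_smul, Complex.norm_real, Real.norm_of_nonneg hs.1]
      exact (mul_le_of_le_one_left (norm_nonneg _) hs.2).trans_lt hT
    have h1 := gaussInt_sq hħ (hY.smul s) (hW.smul s) (hle Y hY1) (hle W hW1)
    rw [hexp s hs] at h1
    simp only [Pi.pow_apply]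
    rw [← Complex.exp_nat_mul]
    have h2 : ((2 : ℕ) : ℂ) * (-(1 / 2) * α s) = -α s := by push_cast; ring
    rw [h2, Complex.exp_neg]
    exact eq_inv_of_mul_eq_one_left h1
  · have := isProbabilityMeasure_gaussMeasure (E := E) hħ
    simp [gaussInt, quadExp, hα0]

/-- The path s ↦ 1 - s²YW runs inside `rePos` from 1, so any continuous normalised logarithm of the
determinant there gives the required α. -/
theorem gaussInt_eq_exp_log_det (hħ : 0 < ħ) {Y W : E →SL[starRingEnd ℂ] E} (hY : IsSymmAnti Y)
    (hW : IsSymmAnti W) (hY1 : ‖Y‖ < 1) (hW1 : ‖W‖ < 1) {a : (E →L[ℂ] E) → ℂ}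
    (ha : ContinuousOn a (rePos E)) (hexp : ∀ A ∈ rePos E, A.det = Complex.exp (a A))
    (ha1 : a 1 = 0) :
    gaussInt ħ Y W = Complex.exp (-(1 / 2) * a (1 - Y.comp W)) := by
  have hmem : ∀ s ∈ Set.Icc (0 : ℝ) 1,
      (1 - ((s : ℂ) • Y).comp ((s : ℂ) • W) : E →L[ℂ] E) ∈ rePos E := by
    intro s hs
    have hle : ∀ T : E →SL[starRingEnd ℂ] E, ‖T‖ < 1 → ‖(s : ℂ) • T‖ < 1 := by
      intro T hT
      rw [norm_smul, Complex.norm_real, Real.norm_of_nonneg hs.1]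
      exact (mul_le_of_le_one_left (norm_nonneg _) hs.2).trans_lt hT
    exact one_sub_comp_mem_rePos (hle _ hY1) (hle _ hW1)
  have h : ∀ s : ℝ, (1 - ((s : ℂ) • Y).comp ((s : ℂ) • W) : E →L[ℂ] E)
      = 1 - ((s : ℂ) ^ 2) • Y.comp W := by
    intro s
    ext x
    simp only [sub_apply, ContinuousLinearMap.comp_apply, smul_apply,
      ContinuousLinearMap.map_smulₛₗ, Complex.conj_ofReal, smul_smul, sq]
  have hcont : Continuous fun s : ℝ => (1 - ((s : ℂ) • Y).comp ((s : ℂ) • W) : E →L[ℂ] E) := by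
    simp only [h]
    fun_prop
  have := gaussInt_eq_exp hħ hY hW hY1 hW1
    (α := fun s => a (1 - ((s : ℂ) • Y).comp ((s : ℂ) • W) : E →L[ℂ] E))
    (ha.comp hcont.continuousOn hmem)
    (by simpa using ha1) (fun s hs => hexp _ (hmem s hs))
  simpa only [Complex.ofReal_one, one_smul] using this

end GaussInt

/-! ### Algebra of the parameters C_g, D_g, Z_g. -/

section Params

variable {V : Type*} [AddCommGroup V] [Module ℝ V] {Ω : SymplecticForm V} [FiniteDimensional ℝ V]
  (j : PCCS Ω)

/-- The action of a symplectic map on `(V, Ω, j)`. -/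
def act (g : Sp Ω) (x : Cpx j) : Cpx j := toCpx j (g.1 ((toCpx j).symm x))

theorem act_toCpx (g : Sp Ω) (v : V) : act j g (toCpx j v) = toCpx j (g.1 v) := rfl

theorem act_mul (g₁ g₂ : Sp Ω) (x : Cpx j) : act j (g₁ * g₂) x = act j g₁ (act j g₂ x) := rfl

theorem act_one (x : Cpx j) : act j 1 x = x := rfl

/-- The antilinear part of a symplectic map. -/
abbrev D (g : Sp Ω) : Cpx j →ₛₗ[starRingEnd ℂ] Cpx j := antiPart j (g.1 : V →ₗ[ℝ] V)

variable {j}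

theorem C_toCpx (g : Sp Ω) (v : V) :
    C j g (toCpx j v) = toCpx j ((1 / 2 : ℝ) • (g.1 v - j.J (g.1 (j.J v)))) := rfl

theorem D_toCpx (g : Sp Ω) (v : V) :
    D j g (toCpx j v) = toCpx j ((1 / 2 : ℝ) • (g.1 v + j.J (g.1 (j.J v)))) := rfl

theorem act_eq (g : Sp Ω) (x : Cpx j) : act j g x = C j g x + D j g x := by
  obtain ⟨v, rfl⟩ := (toCpx j).surjective x
  rw [act_toCpx, C_toCpx, D_toCpx, ← map_add]
  congr 1
  module

theorem form_act_left (g : Sp Ω) (v w : V) :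
    Ω.form (g.1 v) w = Ω.form v ((g⁻¹).1 w) := by
  have h1 : g.1 ((g⁻¹).1 w) = w := g.1.apply_symm_apply w
  rw [← g.2 v, h1]

theorem herm_toCpx (v w : V) : herm j (toCpx j v) (toCpx j w)
    = (Ω.form v (j.J w) : ℂ) - Complex.I * (Ω.form v w : ℂ) := rfl

/-- The Ω-adjoint of g is g⁻¹, so the Hermitean adjoint of C_g is C_{g⁻¹}. -/
theorem herm_C (g : Sp Ω) (x y : Cpx j) : herm j (C j g x) y = herm j x (C j g⁻¹ y) := by
  obtain ⟨v, rfl⟩ := (toCpx j).surjective x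
  obtain ⟨w, rfl⟩ := (toCpx j).surjective y
  rw [C_toCpx, C_toCpx, herm_toCpx, herm_toCpx]
  simp only [map_smul, map_sub, LinearMap.smul_apply, LinearMap.sub_apply, form_act_left,
    j.form_left, j.sq, map_neg, smul_eq_mul]
  push_cast
  ring

theorem herm_D (g : Sp Ω) (x y : Cpx j) : herm j (D j g x) y = -herm j (D j g⁻¹ y) x := by
  obtain ⟨v, rfl⟩ := (toCpx j).surjective x
  obtain ⟨w, rfl⟩ := (toCpx j).surjective y
  rw [D_toCpx, D_toCpx, herm_toCpx, herm_toCpx]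
  simp only [map_smul, map_add, LinearMap.smul_apply, LinearMap.add_apply, form_act_left,
    j.form_left, j.sq, map_neg, smul_eq_mul, inv_inv]
  rw [Ω.neg w (g.1 (j.J v)), Ω.neg w (j.J (g.1 v)), Ω.neg w (g.1 v), Ω.neg w (j.J (g.1 (j.J v)))]
  simp only [form_act_left, j.form_left, neg_neg]
  push_cast
  ring

/-- Replacing x by ix multiplies the linear part by i and the antilinear part by -i, which separates
them. Composition formulas for C and D can then be read off from the action of g. -/
theorem linear_antilinear_unique {L L' : Cpx j →ₗ[ℂ] Cpx j}
    {A A' : Cpx j →ₛₗ[starRingEnd ℂ] Cpx j} (h : ∀ x, L x + A x = L' x + A' x) :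
    (∀ x, L x = L' x) ∧ ∀ x, A x = A' x := by
  have h2 : ∀ x, L x - A x = L' x - A' x := by
    intro x
    have := h (Complex.I • x)
    simp only [map_smul, LinearMap.map_smulₛₗ, Complex.conj_I, neg_smul] at this
    rw [← sub_eq_add_neg, ← sub_eq_add_neg, ← smul_sub, ← smul_sub] at this
    exact smul_right_injective _ Complex.I_ne_zero this
  constructor <;> intro x
  · have h3 := congrArg₂ (· + ·) (h x) (h2 x)
    have h4 : (2 : ℂ) • L x = (2 : ℂ) • L' x := by
      rw [two_smul, two_smul]
      convert! h3 using 1 <;> abel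
    exact smul_right_injective _ two_ne_zero h4
  · have h3 := congrArg₂ (· - ·) (h x) (h2 x)
    have h4 : (2 : ℂ) • A x = (2 : ℂ) • A' x := by
      rw [two_smul, two_smul]
      convert! h3 using 1 <;> abel
    exact smul_right_injective _ two_ne_zero h4

theorem C_D_mul (g₁ g₂ : Sp Ω) :
    (∀ x, C j (g₁ * g₂) x = C j g₁ (C j g₂ x) + D j g₁ (D j g₂ x)) ∧
    ∀ x, D j (g₁ * g₂) x = C j g₁ (D j g₂ x) + D j g₁ (C j g₂ x) := by
  refine linear_antilinear_unique (L := (C j (g₁ * g₂)).toLinearMap)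
    (L' := (C j g₁).toLinearMap ∘ₗ (C j g₂).toLinearMap + (D j g₁).comp (D j g₂))
    (A' := (C j g₁).toLinearMap.comp (D j g₂) + (D j g₁).comp (C j g₂).toLinearMap) fun x => ?_
  simp only [LinearEquiv.coe_coe, LinearMap.add_apply, LinearMap.comp_apply]
  rw [← act_eq, act_mul, act_eq g₁, act_eq g₂, map_add, map_add]
  abel

theorem C_D_one : (∀ x, C j (1 : Sp Ω) x = x) ∧ ∀ x, D j (1 : Sp Ω) x = 0 := by
  refine linear_antilinear_unique (L := (C j (1 : Sp Ω)).toLinearMap) (L' := LinearMap.id)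
    (A' := 0) fun x => ?_
  simp only [LinearEquiv.coe_coe, LinearMap.id_apply, LinearMap.zero_apply, add_zero]
  rw [← act_eq, act_one]

theorem C_inv_C (g : Sp Ω) (x : Cpx j) : C j g⁻¹ (C j g x) + D j g⁻¹ (D j g x) = x := by
  rw [← (C_D_mul g⁻¹ g).1, inv_mul_cancel, C_D_one.1]

theorem D_inv_C (g : Sp Ω) (x : Cpx j) : D j g⁻¹ (C j g x) = -C j g⁻¹ (D j g x) := by
  rw [eq_neg_iff_add_eq_zero, add_comm, ← (C_D_mul g⁻¹ g).2, inv_mul_cancel, C_D_one.2]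

theorem Z_apply (g : Sp Ω) (x : Cpx j) : Z j g x = (C j g).symm (D j g x) := rfl

theorem C_Z (g : Sp Ω) (x : Cpx j) : C j g (Z j g x) = D j g x := by
  rw [Z_apply, LinearEquiv.apply_symm_apply]

theorem Z_inv_C (g : Sp Ω) (x : Cpx j) : Z j g⁻¹ (C j g x) = -D j g x := by
  rw [Z_apply, D_inv_C, map_neg, LinearEquiv.symm_apply_apply]

theorem act_eq_C (g : Sp Ω) (x : Cpx j) : act j g x = C j g (x + Z j g x) := by
  rw [map_add, C_Z, act_eq]

/-- With y = C_{g⁻¹}w, the factor C_g moves to the left slot, where C_g Z_g = D_g and `herm_D`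
applies. -/
theorem Z_symm (g : Sp Ω) (x y : Cpx j) : herm j (Z j g x) y = herm j (Z j g y) x := by
  obtain ⟨w, rfl⟩ := (C j g⁻¹).surjective y
  rw [← herm_C, C_Z]
  have := Z_inv_C g⁻¹ w
  rw [inv_inv] at this
  rw [this, herm_D]
  unfold herm
  simp
  ring

theorem herm_self (x : Cpx j) : herm j x x = (‖x‖ : ℂ) ^ 2 := by
  rw [← inner_eq_herm, inner_self_eq_norm_sq_to_K]
  rfl

/-- This is C_g*C_g - D_g*D_g = 1, the linear part of g⁻¹g = 1. -/
theorem norm_sq_C_D (g : Sp Ω) (x : Cpx j) : ‖x‖ ^ 2 = ‖C j g x‖ ^ 2 - ‖D j g x‖ ^ 2 := by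
  have h1 : herm j x x = herm j (C j g x) (C j g x) - herm j (D j g x) (D j g x) := by
    nth_rewrite 1 [← C_inv_C g x]
    rw [← inner_eq_herm, inner_add_right, inner_eq_herm, inner_eq_herm, herm_C, inv_inv,
      herm_D, inv_inv, sub_eq_add_neg]
  rw [herm_self, herm_self, herm_self] at h1
  exact_mod_cast h1

theorem norm_Z_inv_C_sq (g : Sp Ω) (x : Cpx j) :
    ‖Z j g⁻¹ (C j g x)‖ ^ 2 = ‖C j g x‖ ^ 2 - ‖x‖ ^ 2 := by
  rw [Z_inv_C, norm_neg, norm_sq_C_D g x]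
  ring

/-- For y = C_{g⁻¹}x one has ‖Z_g y‖² = ‖y‖² - ‖x‖², and ‖y‖ ≤ M‖x‖ bounds the loss from below. This
strict contraction makes the Gaussian integrals converge. -/
theorem exists_norm_Z_le (g : Sp Ω) : ∃ c : ℝ, 0 ≤ c ∧ c < 1 ∧ ∀ x : Cpx j, ‖Z j g x‖ ≤ c * ‖x‖ := by
  -- Adding 1 ensures M ≥ 1, so the number under the square root is nonnegative even for V = 0.
  set M := ‖LinearMap.toContinuousLinearMap (C j g⁻¹).toLinearMap‖ + 1 with hM
  have hM0 : 0 < M := by positivity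
  have hM1 : ∀ x, ‖C j g⁻¹ x‖ ≤ M * ‖x‖ := fun x =>
    ((LinearMap.toContinuousLinearMap (C j g⁻¹).toLinearMap).le_opNorm x).trans
      (mul_le_mul_of_nonneg_right (by linarith) (norm_nonneg x))
  have hM2 : 1 ≤ M := by rw [hM]; linarith [norm_nonneg (LinearMap.toContinuousLinearMap (C j g⁻¹).toLinearMap)]
  have h1 : 0 ≤ 1 - 1 / M ^ 2 := by
    have : 1 / M ^ 2 ≤ 1 := div_le_one_of_le₀ (one_le_pow₀ hM2) (by positivity)
    linarith
  refine ⟨√(1 - 1 / M ^ 2), Real.sqrt_nonneg _, ?_, fun y => ?_⟩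
  · rw [Real.sqrt_lt' one_pos]
    have : 0 < 1 / M ^ 2 := by positivity
    linarith
  · obtain ⟨x, rfl⟩ := (C j g⁻¹).surjective y
    refine abs_le_of_sq_le_sq' ?_ (by positivity) |>.2
    have h2 := norm_Z_inv_C_sq g⁻¹ x
    rw [inv_inv] at h2
    rw [h2, mul_pow, Real.sq_sqrt h1]
    have h3 : ‖C j g⁻¹ x‖ ^ 2 ≤ M ^ 2 * ‖x‖ ^ 2 := by
      rw [← mul_pow]
      exact pow_le_pow_left₀ (norm_nonneg _) (hM1 x) 2
    have h4 : 1 / M ^ 2 * ‖C j g⁻¹ x‖ ^ 2 ≤ ‖x‖ ^ 2 := by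
      rw [div_mul_eq_mul_div, one_mul, div_le_iff₀ (by positivity)]
      linarith
    linarith

variable (j) in
/-- `Z_g` as a continuous antilinear map. -/
def ZL (g : Sp Ω) : Cpx j →SL[starRingEnd ℂ] Cpx j :=
  (Z j g).mkContinuous 1 fun x => by
    obtain ⟨c, _, hc, h⟩ := exists_norm_Z_le (j := j) g
    exact (h x).trans (mul_le_mul_of_nonneg_right hc.le (norm_nonneg x))

theorem ZL_apply (g : Sp Ω) (x : Cpx j) : ZL j g x = Z j g x := rfl

theorem norm_ZL_lt_one (g : Sp Ω) : ‖ZL j g‖ < 1 := by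
  obtain ⟨c, h0, hc, h⟩ := exists_norm_Z_le (j := j) g
  exact (ContinuousLinearMap.opNorm_le_bound _ h0 h).trans_lt hc

theorem isSymmAnti_ZL (g : Sp Ω) : IsSymmAnti (ZL j g) := by
  intro x y
  rw [inner_eq_herm, inner_eq_herm, ZL_apply, ZL_apply, Z_symm]

theorem oneSubZZ_eq (g₁ g₂ : Sp Ω) :
    oneSubZZ j g₁ g₂ = 1 - (ZL j g₁).comp (ZL j g₂⁻¹) := rfl

/-- The linear part C_{g₁}C_{g₂} + D_{g₁}D_{g₂} of the product factors since D_{g₁} = C_{g₁}Z_{g₁}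
and D_{g₂} = -Z_{g₂⁻¹}C_{g₂}. -/
theorem C_mul (g₁ g₂ : Sp Ω) (x : Cpx j) :
    C j (g₁ * g₂) x = C j g₁ (oneSubZZ j g₁ g₂ (C j g₂ x)) := by
  rw [oneSubZZ_eq, sub_apply, map_sub, ContinuousLinearMap.comp_apply, ZL_apply, ZL_apply, C_Z,
    Z_inv_C, map_neg, sub_neg_eq_add, (C_D_mul g₁ g₂).1]
  rfl

theorem detC_mul (g₁ g₂ : Sp Ω) :
    detC j (g₁ * g₂) = detC j g₁ * (oneSubZZ j g₁ g₂).det * detC j g₂ := by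
  unfold detC
  rw [ContinuousLinearMap.det, ← LinearMap.det_comp, ← LinearMap.det_comp]
  congr 1
  ext x
  exact C_mul g₁ g₂ x

theorem detC_ne_zero (g : Sp Ω) : detC j g ≠ 0 := by
  exact (LinearEquiv.isUnit_det' (C j g)).ne_zero

theorem detC_one : detC j (1 : Sp Ω) = 1 := by
  have h : (C j (1 : Sp Ω) : Cpx j →ₗ[ℂ] Cpx j) = LinearMap.id :=
    LinearMap.ext fun x => C_D_one.1 x
  rw [detC, h, LinearMap.det_id]

theorem detC_inv (g : Sp Ω) : detC j g⁻¹ = conj (detC j g) := by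
  unfold detC
  have : (C j g⁻¹ : Cpx j →ₗ[ℂ] Cpx j) = LinearMap.adjoint (C j g : Cpx j →ₗ[ℂ] Cpx j) := by
    rw [LinearMap.eq_adjoint_iff]
    intro x y
    rw [inner_eq_herm, inner_eq_herm]
    exact (herm_C g y x).symm
  rw [this, det_adjoint_eq_conj]

theorem herm_C_symm (g : Sp Ω) (x y : Cpx j) :
    herm j ((C j g).symm x) y = herm j x ((C j g⁻¹).symm y) := by
  have := herm_C g ((C j g).symm x) ((C j g⁻¹).symm y)
  rw [LinearEquiv.apply_symm_apply, LinearEquiv.apply_symm_apply] at this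
  exact this.symm

theorem act_add_Z_inv (g : Sp Ω) (x : Cpx j) :
    act j g x + Z j g⁻¹ (act j g x) = (C j g⁻¹).symm x := by
  rw [LinearEquiv.eq_symm_apply, ← act_eq_C, ← act_mul, inv_mul_cancel, act_one]

end Params

/-! ### The Gaussian integral of Z_{g₁}, Z_{g₂⁻¹} through `logDet`. -/

section LogDet

variable {V : Type*} [AddCommGroup V] [Module ℝ V] {Ω : SymplecticForm V} [FiniteDimensional ℝ V]
  {j : PCCS Ω}

theorem norm_herm_le (v w : Cpx j) : ‖herm j v w‖ ≤ ‖v‖ * ‖w‖ := by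
  rw [← inner_eq_herm, mul_comm]
  exact norm_inner_le_norm w v

theorem herm_add_left (u v w : Cpx j) : herm j (u + v) w = herm j u w + herm j v w := by
  simp only [← inner_eq_herm, inner_add_right]

theorem herm_sub_left (u v w : Cpx j) : herm j (u - v) w = herm j u w - herm j v w := by
  simp only [← inner_eq_herm, inner_sub_right]

theorem herm_smul_left (c : ℂ) (v w : Cpx j) : herm j (c • v) w = c * herm j v w := by
  simp only [← inner_eq_herm, inner_smul_right]

theorem herm_add_right (u v w : Cpx j) : herm j u (v + w) = herm j u v + herm j u w := by
  simp only [← inner_eq_herm, inner_add_left]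

theorem herm_sub_right (u v w : Cpx j) : herm j u (v - w) = herm j u v - herm j u w := by
  simp only [← inner_eq_herm, inner_sub_left]

theorem herm_smul_right (c : ℂ) (v w : Cpx j) : herm j v (c • w) = conj c * herm j v w := by
  simp only [← inner_eq_herm, inner_smul_left]

theorem conj_herm (v w : Cpx j) : conj (herm j v w) = herm j w v := by
  rw [← inner_eq_herm, ← inner_eq_herm, inner_conj_symm]

/-- Positivity of the real part already forces injectivity, hence invertibility. -/
theorem GLplus_eq : GLplus j = rePos (Cpx j) := by
  ext A
  have h : ∀ v, (herm j (A v) v).re = (inner ℂ v (A v)).re := fun v => rfl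
  exact ⟨fun hA v hv => hA.2 v hv, fun hA => ⟨isUnit_of_mem_rePos hA, hA⟩⟩

theorem oneSubZZ_mem_GLplus (g₁ g₂ : Sp Ω) : oneSubZZ j g₁ g₂ ∈ GLplus j := by
  have h : (1 - (ZL j g₁).comp (ZL j g₂⁻¹) : Cpx j →L[ℂ] Cpx j) ∈ rePos (Cpx j) :=
    one_sub_comp_mem_rePos (norm_ZL_lt_one g₁) (norm_ZL_lt_one g₂⁻¹)
  rw [GLplus_eq, oneSubZZ_eq]
  exact h

/-- Since `logDet` is a choice among the functions satisfying `IsLogDet`, existence yields all its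
properties. -/
theorem exists_isLogDet (j : PCCS Ω) : ∃ a, IsLogDet j a := by
  obtain ⟨a, h1, h2, h3⟩ := exists_log_det (Cpx j)
  rw [← GLplus_eq] at h1 h2
  exact ⟨a, h1, h2, h3⟩

theorem isLogDet_logDet (j : PCCS Ω) : IsLogDet j (logDet j) :=
  Classical.epsilon_spec (exists_isLogDet j)

theorem gaussInt_ZL {ħ : ℝ} (hħ : 0 < ħ) (g₁ g₂ : Sp Ω) :
    gaussInt ħ (ZL j g₁) (ZL j g₂⁻¹) = Complex.exp (-(1 / 2) * logDet j (oneSubZZ j g₁ g₂)) := by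
  have ha := isLogDet_logDet j
  have h1 := ha.smooth.continuousOn
  have h2 := ha.exp_eq
  rw [GLplus_eq] at h1 h2
  exact gaussInt_eq_exp_log_det hħ (isSymmAnti_ZL g₁) (isSymmAnti_ZL g₂⁻¹) (norm_ZL_lt_one g₁)
    (norm_ZL_lt_one g₂⁻¹) h1 h2 ha.map_one

end LogDet

/-! ### Holomorphy of the Bargmann projection. -/

section Bargmann

variable {E : Type*} [NormedAddCommGroup E] [InnerProductSpace ℂ E] [FiniteDimensional ℂ E]
  [MeasurableSpace E] [BorelSpace E] {ħ : ℝ}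

attribute [local instance] InnerProductSpace.complexToReal

theorem memLp_exp_mul_norm (hħ : 0 < ħ) (b : ℝ) :
    MemLp (fun z : E => Real.exp (b * ‖z‖)) 2 (gaussMeasure E ħ) := by
  rw [memLp_two_iff_integrable_sq_norm (by fun_prop)]
  refine (integrable_exp_quadratic (E := E) hħ (κ := 0) (by positivity) (2 * b)).congr
    (Filter.Eventually.of_forall fun z => ?_)
  simp only
  rw [Real.norm_of_nonneg (Real.exp_pos _).le, ← Real.exp_nat_mul]
  congr 1
  push_cast
  ring

/-- The Bargmann projection of a square integrable function is holomorphic. -/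
theorem differentiable_integral_exp_inner (hħ : 0 < ħ) {F : E → ℂ}
    (hF : MemLp F 2 (gaussMeasure E ħ)) :
    Differentiable ℂ fun z => ∫ v, F v * Complex.exp (inner ℂ v z / (2 * ħ)) ∂gaussMeasure E ħ := by
  intro z₀
  set c : ℝ := 1 / (2 * ħ) with hc
  have hc0 : 0 < c := by positivity
  have hcc : ∀ v z : E, inner ℂ v z / (2 * (ħ : ℂ)) = (c : ℂ) * inner ℂ v z := by
    intro v z
    rw [hc]
    push_cast
    ring
  simp only [hcc]
  have hexp : ∀ v z : E, ‖Complex.exp ((c : ℂ) * inner ℂ v z)‖ ≤ Real.exp (c * ‖z‖ * ‖v‖) := by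
    intro v z
    refine (Complex.norm_exp_le_exp_norm _).trans (Real.exp_le_exp.mpr ?_)
    rw [norm_mul, Complex.norm_real, Real.norm_of_nonneg hc0.le, mul_assoc, mul_comm ‖z‖]
    exact mul_le_mul_of_nonneg_left (norm_inner_le_norm v z) hc0.le
  have hcontexp : ∀ z : E, Continuous fun v : E => Complex.exp ((c : ℂ) * inner ℂ v z) :=
    fun z => by fun_prop
  have hcontinner : Continuous fun v : E => innerSL ℂ v := (innerSL ℂ).continuous
  -- The first summand bounds the kernel on the unit ball about z₀; the extra 1 absorbs the factor
  -- ‖v‖ ≤ exp ‖v‖ produced by differentiation.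
  set b : ℝ := c * (‖z₀‖ + 1) + 1 with hb
  have hbound := ((memLp_exp_mul_norm (E := E) hħ b).integrable_mul hF.norm).const_mul c
  have := hasFDerivAt_integral_of_dominated_of_fderiv_le (𝕜 := ℂ) (μ := gaussMeasure E ħ)
    (F := fun z v => F v * Complex.exp ((c : ℂ) * inner ℂ v z))
    (F' := fun z v => (F v * (Complex.exp ((c : ℂ) * inner ℂ v z) * (c : ℂ))) • innerSL ℂ v)
    (x₀ := z₀) (Metric.ball_mem_nhds z₀ one_pos)
    (bound := fun v => c * (Real.exp (b * ‖v‖) * ‖F v‖)) ?_ ?_ ?_ ?_ hbound ?_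
  · exact this.differentiableAt
  · exact Filter.Eventually.of_forall fun z =>
      hF.aestronglyMeasurable.mul (hcontexp z).aestronglyMeasurable
  · refine (hF.norm.integrable_mul (memLp_exp_mul_norm (E := E) hħ (c * ‖z₀‖))).mono'
      (hF.aestronglyMeasurable.mul (hcontexp z₀).aestronglyMeasurable)
      (Filter.Eventually.of_forall fun v => ?_)
    rw [norm_mul]
    exact mul_le_mul_of_nonneg_left (hexp v z₀) (norm_nonneg _)
  · exact (hF.aestronglyMeasurable.mul
      ((hcontexp z₀).mul continuous_const).aestronglyMeasurable).smul
        hcontinner.aestronglyMeasurable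
  · refine Filter.Eventually.of_forall fun v z hz => ?_
    rw [norm_smul, norm_mul, norm_mul, innerSL_apply_norm, Complex.norm_real,
      Real.norm_of_nonneg hc0.le]
    have h1 : ‖z‖ ≤ ‖z₀‖ + 1 := by
      rw [Metric.mem_ball, dist_eq_norm] at hz
      have := norm_le_norm_add_norm_sub' z z₀
      linarith
    have h2 : Real.exp (c * ‖z‖ * ‖v‖) ≤ Real.exp (c * (‖z₀‖ + 1) * ‖v‖) :=
      Real.exp_le_exp.mpr (by gcongr)
    have h3 : ‖v‖ ≤ Real.exp ‖v‖ := (lt_add_one _).le.trans (Real.add_one_le_exp _)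
    have h4 : Real.exp (b * ‖v‖) = Real.exp (c * (‖z₀‖ + 1) * ‖v‖) * Real.exp ‖v‖ := by
      rw [← Real.exp_add, hb]
      congr 1
      ring
    rw [h4]
    calc ‖F v‖ * (‖Complex.exp ((c : ℂ) * inner ℂ v z)‖ * c) * ‖v‖
        ≤ ‖F v‖ * (Real.exp (c * (‖z₀‖ + 1) * ‖v‖) * c) * Real.exp ‖v‖ := by
          gcongr
          exact (hexp v z).trans h2
      _ = _ := by ring
  · refine Filter.Eventually.of_forall fun v z _ => ?_
    have h1 : HasFDerivAt (fun z : E => (c : ℂ) * inner ℂ v z) ((c : ℂ) • innerSL ℂ v) z :=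
      (innerSL ℂ v).hasFDerivAt.const_mul (c : ℂ)
    have h2 := h1.cexp.const_mul (F v)
    refine h2.congr_fderiv ?_
    rw [smul_smul, smul_smul, mul_assoc]

end Bargmann

/-! ### Heisenberg operators and coherent states. -/

section Heisenberg

variable {V : Type*} [AddCommGroup V] [Module ℝ V] {Ω : SymplecticForm V} [FiniteDimensional ℝ V]
  {j : PCCS Ω} {ħ : ℝ}

theorem heis_apply (v : V) (t : ℝ) (f : Fock ħ j) (z : Cpx j) :
    (heis ħ j v t f).1 z = heisFactor ħ j (toCpx j v) t z * f.1 (z - toCpx j v) := rfl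

theorem Fock.ext {f g : Fock ħ j} (h : ∀ z, f.1 z = g.1 z) : f = g := Subtype.ext (funext h)

theorem norm_sq_eq_herm (v : Cpx j) : (‖v‖ : ℂ) ^ 2 = herm j v v := (herm_self v).symm

theorem heis_heis (v w : V) (s t : ℝ) (f : Fock ħ j) :
    heis ħ j v s (heis ħ j w t f) = heis ħ j (v + w) (s + t - Ω.form v w / 2) f := by
  refine Fock.ext fun z => ?_
  rw [heis_apply, heis_apply, heis_apply, ← mul_assoc, map_add, sub_sub]
  congr 1
  unfold heisFactor
  rw [← Complex.exp_add]
  congr 1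
  simp only [norm_sq_eq_herm, herm_add_left, herm_add_right, herm_sub_left]
  have h1 : herm j (toCpx j w) (toCpx j v)
      = herm j (toCpx j v) (toCpx j w) + 2 * Complex.I * (Ω.form v w : ℂ) := by
    rw [herm_toCpx, herm_toCpx, Ω.neg w v, Ω.neg w (j.J v), j.form_left]
    push_cast
    ring
  rw [h1]
  push_cast
  ring

theorem heis_zero (f : Fock ħ j) : heis ħ j 0 0 f = f := by
  refine Fock.ext fun z => ?_
  rw [heis_apply, map_zero, sub_zero]
  unfold heisFactor herm
  simp

theorem heis_neg_heis (v : V) (f : Fock ħ j) : heis ħ j (-v) 0 (heis ħ j v 0 f) = f := by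
  rw [heis_heis]
  have h : Ω.form (-v) v = 0 := by rw [map_neg, LinearMap.neg_apply, Ω.isAlt.self_eq_zero, neg_zero]
  rw [h, neg_add_cancel]
  simpa using heis_zero f

theorem heis_heis_neg (v : V) (f : Fock ħ j) : heis ħ j v 0 (heis ħ j (-v) 0 f) = f := by
  have := heis_neg_heis (-v) f
  rwa [neg_neg] at this

theorem fockNorm_heis (v : V) (t : ℝ) (f : Fock ħ j) :
    fockNorm ħ j (heis ħ j v t f) = fockNorm ħ j f := by
  unfold fockNorm
  congr 2
  rw [← integral_sub_right_eq_self (fun z => ‖f.1 z‖ ^ 2 * weight ħ j z) (toCpx j v)]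
  refine integral_congr_ae (Filter.Eventually.of_forall fun z => ?_)
  simp only
  rw [heis_apply, norm_mul, mul_pow, ← heisFactor_weight ħ j (toCpx j v) t z]
  ring

variable [hħ : Fact (0 < ħ)]

theorem coherent_apply (v z : Cpx j) :
    (coherent ħ j v).1 z = Complex.exp (herm j z v / (2 * ħ)) := rfl

/-- Coherent states are multiples of translates of the vacuum e₀, so an operator intertwining
Heisenberg operators is known on them from its value at e₀. -/
theorem coherent_eq_heis (v : V) : coherent ħ j (toCpx j v) =
    Complex.exp ((‖toCpx j v‖ : ℂ) ^ 2 / (4 * ħ)) • heis ħ j v 0 (coherent ħ j 0) := by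
  refine Fock.ext fun z => ?_
  change _ = Complex.exp ((‖toCpx j v‖ : ℂ) ^ 2 / (4 * ħ)) * (heis ħ j v 0 (coherent ħ j 0)).1 z
  rw [heis_apply, coherent_apply, coherent_apply]
  unfold heisFactor
  rw [← Complex.exp_add, ← Complex.exp_add]
  congr 1
  have : herm j (z - toCpx j v) 0 = 0 := by simp [herm]
  rw [this]
  simp

end Heisenberg

/-! ### The Fock space as a Hilbert space with reproducing kernel. -/

section FockHilbert

variable {V : Type*} [AddCommGroup V] [Module ℝ V] {Ω : SymplecticForm V} [FiniteDimensional ℝ V]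
  {ħ : ℝ} [hħ : Fact (0 < ħ)] {j : PCCS Ω}

theorem memLp_of_mem_Fock (f : Fock ħ j) : MemLp f.1 2 (gaussMeasure (Cpx j) ħ) := by
  rw [memLp_two_iff_integrable_sq_norm f.2.1.continuous.aestronglyMeasurable,
    integrable_gaussMeasure_iff hħ.out]
  refine f.2.2.congr (Filter.Eventually.of_forall fun z => ?_)
  simp only [weight, smul_eq_mul]
  ring

theorem mem_Fock_of_memLp {f : Cpx j → ℂ} (hf : Differentiable ℂ f)
    (hf' : MemLp f 2 (gaussMeasure (Cpx j) ħ)) : f ∈ Fock ħ j := by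
  rw [memLp_two_iff_integrable_sq_norm hf.continuous.aestronglyMeasurable,
    integrable_gaussMeasure_iff hħ.out] at hf'
  refine ⟨hf, hf'.congr (Filter.Eventually.of_forall fun z => ?_)⟩
  simp only [weight, smul_eq_mul]
  ring

variable (ħ j) in
/-- The Fock space with its Hilbert space structure. -/
def FockH : Type _ := Fock ħ j

instance : AddCommGroup (FockH ħ j) := inferInstanceAs (AddCommGroup (Fock ħ j))

instance : Module ℂ (FockH ħ j) := inferInstanceAs (Module ℂ (Fock ħ j))

variable (ħ j) in
/-- The identity map from the Fock space to the Hilbert space. -/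
def toH : Fock ħ j ≃ₗ[ℂ] FockH ħ j := LinearEquiv.refl ℂ (Fock ħ j)

variable (ħ j) in
/-- The inclusion of the Fock space in the space of square integrable functions. -/
def fockToLp : FockH ħ j →ₗ[ℂ] Lp ℂ 2 (gaussMeasure (Cpx j) ħ) where
  toFun f := (memLp_of_mem_Fock ((toH ħ j).symm f)).toLp _
  map_add' _ _ := rfl
  map_smul' _ _ := rfl

theorem fockToLp_ae (f : Fock ħ j) :
    fockToLp ħ j (toH ħ j f) =ᵐ[gaussMeasure (Cpx j) ħ] f.1 :=
  (memLp_of_mem_Fock f).coeFn_toLp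

theorem fockToLp_injective : Function.Injective (fockToLp ħ j) := by
  rw [injective_iff_map_eq_zero]
  intro f hf
  obtain ⟨f, rfl⟩ := (toH ħ j).surjective f
  have := isOpenPosMeasure_gaussMeasure (E := Cpx j) hħ.out
  have h1 : f.1 =ᵐ[gaussMeasure (Cpx j) ħ] 0 := by
    refine (fockToLp_ae f).symm.trans ?_
    rw [hf]
    exact Lp.coeFn_zero _ _ _
  have h2 : f.1 = 0 := (f.2.1.continuous.ae_eq_iff_eq _ continuous_zero).mp h1
  have h3 : f = 0 := Subtype.ext h2
  rw [h3, map_zero]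

instance fockCore : InnerProductSpace.Core ℂ (FockH ħ j) where
  inner f g := inner ℂ (fockToLp ħ j f) (fockToLp ħ j g)
  conj_inner_symm f g := inner_conj_symm _ _
  re_inner_nonneg f := inner_self_nonneg
  add_left f g h := by rw [map_add, inner_add_left]
  smul_left f g r := by rw [map_smul, inner_smul_left]
  definite f hf := by
    apply fockToLp_injective
    rw [map_zero]
    exact inner_self_eq_zero.mp hf

instance : NormedAddCommGroup (FockH ħ j) :=
  @InnerProductSpace.Core.toNormedAddCommGroup ℂ (FockH ħ j) _ _ _ fockCore

instance : InnerProductSpace ℂ (FockH ħ j) := InnerProductSpace.ofCore fockCore.toCore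

variable (ħ j) in
/-- The inclusion of the Fock space in the space of square integrable functions, as an isometry. -/
def fockIsometry : FockH ħ j →ₗᵢ[ℂ] Lp ℂ 2 (gaussMeasure (Cpx j) ħ) where
  toLinearMap := fockToLp ħ j
  norm_map' f := by
    have h : inner ℂ (fockToLp ħ j f) (fockToLp ħ j f) = inner ℂ f f := rfl
    rw [inner_self_eq_norm_sq_to_K, inner_self_eq_norm_sq_to_K] at h
    exact (pow_left_inj₀ (norm_nonneg _) (norm_nonneg _) two_ne_zero).mp (by exact_mod_cast h)

theorem inner_toH (f g : Fock ħ j) : inner ℂ (toH ħ j f) (toH ħ j g)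
    = ∫ z, conj (f.1 z) * g.1 z ∂gaussMeasure (Cpx j) ħ := by
  change inner ℂ (fockToLp ħ j (toH ħ j f)) (fockToLp ħ j (toH ħ j g)) = _
  rw [L2.inner_def]
  refine integral_congr_ae ?_
  filter_upwards [fockToLp_ae f, fockToLp_ae g] with z h1 h2
  rw [h1, h2, RCLike.inner_apply, mul_comm]

theorem norm_toH (f : Fock ħ j) : ‖toH ħ j f‖ = fockNorm ħ j f := by
  have h1 : ((‖toH ħ j f‖ ^ 2 : ℝ) : ℂ) = ((fockNorm ħ j f ^ 2 : ℝ) : ℂ) := by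
    have h2 := inner_toH f f
    rw [inner_self_eq_norm_sq_to_K] at h2
    have h3 : ∀ z, conj (f.1 z) * f.1 z = ((‖f.1 z‖ ^ 2 : ℝ) : ℂ) := fun z => by
      rw [Complex.conj_mul']
      norm_cast
    simp only [h3] at h2
    rw [integral_complex_ofReal, integral_gaussMeasure hħ.out] at h2
    have hpos : 0 ≤ ((2 * Real.pi * ħ) ^ Module.finrank ℂ (Cpx j))⁻¹ *
        ∫ z, ‖f.1 z‖ ^ 2 * weight ħ j z := by
      have := hħ.out
      refine mul_nonneg (by positivity) (integral_nonneg fun z => ?_)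
      exact mul_nonneg (by positivity) (Real.exp_pos _).le
    rw [fockNorm, Real.sq_sqrt hpos]
    push_cast at h2 ⊢
    rw [smul_eq_mul] at h2
    refine h2.trans ?_
    push_cast
    congr 3
    funext z
    rw [smul_eq_mul, mul_comm]
    rfl
  exact (pow_left_inj₀ (norm_nonneg _) (Real.sqrt_nonneg _) two_ne_zero).mp
    (by exact_mod_cast h1)

/-- A norm preserving operator on the Fock space, as an isometry of the Hilbert space. -/
def toIsometry (T : Fock ħ j →ₗ[ℂ] Fock ħ j) (hT : ∀ f, fockNorm ħ j (T f) = fockNorm ħ j f) :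
    FockH ħ j →ₗᵢ[ℂ] FockH ħ j where
  toLinearMap := (toH ħ j).toLinearMap ∘ₗ T ∘ₗ (toH ħ j).symm.toLinearMap
  norm_map' f := by
    obtain ⟨f, rfl⟩ := (toH ħ j).surjective f
    change ‖toH ħ j (T f)‖ = _
    rw [norm_toH, norm_toH, hT]

theorem inner_map_of_fockNorm {T : Fock ħ j →ₗ[ℂ] Fock ħ j}
    (hT : ∀ f, fockNorm ħ j (T f) = fockNorm ħ j f) (f g : Fock ħ j) :
    inner ℂ (toH ħ j (T f)) (toH ħ j (T g)) = inner ℂ (toH ħ j f) (toH ħ j g) :=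
  (toIsometry T hT).inner_map_map (toH ħ j f) (toH ħ j g)

/-- Since e₀ = 1, this is the Gaussian mean value property; Heisenberg translation carries it to
other points. -/
theorem inner_coherent_zero (f : Fock ħ j) :
    inner ℂ (toH ħ j (coherent ħ j 0)) (toH ħ j f) = f.1 0 := by
  have := isProbabilityMeasure_gaussMeasure (E := Cpx j) hħ.out
  rw [inner_toH, ← integral_gaussMeasure_of_differentiable hħ.out f.2.1
    ((memLp_of_mem_Fock f).integrable one_le_two)]
  refine integral_congr_ae (Filter.Eventually.of_forall fun z => ?_)
  simp [coherent_apply, herm]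

/-- The reproducing property of the coherent states. -/
theorem inner_coherent (v : Cpx j) (f : Fock ħ j) :
    inner ℂ (toH ħ j (coherent ħ j v)) (toH ħ j f) = f.1 v := by
  obtain ⟨v, rfl⟩ := (toCpx j).surjective v
  have h1 := inner_coherent_zero (heis ħ j (-v) 0 f)
  rw [← inner_map_of_fockNorm (fockNorm_heis v 0), heis_heis_neg, heis_apply] at h1
  rw [coherent_eq_heis, map_smul, inner_smul_left, h1, ← Complex.exp_conj, ← mul_assoc]
  unfold heisFactor
  rw [← Complex.exp_add, map_neg, zero_sub, neg_neg]
  have h2 : herm j 0 (-toCpx j v) = 0 := by simp [herm]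
  rw [h2]
  have h3 : conj ((‖toCpx j v‖ : ℂ) ^ 2 / (4 * ħ)) = (‖toCpx j v‖ : ℂ) ^ 2 / (4 * ħ) := by
    simp [map_ofNat]
  rw [h3]
  simp

/-- The image in L² is closed. For a limit F, the function z ↦ ⟨e_z, F⟩ (inner product antilinear on
the left) is holomorphic, and by the reproducing property it is the pointwise limit of the
approximants. A subsequence of these tends to F almost everywhere, so F has a holomorphic
representative. -/
instance : CompleteSpace (FockH ħ j) := by
  rw [completeSpace_iff_isComplete_range (fockIsometry ħ j).isometry.isUniformInducing]
  refine IsClosed.isComplete (IsSeqClosed.isClosed ?_)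
  intro u F hu hlim
  choose f hf using hu
  have hg : ∀ z, inner ℂ (fockIsometry ħ j (toH ħ j (coherent ħ j z))) F
      = ∫ v, F v * Complex.exp (inner ℂ v z / (2 * ħ)) ∂gaussMeasure (Cpx j) ħ := by
    intro z
    rw [L2.inner_def]
    refine integral_congr_ae ?_
    filter_upwards [fockToLp_ae (coherent ħ j z)] with v hv
    change inner ℂ (fockToLp ħ j (toH ħ j (coherent ħ j z)) v) (F v) = _
    rw [hv, RCLike.inner_apply, coherent_apply, ← Complex.exp_conj, inner_eq_herm]
    congr 2
    simp [conj_herm, map_ofNat]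
  have hdiff := differentiable_integral_exp_inner hħ.out (Lp.memLp F)
  simp only [← hg] at hdiff
  have hpt : ∀ z, Filter.Tendsto (fun n => ((toH ħ j).symm (f n)).1 z) Filter.atTop
      (𝓝 (inner ℂ (fockIsometry ħ j (toH ħ j (coherent ħ j z))) F)) := by
    intro z
    have h1 : ∀ n, ((toH ħ j).symm (f n)).1 z
        = inner ℂ (fockIsometry ħ j (toH ħ j (coherent ħ j z))) (u n) := by
      intro n
      rw [← hf n, (fockIsometry ħ j).inner_map_map, ← inner_coherent z, LinearEquiv.apply_symm_apply]
    simp only [h1]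
    exact Filter.Tendsto.inner tendsto_const_nhds hlim
  obtain ⟨φ, hφ, hae⟩ := (tendstoInMeasure_of_tendsto_Lp hlim).exists_seq_tendsto_ae
  have hall : ∀ᵐ z ∂gaussMeasure (Cpx j) ħ, ∀ n, u n z = ((toH ħ j).symm (f n)).1 z := by
    rw [ae_all_iff]
    intro n
    rw [← hf n]
    exact fockToLp_ae ((toH ħ j).symm (f n))
  have hFg : F =ᵐ[gaussMeasure (Cpx j) ħ]
      fun z => inner ℂ (fockIsometry ħ j (toH ħ j (coherent ħ j z))) F := by
    filter_upwards [hae, hall] with z h1 h2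
    simp only [h2] at h1
    exact tendsto_nhds_unique h1 ((hpt z).comp hφ.tendsto_atTop)
  have hmem := mem_Fock_of_memLp hdiff ((memLp_congr_ae hFg).mp (Lp.memLp F))
  refine ⟨toH ħ j ⟨_, hmem⟩, ?_⟩
  apply Lp.ext
  exact (fockToLp_ae _).trans hFg.symm

/-- A vector orthogonal to every e_v vanishes at every v. -/
theorem dense_span_coherent :
    Dense (Submodule.span ℂ (Set.range fun v => toH ħ j (coherent ħ j v)) : Set (FockH ħ j)) := by
  rw [Submodule.dense_iff_topologicalClosure_eq_top, Submodule.topologicalClosure_eq_top_iff,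
    Submodule.eq_bot_iff]
  intro f hf
  obtain ⟨f, rfl⟩ := (toH ħ j).surjective f
  have : f = 0 := Fock.ext fun v => by
    rw [← inner_coherent]
    exact hf _ (Submodule.subset_span ⟨v, rfl⟩)
  rw [this, map_zero]

end FockHilbert

/-! ### Isometries from Gram matrices. -/

section Extension

/-- Equal Gram matrices give equal norms of linear combinations, so e a ↦ k a is well defined and
isometric on the span, and extends by density. -/
theorem exists_isometry_of_gram {H ι : Type*} [NormedAddCommGroup H] [InnerProductSpace ℂ H]
    [CompleteSpace H] (e k : ι → H) (hd : Dense (Submodule.span ℂ (Set.range e) : Set H))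
    (hg : ∀ a b, inner ℂ (k a) (k b) = inner ℂ (e a) (e b)) :
    ∃ T : H →ₗᵢ[ℂ] H, ∀ a, T (e a) = k a := by
  set L := Finsupp.linearCombination ℂ e with hL
  set K := Finsupp.linearCombination ℂ k with hK
  have hn : ∀ x, ‖K x‖ = ‖L x‖ := by
    intro x
    have h : inner ℂ (K x) (K x) = inner ℂ (L x) (L x) := by
      rw [hK, hL, Finsupp.linearCombination_apply, Finsupp.linearCombination_apply]
      simp only [Finsupp.sum, sum_inner, inner_sum, inner_smul_left, inner_smul_right, hg]
    rw [inner_self_eq_norm_sq_to_K, inner_self_eq_norm_sq_to_K] at h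
    exact (pow_left_inj₀ (norm_nonneg _) (norm_nonneg _) two_ne_zero).mp (by exact_mod_cast h)
  have hdr : DenseRange L := by
    rw [DenseRange, ← LinearMap.coe_range, hL, Finsupp.range_linearCombination]
    exact hd
  have hb : ∀ x, ‖K x‖ ≤ 1 * ‖L x‖ := fun x => by rw [one_mul, hn]
  have hT : ∀ x, K.extendOfNorm L (L x) = K x := LinearMap.extendOfNorm_eq hdr ⟨1, hb⟩
  refine ⟨{ toLinearMap := (K.extendOfNorm L).toLinearMap
            norm_map' := fun x => ?_ }, fun a => ?_⟩
  · refine hdr.induction_on (p := fun x => ‖K.extendOfNorm L x‖ = ‖x‖) x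
      (isClosed_eq (by fun_prop) continuous_norm) fun y => ?_
    rw [hT, hn]
  · have := hT (Finsupp.single a 1)
    simpa [hK, hL] using this

end Extension

/-! ### The states with the prescribed Berezin kernel and their Gram matrix. -/

section Kernel

variable {V : Type*} [AddCommGroup V] [Module ℝ V] {Ω : SymplecticForm V} [FiniteDimensional ℝ V]
  {ħ : ℝ} [hħ : Fact (0 < ħ)] {j : PCCS Ω}

/-- Two antilinearities cancel: this is a complex quadratic form. -/
theorem differentiable_herm_Z (g : Sp Ω) : Differentiable ℂ fun z : Cpx j => herm j z (Z j g z) := by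
  let B : Cpx j →L[ℂ] Cpx j →L[ℂ] ℂ := (innerSL ℂ).comp (ZL j g)
  have h : (fun z : Cpx j => herm j z (Z j g z)) = fun z => B z z := rfl
  rw [h]
  exact B.differentiable.clm_apply differentiable_id

theorem quadExp_zero_ZL (g : Sp Ω) (z : Cpx j) :
    quadExp ħ 0 (ZL j g) z = Complex.exp (-herm j z (Z j g z) / (4 * ħ)) := by
  unfold quadExp
  rw [zero_apply, inner_zero_right, zero_add, inner_eq_herm, ZL_apply]

theorem memLp_quadExp (g : Sp Ω) :
    MemLp (quadExp ħ 0 (ZL j g)) 2 (gaussMeasure (Cpx j) ħ) := by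
  have hħ0 := hħ.out
  rw [memLp_two_iff_integrable_sq_norm (continuous_quadExp _ _).aestronglyMeasurable]
  have hκ : ‖ZL j g‖ / (2 * ħ) < 1 / (2 * ħ) :=
    div_lt_div_of_pos_right (norm_ZL_lt_one g) (by positivity)
  refine (integrable_exp_quadratic hħ0 hκ 0).mono'
    ((continuous_quadExp _ _).norm.pow 2).aestronglyMeasurable
    (Filter.Eventually.of_forall fun z => ?_)
  have h1 := norm_quadExp_le hħ0 0 (ZL j g) z
  rw [norm_pow, norm_norm]
  refine (pow_le_pow_left₀ (norm_nonneg _) h1 2).trans (le_of_eq ?_)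
  rw [← Real.exp_nat_mul, norm_zero]
  congr 1
  push_cast
  field_simp
  ring

variable (ħ j) in
/-- The function `exp (-⟨z, Z_{g⁻¹} z⟩ / 4ħ)` of the Fock space. -/
def vac (g : Sp Ω) : Fock ħ j :=
  ⟨quadExp ħ 0 (ZL j g⁻¹), mem_Fock_of_memLp (by
    have h : quadExp ħ 0 (ZL j g⁻¹) = fun z => Complex.exp (-herm j z (Z j g⁻¹ z) / (4 * ħ)) :=
      funext (quadExp_zero_ZL g⁻¹)
    rw [h]
    simp only [div_eq_mul_inv]
    exact ((differentiable_herm_Z g⁻¹).neg.mul_const _).cexp) (memLp_quadExp g⁻¹)⟩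

theorem vac_apply (g : Sp Ω) (z : Cpx j) :
    (vac ħ j g).1 z = Complex.exp (-herm j z (Z j g⁻¹ z) / (4 * ħ)) := quadExp_zero_ZL g⁻¹ z

/-- Conjugation in the left factor turns ⟨z, Zz⟩ into ⟨Zz, z⟩. This overlap is the source of the
multiplication law. -/
theorem inner_vac (g₁ g₂ : Sp Ω) : inner ℂ (toH ħ j (vac ħ j g₁⁻¹)) (toH ħ j (vac ħ j g₂))
    = gaussInt ħ (ZL j g₁) (ZL j g₂⁻¹) := by
  rw [inner_toH]
  unfold gaussInt
  congr 1
  funext z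
  rw [vac_apply, vac_apply, inv_inv, ← Complex.exp_conj, ← Complex.exp_add]
  unfold quadExp
  congr 1
  rw [inner_eq_herm, inner_eq_herm, ZL_apply, ZL_apply]
  simp only [map_div₀, map_neg, map_mul, map_ofNat, Complex.conj_ofReal, conj_herm]
  ring

/-- The square of the integral is inverse to det(1 - Z_g²), while `detC_mul` for g g⁻¹ = 1 says that
|Det C_g|² |det(1 - Z_g²)| = 1. The normalisation |λ² Det C_g| = 1 originates here. -/
theorem norm_gaussInt_self (g : Sp Ω) : ‖gaussInt ħ (ZL j g) (ZL j g)‖ = ‖detC j g‖ := by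
  have h1 := gaussInt_sq hħ.out (isSymmAnti_ZL (j := j) g) (isSymmAnti_ZL g) (norm_ZL_lt_one g)
    (norm_ZL_lt_one g)
  have h2 := detC_mul (j := j) g g⁻¹
  rw [mul_inv_cancel, detC_one, detC_inv, oneSubZZ_eq, inv_inv] at h2
  have h3 := congrArg norm h1
  have h4 := congrArg norm h2
  simp only [norm_mul, norm_pow, norm_one, RCLike.norm_conj] at h3 h4
  refine (pow_left_inj₀ (norm_nonneg _) (norm_nonneg _) two_ne_zero).mp ?_
  have h5 : ‖(1 - (ZL j g).comp (ZL j g) : Cpx j →L[ℂ] Cpx j).det‖ ≠ 0 := fun h => by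
    rw [h] at h3
    simp at h3
  apply mul_right_cancel₀ h5
  rw [h3, h4]
  ring

theorem norm_detC_inv (g : Sp Ω) : ‖detC j g⁻¹‖ = ‖detC j g‖ := by
  rw [detC_inv, RCLike.norm_conj]

theorem norm_vac_sq (g : Sp Ω) : ‖toH ħ j (vac ħ j g)‖ ^ 2 = ‖detC j g‖ := by
  have h1 := inner_vac (ħ := ħ) (j := j) g⁻¹ g
  rw [inv_inv, inner_self_eq_norm_sq_to_K] at h1
  have h2 := congrArg norm h1
  rw [norm_gaussInt_self, norm_detC_inv] at h2
  rw [← h2]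
  simp

variable (ħ j) in
/-- The image of a coherent state under the unnormalised operator of kernel
`exp (1/4ħ) {2⟨C_g⁻¹ z, v⟩ - ⟨z, Z_{g⁻¹} z⟩ - ⟨Z_g v, v⟩}`. -/
def kerState (g : Sp Ω) (v : Cpx j) : Fock ħ j :=
  Complex.exp ((‖v‖ : ℂ) ^ 2 / (4 * ħ)) • heis ħ j (g.1 ((toCpx j).symm v)) 0 (vac ħ j g)

theorem herm_Z_add (g : Sp Ω) (x y : Cpx j) :
    herm j (x + y) (Z j g (x + y)) = herm j x (Z j g x) + 2 * herm j x (Z j g y)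
      + herm j y (Z j g y) := by
  have h : herm j y (Z j g x) = herm j x (Z j g y) := by
    rw [← conj_herm, Z_symm, conj_herm]
  rw [map_add, herm_add_left, herm_add_right, herm_add_right, h]
  ring

/-- Defining `kerState` as a translate of `vac` gives membership in the Fock space at once. The
explicit kernel then follows from w + Z_{g⁻¹}w = C_{g⁻¹}⁻¹v for w = gv. -/
theorem kerState_apply (g : Sp Ω) (z v : Cpx j) : (kerState ħ j g v).1 z =
    Complex.exp (1 / (4 * ħ) *
      (2 * herm j ((C j g).symm z) v - herm j z (Z j g⁻¹ z) - herm j (Z j g v) v)) := by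
  change Complex.exp ((‖v‖ : ℂ) ^ 2 / (4 * ħ)) *
    (heis ħ j (g.1 ((toCpx j).symm v)) 0 (vac ħ j g)).1 z = _
  rw [heis_apply, vac_apply]
  unfold heisFactor
  rw [← Complex.exp_add, ← Complex.exp_add]
  congr 1
  have hw : toCpx j (g.1 ((toCpx j).symm v)) = act j g v := rfl
  rw [hw]
  set w := act j g v with hwdef
  have h1 : herm j w w + herm j w (Z j g⁻¹ w) = herm j v v + herm j (Z j g v) v := by
    rw [← herm_add_right, hwdef, act_add_Z_inv, ← herm_C_symm, act_eq_C,
      LinearEquiv.symm_apply_apply, herm_add_left]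
  have h2 : herm j ((C j g).symm z) v = herm j z w + herm j z (Z j g⁻¹ w) := by
    rw [herm_C_symm, ← herm_add_right, hwdef, act_add_Z_inv]
  have h3 : herm j (z - w) (Z j g⁻¹ (z - w)) = herm j z (Z j g⁻¹ z)
      - 2 * herm j z (Z j g⁻¹ w) + herm j w (Z j g⁻¹ w) := by
    have hn : ∀ x y, herm j x (-y) = -herm j x y := fun x y => by
      rw [← zero_sub, herm_sub_right]; simp [herm]
    have hn' : ∀ x y, herm j (-x) y = -herm j x y := fun x y => by
      rw [← zero_sub, herm_sub_left]; simp [herm]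
    rw [sub_eq_add_neg, herm_Z_add, map_neg, hn, hn, hn']
    ring
  rw [h2, h3, norm_sq_eq_herm, norm_sq_eq_herm]
  have h4 : herm j (Z j g v) v = herm j w w + herm j w (Z j g⁻¹ w) - herm j v v := by
    rw [h1]; ring
  rw [h4]
  push_cast
  ring

/-- The kernel of g⁻¹ is the adjoint kernel, which will make its operator the inverse. -/
theorem conj_kerState (g : Sp Ω) (z v : Cpx j) :
    conj ((kerState ħ j g v).1 z) = (kerState ħ j g⁻¹ z).1 v := by
  rw [kerState_apply, kerState_apply, ← Complex.exp_conj]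
  congr 1
  simp only [map_div₀, map_mul, map_sub, map_one, map_ofNat, Complex.conj_ofReal, conj_herm, inv_inv]
  rw [herm_C_symm g⁻¹, inv_inv]
  ring

theorem norm_heis (v : V) (t : ℝ) (f : Fock ħ j) : ‖toH ħ j (heis ħ j v t f)‖ = ‖toH ħ j f‖ := by
  rw [norm_toH, norm_toH, fockNorm_heis]

/-- Heisenberg operators preserve norms, so only the norm of `vac` enters. -/
theorem inner_kerState_self (g : Sp Ω) (v : Cpx j) :
    inner ℂ (toH ħ j (kerState ħ j g v)) (toH ħ j (kerState ħ j g v))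
      = ‖detC j g‖ * Complex.exp (herm j v v / (2 * ħ)) := by
  rw [inner_self_eq_norm_sq_to_K]
  unfold kerState
  rw [map_smul, norm_smul, norm_heis, mul_comm, ← norm_vac_sq (ħ := ħ)]
  push_cast
  rw [mul_pow]
  congr 1
  rw [Complex.norm_exp]
  have h1 : ((‖v‖ : ℂ) ^ 2 / (4 * ħ)) = ((‖v‖ ^ 2 / (4 * ħ) : ℝ) : ℂ) := by push_cast; rfl
  rw [h1, Complex.ofReal_re, herm_self]
  change ((Real.exp (‖v‖ ^ 2 / (4 * ħ)) : ℝ) : ℂ) ^ 2 = _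
  rw [Complex.ofReal_exp, ← Complex.exp_nat_mul]
  congr 1
  push_cast
  ring

theorem norm_kerState_le (g : Sp Ω) : ∃ M : ℝ, 0 ≤ M ∧ ∀ z v : Cpx j, ‖(kerState ħ j g v).1 z‖ ≤
    Real.exp ((2 * M * ‖z‖ * ‖v‖ + ‖ZL j g⁻¹‖ * ‖z‖ ^ 2 + ‖v‖ ^ 2) / (4 * ħ)) := by
  have hħ0 := hħ.out
  set A := LinearMap.toContinuousLinearMap ((C j g).symm : Cpx j →ₗ[ℂ] Cpx j) with hA
  refine ⟨‖A‖, norm_nonneg _, fun z v => ?_⟩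
  rw [kerState_apply]
  refine (Complex.norm_exp_le_exp_norm _).trans (Real.exp_le_exp.mpr ?_)
  have h0 : ‖(1 / (4 * ħ) : ℂ)‖ = 1 / (4 * ħ) := by
    rw [norm_div, norm_mul, Complex.norm_real, Real.norm_of_nonneg hħ0.le]; simp
  rw [norm_mul, h0, one_div_mul_eq_div]
  refine div_le_div_of_nonneg_right ?_ (by positivity)
  have h1 : ‖2 * herm j ((C j g).symm z) v‖ ≤ 2 * ‖A‖ * ‖z‖ * ‖v‖ := by
    rw [norm_mul, RCLike.norm_ofNat, mul_assoc, mul_assoc]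
    refine mul_le_mul_of_nonneg_left ((norm_herm_le _ _).trans ?_) (by norm_num)
    rw [← mul_assoc]
    exact mul_le_mul_of_nonneg_right (A.le_opNorm z) (norm_nonneg _)
  have h2 : ‖herm j z (Z j g⁻¹ z)‖ ≤ ‖ZL j g⁻¹‖ * ‖z‖ ^ 2 := by
    refine (norm_herm_le _ _).trans ?_
    have := (ZL j g⁻¹).le_opNorm z
    rw [ZL_apply] at this
    nlinarith [norm_nonneg z]
  have h3 : ‖herm j (Z j g v) v‖ ≤ ‖v‖ ^ 2 := by
    refine (norm_herm_le _ _).trans ?_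
    have := (ZL j g).le_opNorm v
    rw [ZL_apply] at this
    have h4 := norm_ZL_lt_one (j := j) g
    nlinarith [norm_nonneg v, mul_le_of_le_one_left (norm_nonneg v) h4.le]
  have h4 := norm_sub_le (2 * herm j ((C j g).symm z) v - herm j z (Z j g⁻¹ z)) (herm j (Z j g v) v)
  have h5 := norm_sub_le (2 * herm j ((C j g).symm z) v) (herm j z (Z j g⁻¹ z))
  linarith

/-- The states depend antiholomorphically on their label, so the inner product is holomorphic in the
left label and antiholomorphic in the right one; hence the conjugate of τ on the right. -/
theorem differentiable_inner_kerState (g : Sp Ω) (a b : Cpx j) :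
    Differentiable ℂ fun τ : ℂ => inner ℂ (toH ħ j (kerState ħ j g (a + τ • b)))
      (toH ħ j (kerState ħ j g (a + conj τ • b))) := by
  have hħ0 := hħ.out
  rw [← differentiableOn_univ]
  simp only [inner_toH]
  refine differentiableOn_integral_of_dominated isOpen_univ (fun τ _ => ?_) (fun z => ?_)
    (fun τ _ => ?_)
  · refine Continuous.aestronglyMeasurable ?_
    exact (Complex.continuous_conj.comp (kerState ħ j g (a + τ • b)).2.1.continuous).mul
      (kerState ħ j g (a + conj τ • b)).2.1.continuous
  · simp only [kerState_apply, ← Complex.exp_conj]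
    simp only [map_div₀, map_mul, map_sub, map_one, map_ofNat, Complex.conj_ofReal, conj_herm,
      map_add, herm_add_left, herm_add_right, herm_smul_left, herm_smul_right,
      LinearMap.map_smulₛₗ, Complex.conj_conj]
    fun_prop
  · obtain ⟨M, hM0, hM⟩ := norm_kerState_le (ħ := ħ) (j := j) g
    set R := ‖a‖ + (‖τ‖ + 1) * ‖b‖ with hR
    have hR0 : 0 ≤ R := by positivity
    have hκ : ‖ZL j g⁻¹‖ / (2 * ħ) < 1 / (2 * ħ) :=
      div_lt_div_of_pos_right (norm_ZL_lt_one g⁻¹) (by positivity)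
    refine ⟨1, one_pos, _, (integrable_exp_quadratic hħ0 hκ (M * R / ħ)).const_mul
      (Real.exp (R ^ 2 / (2 * ħ))), fun τ' hτ' z => ?_⟩
    have hτR : ‖τ'‖ ≤ ‖τ‖ + 1 := by
      rw [Metric.mem_ball, dist_eq_norm] at hτ'
      have := norm_le_norm_add_norm_sub' τ' τ
      linarith
    have hv : ∀ c : ℂ, ‖c‖ = ‖τ'‖ → ‖(kerState ħ j g (a + c • b)).1 z‖ ≤
        Real.exp ((2 * M * ‖z‖ * R + ‖ZL j g⁻¹‖ * ‖z‖ ^ 2 + R ^ 2) / (4 * ħ)) := by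
      intro c hc
      have h1 : ‖a + c • b‖ ≤ R := by
        refine (norm_add_le _ _).trans ?_
        rw [norm_smul, hc, hR]
        gcongr
      refine (hM z _).trans (Real.exp_le_exp.mpr ?_)
      gcongr
    rw [norm_mul, RCLike.norm_conj]
    refine (mul_le_mul (hv τ' rfl) (hv (conj τ') (RCLike.norm_conj _)) (norm_nonneg _)
      (Real.exp_pos _).le).trans (le_of_eq ?_)
    rw [← Real.exp_add, ← Real.exp_add]
    congr 1
    field_simp
    ring

/-- The Gram matrix of the kernel states is proportional to that of the coherent states. -/
theorem inner_kerState (g : Sp Ω) (v w : Cpx j) :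
    inner ℂ (toH ħ j (kerState ħ j g v)) (toH ħ j (kerState ħ j g w))
      = ‖detC j g‖ * inner ℂ (toH ħ j (coherent ħ j v)) (toH ħ j (coherent ħ j w)) := by
  rw [inner_coherent, coherent_apply]
  -- Here v = a + ib and w = a - ib. Real τ gives diagonal entries, and the identity continues to τ
  -- = i.
  set a : Cpx j := (1 / 2 : ℂ) • (v + w) with ha
  set b : Cpx j := (1 / (2 * Complex.I) : ℂ) • (v - w) with hb
  have e1 : a + Complex.I • b = v := by
    rw [ha, hb, smul_smul]
    have : Complex.I * (1 / (2 * Complex.I)) = 1 / 2 := by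
      have := Complex.I_ne_zero
      field_simp
    rw [this]
    module
  have e2 : a + conj Complex.I • b = w := by
    rw [ha, hb, smul_smul]
    have : conj Complex.I * (1 / (2 * Complex.I)) = -(1 / 2) := by
      have := Complex.I_ne_zero
      rw [Complex.conj_I]
      field_simp
    rw [this]
    module
  have h := eqOn_of_eq_on_reals isOpen_univ convex_univ (Set.mem_univ 0)
    (differentiable_inner_kerState (ħ := ħ) g a b).differentiableOn
    (g := fun τ => ‖detC j g‖ * Complex.exp (herm j (a + τ • b) (a + conj τ • b) / (2 * ħ))) ?_ ?_
    (Set.mem_univ Complex.I)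
  · simpa only [e1, e2] using h
  · refine Differentiable.differentiableOn ?_
    simp only [herm_add_left, herm_add_right, herm_smul_left, herm_smul_right, Complex.conj_conj,
      div_eq_mul_inv]
    fun_prop
  · intro t _
    simp only [Complex.conj_ofReal]
    exact inner_kerState_self g _

end Kernel

/-! ### Existence and uniqueness of elements with given parameters, and the product of parameters.
-/

section Metaplectic

variable {V : Type*} [AddCommGroup V] [Module ℝ V] {Ω : SymplecticForm V} [FiniteDimensional ℝ V]
  {ħ : ℝ} [hħ : Fact (0 < ħ)] {j : PCCS Ω}

/-- Norm preserving operators that agree on the coherent states are equal. -/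
theorem eq_of_coherent {S T : Fock ħ j →ₗ[ℂ] Fock ħ j}
    (hS : ∀ f, fockNorm ħ j (S f) = fockNorm ħ j f) (hT : ∀ f, fockNorm ħ j (T f) = fockNorm ħ j f)
    (h : ∀ v, S (coherent ħ j v) = T (coherent ħ j v)) (f : Fock ħ j) : S f = T f := by
  have h1 : (toIsometry S hS).toContinuousLinearMap = (toIsometry T hT).toContinuousLinearMap := by
    refine ContinuousLinearMap.ext_on dense_span_coherent ?_
    rintro _ ⟨v, rfl⟩
    exact congrArg (toH ħ j) (h v)
  exact congrArg (fun A => (toH ħ j).symm (A (toH ħ j f))) h1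

theorem exists_operator (g : Sp Ω) {l : ℂ} (hl : ‖l ^ 2 * detC j g‖ = 1) :
    ∃ S : Fock ħ j →ₗ[ℂ] Fock ħ j, (∀ f, fockNorm ħ j (S f) = fockNorm ħ j f) ∧
      ∀ v, S (coherent ħ j v) = l • kerState ħ j g v := by
  obtain ⟨T, hT⟩ := exists_isometry_of_gram (fun v => toH ħ j (coherent ħ j v))
    (fun v => toH ħ j (l • kerState ħ j g v)) dense_span_coherent (fun v w => by
      rw [map_smul, map_smul, inner_smul_left, inner_smul_right, inner_kerState, ← mul_assoc,
        ← mul_assoc, Complex.conj_mul', ← Complex.ofReal_pow, ← Complex.ofReal_mul]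
      rw [norm_mul, norm_pow] at hl
      rw [hl, Complex.ofReal_one, one_mul])
  refine ⟨(toH ħ j).symm.toLinearMap ∘ₗ T.toLinearMap ∘ₗ (toH ħ j).toLinearMap, fun f => ?_,
    fun v => congrArg (toH ħ j).symm (hT v)⟩
  rw [← norm_toH, ← norm_toH]
  exact T.norm_map (toH ħ j f)

/-- By `conj_kerState` and density, S' is adjoint to S. As S' is isometric, (S S' f)(z) = ⟨S' e_z,
S' f⟩ = ⟨e_z, f⟩ = f(z). -/
theorem operator_comp {g : Sp Ω} {l : ℂ} {S S' : Fock ħ j →ₗ[ℂ] Fock ħ j}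
    (hS : ∀ f, fockNorm ħ j (S f) = fockNorm ħ j f)
    (hS' : ∀ f, fockNorm ħ j (S' f) = fockNorm ħ j f)
    (h : ∀ v, S (coherent ħ j v) = l • kerState ħ j g v)
    (h' : ∀ v, S' (coherent ħ j v) = conj l • kerState ħ j g⁻¹ v) (f : Fock ħ j) :
    S (S' f) = f := by
  have key : ∀ (z : Cpx j) (f : Fock ħ j),
      inner ℂ (toH ħ j (S' (coherent ħ j z))) (toH ħ j f) = (S f).1 z := by
    intro z f
    have h1 : innerSL ℂ (toH ħ j (S' (coherent ħ j z)))
        = (innerSL ℂ (toH ħ j (coherent ħ j z))).comp (toIsometry S hS).toContinuousLinearMap := by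
      refine ContinuousLinearMap.ext_on dense_span_coherent ?_
      rintro _ ⟨v, rfl⟩
      change inner ℂ (toH ħ j (S' (coherent ħ j z))) (toH ħ j (coherent ħ j v))
        = inner ℂ (toH ħ j (coherent ħ j z)) (toH ħ j (S (coherent ħ j v)))
      rw [inner_coherent, h, ← inner_conj_symm, inner_coherent, h']
      change conj (conj l * (kerState ħ j g⁻¹ z).1 v) = l * (kerState ħ j g v).1 z
      rw [← conj_kerState, map_mul, Complex.conj_conj, Complex.conj_conj]
    have h2 := congrArg (fun A => A (toH ħ j f)) h1
    exact h2.trans (inner_coherent z (S f))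
  refine Fock.ext fun z => ?_
  rw [← key, inner_map_of_fockNorm hS', inner_coherent]

theorem heis_time (v : V) (t : ℝ) (f : Fock ħ j) :
    heis ħ j v t f = Complex.exp (-Complex.I * t / ħ) • heis ħ j v 0 f := by
  refine Fock.ext fun z => ?_
  change _ = Complex.exp (-Complex.I * t / ħ) * (heis ħ j v 0 f).1 z
  rw [heis_apply, heis_apply, ← mul_assoc]
  unfold heisFactor
  rw [← Complex.exp_add]
  congr 2
  push_cast
  ring

theorem kerState_zero (g : Sp Ω) : kerState ħ j g 0 = vac ħ j g := by
  refine Fock.ext fun z => ?_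
  rw [kerState_apply, vac_apply]
  congr 1
  simp [herm]
  ring

theorem operator_heis_vacuum {g : Sp Ω} {l : ℂ} {S : Fock ħ j →ₗ[ℂ] Fock ħ j}
    (h : ∀ v, S (coherent ħ j v) = l • kerState ħ j g v) (v : V) (t : ℝ) :
    S (heis ħ j v t (coherent ħ j 0)) = heis ħ j (g.1 v) t (l • vac ħ j g) := by
  rw [heis_time v, heis_time (g.1 v), map_smul, map_smul]
  congr 1
  have h1 := h (toCpx j v)
  rw [coherent_eq_heis, map_smul, kerState, smul_comm] at h1
  exact smul_right_injective _ (Complex.exp_ne_zero _) h1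

/-- On coherent states both sides are translates of the image of the vacuum, and their phases agree
because g preserves Ω. -/
theorem operator_heis {g : Sp Ω} {l : ℂ} {S : Fock ħ j →ₗ[ℂ] Fock ħ j}
    (hS : ∀ f, fockNorm ħ j (S f) = fockNorm ħ j f)
    (h : ∀ v, S (coherent ħ j v) = l • kerState ħ j g v) (v : V) (t : ℝ) (f : Fock ħ j) :
    heis ħ j (g.1 v) t (S f) = S (heis ħ j v t f) := by
  refine eq_of_coherent (S := heis ħ j (g.1 v) t ∘ₗ S) (T := S ∘ₗ heis ħ j v t)
    (fun f => ?_) (fun f => ?_) (fun w => ?_) f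
  · exact (fockNorm_heis _ _ _).trans (hS f)
  · exact (hS _).trans (fockNorm_heis _ _ _)
  · obtain ⟨w, rfl⟩ := (toCpx j).surjective w
    simp only [LinearMap.comp_apply]
    rw [coherent_eq_heis, map_smul, map_smul, map_smul, map_smul, heis_heis,
      operator_heis_vacuum h, operator_heis_vacuum h, heis_heis, map_add, g.2]

/-- The existence of operators with given parameters. -/
theorem exists_hasParameters (g : Sp Ω) {l : ℂ} (hl : ‖l ^ 2 * detC j g‖ = 1) :
    ∃ x : Mpc ħ j, HasParameters x g l := by
  have hl' : ‖(conj l) ^ 2 * detC j g⁻¹‖ = 1 := by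
    rw [detC_inv, ← map_pow, ← map_mul, RCLike.norm_conj, hl]
  obtain ⟨S, hS, h⟩ := exists_operator (ħ := ħ) g hl
  obtain ⟨S', hS', h'⟩ := exists_operator (ħ := ħ) g⁻¹ hl'
  have h1 := operator_comp hS hS' h h'
  have h2 := operator_comp hS' hS h' (by rwa [Complex.conj_conj, inv_inv])
  refine ⟨⟨(LinearEquiv.ofLinearMap S S' (LinearMap.ext h1) (LinearMap.ext h2), g), hS,
    fun v t f => operator_heis hS h v t f⟩, rfl, hl, fun z v => ?_⟩
  change (S (coherent ħ j v)).1 z = _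
  rw [h]
  change l * (kerState ħ j g v).1 z = _
  rw [kerState_apply]

/-- Liouville's theorem for 1/(f + i), whose modulus is at most 1. -/
theorem eq_of_im_eq_zero {E : Type*} [NormedAddCommGroup E] [NormedSpace ℂ E] {f : E → ℂ}
    (hf : Differentiable ℂ f) (h : ∀ z, (f z).im = 0) (z w : E) : f z = f w := by
  have h1 : ∀ z, 1 ≤ ‖f z + Complex.I‖ := fun z => by
    have := Complex.abs_im_le_norm (f z + Complex.I)
    rwa [Complex.add_im, h, Complex.I_im, zero_add, abs_one] at this
  have h0 : ∀ z, f z + Complex.I ≠ 0 := fun z => norm_pos_iff.mp (one_pos.trans_le (h1 z))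
  have h2 : Differentiable ℂ fun z => (f z + Complex.I)⁻¹ := (hf.add_const _).inv h0
  have h3 := h2.apply_eq_apply_of_bounded (isBounded_iff_forall_norm_le.mpr ⟨1, by
    rintro _ ⟨z, rfl⟩
    rw [norm_inv]
    exact inv_le_one_of_one_le₀ (h1 z)⟩) z w
  exact add_right_cancel (inv_injective h3)

theorem apply_inv_apply (x : Mpc ħ j) (f : Fock ħ j) : x.1.1 ((x⁻¹).1.1 f) = f :=
  x.1.1.apply_symm_apply f

theorem inner_apply_right (x : Mpc ħ j) (f f' : Fock ħ j) :
    inner ℂ (toH ħ j f) (toH ħ j (x.1.1 f')) = inner ℂ (toH ħ j ((x⁻¹).1.1 f)) (toH ħ j f') := by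
  have h := inner_map_of_fockNorm (T := (x.1.1 : Fock ħ j →ₗ[ℂ] Fock ħ j)) x.2.1 ((x⁻¹).1.1 f) f'
  refine Eq.trans ?_ h
  change _ = inner ℂ (toH ħ j (x.1.1 ((x⁻¹).1.1 f))) (toH ħ j (x.1.1 f'))
  rw [apply_inv_apply]

/-- Schur's lemma for the Heisenberg representation. -/
theorem exists_scalar_of_sigma_eq_one (x : Mpc ħ j) (hx : sigma ħ j x = 1) :
    ∃ u : Circle, x = scalar ħ j u := by
  have hcomm : ∀ (v : V) (t : ℝ) (f : Fock ħ j), heis ħ j v t (x.1.1 f) = x.1.1 (heis ħ j v t f) := by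
    intro v t f
    have h := x.2.2 v t f
    have hx' : x.1.2 = 1 := hx
    rw [hx'] at h
    exact h
  set φ := x.1.1 (coherent ħ j 0) with hφ
  set φ' := (x⁻¹).1.1 (coherent ħ j 0) with hφ'
  have hcoh : ∀ v : V, x.1.1 (coherent ħ j (toCpx j v)) =
      Complex.exp ((‖toCpx j v‖ : ℂ) ^ 2 / (4 * ħ)) • heis ħ j v 0 φ := by
    intro v
    rw [coherent_eq_heis, map_smul, ← hcomm]
  -- Both sides are the matrix element of U between e₀ and e_v, computed through U on e_v and
  -- through U⁻¹ on e₀.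
  have h1 : ∀ v : Cpx j, φ.1 (-v) = conj (φ'.1 v) := by
    intro v
    obtain ⟨v, rfl⟩ := (toCpx j).surjective v
    have h2 := inner_apply_right x (coherent ħ j 0) (coherent ħ j (toCpx j v))
    rw [inner_coherent_zero, ← inner_conj_symm, inner_coherent, hcoh] at h2
    rw [hφ', ← h2]
    change _ = Complex.exp ((‖toCpx j v‖ : ℂ) ^ 2 / (4 * ħ)) * (heis ħ j v 0 φ).1 0
    rw [heis_apply, ← mul_assoc]
    unfold heisFactor
    rw [← Complex.exp_add, zero_sub]
    simp [herm]
  have hd : Differentiable ℂ fun v => φ.1 (-v) := φ.2.1.comp differentiable_id.neg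
  -- A holomorphic function conjugate to a holomorphic one is constant: their sum, and i times their
  -- difference, are real-valued.
  have hconst : ∀ v, φ.1 v = φ.1 0 := by
    intro v
    have h2 := eq_of_im_eq_zero (hd.add φ'.2.1) (fun z => by
      simp only [Pi.add_apply]; rw [h1]; simp) (-v) 0
    have h3 := eq_of_im_eq_zero ((hd.sub φ'.2.1).const_mul Complex.I) (fun z => by
      simp only [Pi.sub_apply]; rw [h1]; simp) (-v) 0
    have h4 := mul_left_cancel₀ Complex.I_ne_zero h3
    simp only [Pi.add_apply, Pi.sub_apply, neg_neg, neg_zero] at h2 h4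
    linear_combination (h2 + h4) / 2
  have hφc : φ = φ.1 0 • coherent ħ j 0 := Fock.ext fun v => by
    change _ = φ.1 0 * (coherent ħ j 0).1 v
    rw [hconst v, coherent_apply]
    simp [herm]
  have hnorm : ‖φ.1 0‖ = 1 := by
    have h2 : ‖toH ħ j φ‖ = ‖toH ħ j (coherent ħ j 0)‖ := by
      rw [norm_toH, norm_toH]
      exact x.2.1 _
    rw [hφc, map_smul, norm_smul] at h2
    refine mul_right_cancel₀ ?_ (h2.trans (one_mul _).symm)
    intro h3
    have h4 := inner_coherent_zero (coherent ħ j 0)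
    rw [inner_self_eq_norm_sq_to_K, h3, coherent_apply] at h4
    simp [herm] at h4
  refine ⟨⟨φ.1 0, mem_sphere_zero_iff_norm.mpr hnorm⟩, ?_⟩
  apply Subtype.ext
  refine Prod.ext (LinearEquiv.ext fun f => ?_) hx
  refine eq_of_coherent (S := (x.1.1 : Fock ħ j →ₗ[ℂ] Fock ħ j))
    (T := ((scalar ħ j ⟨φ.1 0, mem_sphere_zero_iff_norm.mpr hnorm⟩).1.1 :
      Fock ħ j →ₗ[ℂ] Fock ħ j)) x.2.1 (scalar ħ j _).2.1 (fun v => ?_) f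
  obtain ⟨v, rfl⟩ := (toCpx j).surjective v
  change x.1.1 (coherent ħ j (toCpx j v)) = φ.1 0 • coherent ħ j (toCpx j v)
  rw [hcoh, coherent_eq_heis, hφc, map_smul, smul_comm, ← hφc]

theorem exists_scalar_mul (x y : Mpc ħ j) (h : sigma ħ j x = sigma ħ j y) :
    ∃ u : Circle, x = scalar ħ j u * y := by
  obtain ⟨u, hu⟩ := exists_scalar_of_sigma_eq_one (x * y⁻¹) (by
    rw [map_mul, map_inv, h, mul_inv_cancel])
  exact ⟨u, by rw [← hu, inv_mul_cancel_right]⟩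

theorem HasParameters.lam_eq {x : Mpc ħ j} {g : Sp Ω} {l : ℂ} (h : HasParameters x g l) :
    lam x = l := by
  unfold lam
  rw [h.2.2]
  simp [herm]

/-- The kernel is compared with that of an element y over the same g with λ(y) = |Det C_g|^(-1/2);
Schur's lemma leaves only a scalar of modulus one. -/
theorem hasParameters_lam (x : Mpc ħ j) : HasParameters x (sigma ħ j x) (lam x) := by
  set g := sigma ħ j x with hg
  have hd : 0 < ‖detC j g‖ := norm_pos_iff.mpr (detC_ne_zero g)
  obtain ⟨y, hy⟩ := exists_hasParameters (ħ := ħ) (j := j) g (l := ((Real.sqrt ‖detC j g‖)⁻¹ : ℝ))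
    (by
      rw [norm_mul, norm_pow, Complex.norm_real, Real.norm_of_nonneg (by positivity), inv_pow,
        Real.sq_sqrt hd.le, inv_mul_cancel₀ hd.ne'])
  obtain ⟨u, hu⟩ := exists_scalar_mul x y (hg.symm.trans hy.1.symm)
  have hl : lam x = u * lam y := by rw [hu, lam_scalar_mul]
  refine ⟨rfl, ?_, fun z v => ?_⟩
  · rw [hl, hy.lam_eq, mul_pow, mul_assoc, norm_mul, norm_pow, Circle.norm_coe, hy.2.1]
    simp
  · rw [hl, hy.lam_eq, mul_assoc, ← hy.2.2 z v, hu]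
    rfl

theorem norm_lam (x : Mpc ħ j) : ‖lam x ^ 2 * detC j (sigma ħ j x)‖ = 1 :=
  (hasParameters_lam x).2.1

theorem lam_ne_zero (x : Mpc ħ j) : lam x ≠ 0 := fun h => by
  have := norm_lam x
  rw [h] at this
  simp at this

theorem eq_of_sigma_eq_of_lam_eq {x y : Mpc ħ j} (h : sigma ħ j x = sigma ħ j y)
    (hl : lam x = lam y) : x = y := by
  obtain ⟨u, rfl⟩ := exists_scalar_mul x y h
  rw [lam_scalar_mul] at hl
  have h1 : u = 1 := Circle.ext (by
    rw [Circle.coe_one]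
    exact mul_right_cancel₀ (lam_ne_zero y) (hl.trans (one_mul _).symm))
  rw [h1, map_one, one_mul]

theorem existsUnique_hasParameters (g : Sp Ω) {l : ℂ} (hl : ‖l ^ 2 * detC j g‖ = 1) :
    ∃! x : Mpc ħ j, HasParameters x g l := by
  obtain ⟨x, hx⟩ := exists_hasParameters (ħ := ħ) g hl
  exact ⟨x, hx, fun y hy => eq_of_sigma_eq_of_lam_eq (hy.1.trans hx.1.symm)
    (hy.lam_eq.trans hx.lam_eq.symm)⟩

theorem apply_vacuum (x : Mpc ħ j) :
    x.1.1 (coherent ħ j 0) = lam x • vac ħ j (sigma ħ j x) := by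
  refine Fock.ext fun z => ?_
  rw [← kerState_zero]
  change _ = lam x * (kerState ħ j (sigma ħ j x) 0).1 z
  rw [kerState_apply]
  exact (hasParameters_lam x).2.2 z 0

theorem lam_inv (x : Mpc ħ j) : lam x⁻¹ = conj (lam x) := by
  have h := inner_apply_right x⁻¹ (coherent ħ j 0) (coherent ħ j 0)
  rw [inv_inv, inner_coherent_zero, ← inner_conj_symm, inner_coherent_zero] at h
  exact h

/-- The multiplication of `Mp^c(V, Ω, j)` in terms of parameters. -/
theorem lam_mul (x y : Mpc ħ j) : lam (x * y) = lam x * lam y *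
    Complex.exp (-(1 / 2) * logDet j (oneSubZZ j (sigma ħ j x) (sigma ħ j y))) := by
  -- Unitarity gives λ(xy) = ⟨e₀, xy e₀⟩ = ⟨x⁻¹e₀, y e₀⟩, an overlap of two multiples of `vac`.
  have h := inner_apply_right x (coherent ħ j 0) (y.1.1 (coherent ħ j 0))
  have hv : ∀ x : Mpc ħ j, toH ħ j (x.1.1 (coherent ħ j 0))
      = lam x • toH ħ j (vac ħ j (sigma ħ j x)) := fun x => by rw [apply_vacuum, map_smul]
  rw [inner_coherent_zero, hv, hv, inner_smul_left, inner_smul_right, lam_inv, Complex.conj_conj,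
    map_inv, inner_vac, gaussInt_ZL hħ.out, ← mul_assoc] at h
  exact h

end Metaplectic

/-! ### Continuity of 1 - Z_{g₁}Z_{g₂⁻¹} and its value on the unitary group. -/

section Continuity

variable {V : Type*} [NormedAddCommGroup V] [NormedSpace ℝ V] [FiniteDimensional ℝ V]
  {Ω : SymplecticForm V} {j : PCCS Ω}

variable (j) in
/-- The `j`-linear part of an endomorphism, as a linear map of normed spaces. -/
def linPartₗ : (V →L[ℝ] V) →ₗ[ℝ] (Cpx j →L[ℂ] Cpx j) where
  toFun A := LinearMap.toContinuousLinearMap (linPart j (A : V →ₗ[ℝ] V))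
  map_add' A B := by
    refine ContinuousLinearMap.ext fun x => ?_
    change toCpx j ((1 / 2 : ℝ) • (A x + B x - j.J (A (j.J x) + B (j.J x)))) =
      toCpx j ((1 / 2 : ℝ) • (A x - j.J (A (j.J x))) + (1 / 2 : ℝ) • (B x - j.J (B (j.J x))))
    congr 1
    rw [map_add]
    module
  map_smul' r A := by
    refine ContinuousLinearMap.ext fun x => ?_
    obtain ⟨v, rfl⟩ := (toCpx j).surjective x
    refine Eq.trans ?_ ((toCpxₗ j).map_smul r ((1 / 2 : ℝ) • (A v - j.J (A (j.J v)))))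
    change toCpxₗ j ((1 / 2 : ℝ) • (r • A v - j.J (r • A (j.J v)))) = _
    congr 1
    rw [map_smul]
    module

theorem isUnit_linPartₗ (g : Sp Ω) : IsUnit (linPartₗ j (toEnd g)) :=
  ⟨(ContinuousLinearEquiv.unitsEquiv ℂ (Cpx j)).symm (C j g).toContinuousLinearEquiv, rfl⟩

/-- Only linear parts of g₁, g₂ and g₁g₂ remain, and these are linear in the endomorphisms, so
continuity reduces to that of inversion. -/
theorem oneSubZZ_eq_inverse (g₁ g₂ : Sp Ω) : oneSubZZ j g₁ g₂ =
    Ring.inverse (linPartₗ j (toEnd g₁)) * linPartₗ j (toEnd (g₁ * g₂)) *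
      Ring.inverse (linPartₗ j (toEnd g₂)) := by
  have h : linPartₗ j (toEnd (g₁ * g₂)) =
      linPartₗ j (toEnd g₁) * oneSubZZ j g₁ g₂ * linPartₗ j (toEnd g₂) :=
    ContinuousLinearMap.ext fun x => C_mul g₁ g₂ x
  rw [h, ← mul_assoc, ← mul_assoc, Ring.inverse_mul_cancel _ (isUnit_linPartₗ g₁), one_mul,
    mul_assoc, Ring.mul_inverse_cancel _ (isUnit_linPartₗ g₂), mul_one]

theorem continuous_oneSubZZ {X : Type*} [TopologicalSpace X] {a b : X → Sp Ω}
    (ha : Continuous fun x => toEnd (a x)) (hb : Continuous fun x => toEnd (b x))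
    (hab : Continuous fun x => toEnd (a x * b x)) :
    Continuous fun x => oneSubZZ j (a x) (b x) := by
  have : CompleteSpace (Cpx j) := FiniteDimensional.complete ℂ (Cpx j)
  have hL : Continuous (linPartₗ j) := LinearMap.continuous_of_finiteDimensional _
  have hinv : ∀ {c : X → Sp Ω}, (Continuous fun x => toEnd (c x)) →
      Continuous fun x => Ring.inverse (linPartₗ j (toEnd (c x))) := by
    intro c hc
    rw [continuous_iff_continuousAt]
    intro x
    obtain ⟨u, hu⟩ := isUnit_linPartₗ (j := j) (c x)
    have h1 := NormedRing.inverse_continuousAt u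
    rw [hu] at h1
    exact ContinuousAt.comp (f := fun x => linPartₗ j (toEnd (c x))) h1 (hL.comp hc).continuousAt
  simp only [oneSubZZ_eq_inverse]
  exact ((hinv ha).mul (hL.comp hab)).mul (hinv hb)

theorem Z_eq_zero_of_mem_unitaryGroupJ {g : Sp Ω} (hg : g ∈ unitaryGroupJ j) (x : Cpx j) :
    Z j g x = 0 := by
  have h : D j g x = 0 := by
    change toCpx j ((1 / 2 : ℝ) • (g.1 ((toCpx j).symm x) + j.J (g.1 (j.J ((toCpx j).symm x))))) = 0
    rw [hg, j.sq, add_neg_cancel, smul_zero, map_zero]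
  exact (congrArg (C j g).symm h).trans (map_zero _)

theorem oneSubZZ_of_mem_unitaryGroupJ {g₁ : Sp Ω} (g₂ : Sp Ω) (h : g₁ ∈ unitaryGroupJ j) :
    oneSubZZ j g₁ g₂ = 1 := by
  refine ContinuousLinearMap.ext fun x => ?_
  change x - Z j g₁ (Z j g₂⁻¹ x) = x
  rw [Z_eq_zero_of_mem_unitaryGroupJ h, sub_zero]

end Continuity

/-! ### Lifts as functions on H. -/

section Lifts

variable {V : Type*} [NormedAddCommGroup V] [NormedSpace ℝ V] [FiniteDimensional ℝ V]
  {Ω : SymplecticForm V} {j : PCCS Ω} {ħ : ℝ} [hħ : Fact (0 < ħ)]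
  {E : Type*} [NormedAddCommGroup E] [NormedSpace ℝ E]
  {H : Subgroup (Sp Ω)} [TopologicalSpace H] [ChartedSpace E H]

theorem Lift.contMDiff_lam (F : Lift E H ħ j) :
    ContMDiff 𝓘(ℝ, E) 𝓘(ℝ, ℂ) ∞ fun h => lam (F.F h) :=
  contDiff_snd.contMDiff.comp F.smooth

/-- Elements of Mp^c are determined by their parameters, so the identity for f is exactly
multiplicativity of the lift. -/
theorem exists_lift (hH : IsLieSubgroup E H) {f : H → ℂ} (hf : ContMDiff 𝓘(ℝ, E) 𝓘(ℝ, ℂ) ∞ f)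
    (hmul : ∀ g₁ g₂ : H, f (g₁ * g₂) =
      f g₁ * f g₂ * Complex.exp (-(1 / 2) * logDet j (oneSubZZ j g₁ g₂)))
    (hn : ∀ g : H, ‖f g ^ 2 * detC j g‖ = 1) :
    ∃ F : Lift E H ħ j, ∀ g : H, HasParameters (F.F g) g (f g) := by
  choose x hx using fun g : H => exists_hasParameters (ħ := ħ) (j := j) g (hn g)
  refine ⟨⟨MonoidHom.mk' x fun g₁ g₂ => ?_, ?_, fun h => (hx h).1⟩, hx⟩
  · refine eq_of_sigma_eq_of_lam_eq ?_ ?_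
    · rw [map_mul, (hx _).1, (hx _).1, (hx _).1, Subgroup.coe_mul]
    · rw [lam_mul, (hx _).lam_eq, (hx _).lam_eq, (hx _).lam_eq, (hx _).1, (hx _).1, hmul]
  · have h : (fun h => (toEnd (sigma ħ j (x h)), lam (x h))) = fun h => (toEnd h.1, f h) :=
      funext fun h => by rw [(hx h).1, (hx h).lam_eq]
    change ContMDiff _ _ _ fun h => (toEnd (sigma ħ j (x h)), lam (x h))
    rw [h]
    exact hH.smooth.prodMk_space hf

theorem nonempty_lift_iff (hH : IsLieSubgroup E H) : Nonempty (Lift E H ħ j) ↔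
    ∃ f : H → ℂ, ContMDiff 𝓘(ℝ, E) 𝓘(ℝ, ℂ) ∞ f ∧
      (∀ g₁ g₂ : H, f (g₁ * g₂) =
        f g₁ * f g₂ * Complex.exp (-(1 / 2) * logDet j (oneSubZZ j g₁ g₂))) ∧
      ∀ g : H, ‖f g ^ 2 * detC j g‖ = 1 := by
  constructor
  · rintro ⟨F⟩
    refine ⟨fun h => lam (F.F h), F.contMDiff_lam, fun g₁ g₂ => ?_, fun g => ?_⟩
    · simp only
      rw [map_mul, lam_mul, F.sigma_eq, F.sigma_eq]
    · have h := norm_lam (F.F g)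
      rwa [F.sigma_eq] at h
  · rintro ⟨f, hf, hmul, hn⟩
    obtain ⟨F, -⟩ := exists_lift (ħ := ħ) hH hf hmul hn
    exact ⟨F⟩

theorem scalar_mul_left_injective (x : Mpc ħ j) :
    Function.Injective fun u : Circle => scalar ħ j u * x := by
  intro u v h
  have h1 := congrArg lam h
  simp only [lam_scalar_mul] at h1
  exact Circle.ext (mul_right_cancel₀ (lam_ne_zero x) h1)

theorem contMDiff_circle_of_coe [IsManifold 𝓘(ℝ, E) ∞ H] {χ : H → Circle}
    (h : ContMDiff 𝓘(ℝ, E) 𝓘(ℝ, ℂ) ∞ fun g => (χ g : ℂ)) : ContMDiff 𝓘(ℝ, E) (𝓡 1) ∞ χ :=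
  have := Complex.finrank_real_complex_fact
  ContMDiff.codRestrict_sphere (n := 1) h fun g => (χ g).2

theorem existsUnique_smul_eq (hH : IsLieSubgroup E H) (F F' : Lift E H ħ j) : ∃! χ : SmoothHom E H, χ • F = F' := by
  have := hH.lieGroup
  choose u hu using fun g => exists_scalar_mul (F'.F g) (F.F g)
    ((F'.sigma_eq g).trans (F.sigma_eq g).symm)
  have hmul : ∀ a b, u (a * b) = u a * u b := by
    intro a b
    apply scalar_mul_left_injective (F.F (a * b))
    change scalar ħ j (u (a * b)) * _ = scalar ħ j (u a * u b) * _
    rw [← hu, map_mul, hu a, hu b, map_mul, map_mul, mul_assoc, ← mul_assoc (F.F a),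
      ← scalar_comm, mul_assoc, mul_assoc]
  -- The pointwise scalars from Schur's lemma are quotients of smooth nonvanishing parameters, hence
  -- smooth.
  have hcoe : ∀ g, (u g : ℂ) = lam (F'.F g) * (lam (F.F g))⁻¹ := by
    intro g
    rw [hu g, lam_scalar_mul, mul_inv_cancel_right₀ (lam_ne_zero _)]
  have hinv : ContMDiff 𝓘(ℝ, E) 𝓘(ℝ, ℂ) ∞ fun g => (lam (F.F g))⁻¹ := fun g =>
    ContMDiffAt.comp g (contDiffAt_inv ℝ (lam_ne_zero (F.F g))).contMDiffAt (F.contMDiff_lam g)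
  have hsm : ContMDiff 𝓘(ℝ, E) (𝓡 1) ∞ u := by
    refine contMDiff_circle_of_coe ?_
    simp only [hcoe]
    exact contDiff_mul.contMDiff.comp (F'.contMDiff_lam.prodMk_space hinv)
  refine ⟨⟨MonoidHom.mk' u hmul, hsm⟩, ?_, fun χ hχ => ?_⟩
  · apply Lift.ext
    ext1 g
    exact (hu g).symm
  · apply Subtype.ext
    ext1 g
    apply scalar_mul_left_injective (F.F g)
    change scalar ħ j (χ.1 g) * F.F g = scalar ħ j (u g) * F.F g
    rw [← smul_F, hχ, hu]

/-- The two sides have equal squares on H × H, so on a product of connected components they differ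
by a constant sign, which a pair of unitary elements shows to be 1. -/
theorem mul_eq_of_unitary (hH : IsLieSubgroup E H)
    (hmeet : ∀ h : H, ∃ k ∈ connectedComponent h, (k : Sp Ω) ∈ unitaryGroupJ j)
    {f : H → ℂ} (hf : Continuous f) (hf0 : ∀ g, f g ≠ 0)
    (hfU : ∀ g₁ g₂ : H, (g₁ : Sp Ω) ∈ unitaryGroupJ j → (g₂ : Sp Ω) ∈ unitaryGroupJ j →
      f (g₁ * g₂) = f g₁ * f g₂)
    (hψ : ∀ g₁ g₂ : H, f (g₁ * g₂) ^ 2 * detC j (g₁ * g₂ : Sp Ω) =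
      (f g₁ ^ 2 * detC j g₁) * (f g₂ ^ 2 * detC j g₂)) (g₁ g₂ : H) :
    f (g₁ * g₂) = f g₁ * f g₂ * Complex.exp (-(1 / 2) * logDet j (oneSubZZ j g₁ g₂)) := by
  have := hH.lieGroup
  have : ContinuousMul H := continuousMul_of_contMDiffMul 𝓘(ℝ, E) ∞
  have hE : Continuous fun h : H => toEnd h.1 := hH.smooth.continuous
  have hZ : Continuous fun p : H × H => oneSubZZ j p.1.1 p.2.1 :=
    continuous_oneSubZZ (hE.comp continuous_fst) (hE.comp continuous_snd) (hE.comp continuous_mul)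
  have ha := isLogDet_logDet j
  have hL : Continuous fun p : H × H => logDet j (oneSubZZ j p.1.1 p.2.1) :=
    ha.smooth.continuousOn.comp_continuous hZ fun p => oneSubZZ_mem_GLplus _ _
  obtain ⟨k₁, hk₁, hu₁⟩ := hmeet g₁
  obtain ⟨k₂, hk₂, hu₂⟩ := hmeet g₂
  refine ((isPreconnected_connectedComponent (x := g₁)).prod
    (isPreconnected_connectedComponent (x := g₂))).eq_of_sq_eq
    (f := fun p : H × H => f (p.1 * p.2))
    (g := fun p : H × H => f p.1 * f p.2 *
      Complex.exp (-(1 / 2) * logDet j (oneSubZZ j p.1.1 p.2.1)))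
    (hf.comp continuous_mul).continuousOn
    (((hf.comp continuous_fst).mul (hf.comp continuous_snd)).mul
      (continuous_const.mul hL).cexp).continuousOn (fun p _ => ?_)
    (fun _ => mul_ne_zero (mul_ne_zero (hf0 _) (hf0 _)) (Complex.exp_ne_zero _))
    (y := (k₁, k₂)) ⟨hk₁, hk₂⟩ ?_
    (x := (g₁, g₂)) ⟨mem_connectedComponent, mem_connectedComponent⟩
  -- Squaring exp(-½ a) inverts exactly the determinant factor of `detC_mul`, so equality of squares
  -- is `hψ` divided by nonzero determinants.
  · have h1 := hψ p.1 p.2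
    rw [detC_mul, ha.exp_eq _ (oneSubZZ_mem_GLplus _ _)] at h1
    have h2 : Complex.exp (-(1 / 2) * logDet j (oneSubZZ j p.1.1 p.2.1)) ^ 2 *
        Complex.exp (logDet j (oneSubZZ j p.1.1 p.2.1)) = 1 := by
      rw [← Complex.exp_nat_mul, ← Complex.exp_add, Complex.exp_eq_one_iff]
      refine ⟨0, ?_⟩
      push_cast
      ring
    have hne : Complex.exp (logDet j (oneSubZZ j p.1.1 p.2.1)) * detC j p.1.1 * detC j p.2.1 ≠ 0 :=
      mul_ne_zero (mul_ne_zero (Complex.exp_ne_zero _) (detC_ne_zero _)) (detC_ne_zero _)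
    apply mul_right_cancel₀ hne
    simp only [Pi.pow_apply]
    linear_combination h1 - f p.1 ^ 2 * f p.2 ^ 2 * detC j p.1.1 * detC j p.2.1 * h2
  · simp only
    rw [hfU _ _ hu₁ hu₂, oneSubZZ_of_mem_unitaryGroupJ _ hu₁, ha.map_one, mul_zero,
      Complex.exp_zero, mul_one]

end Lifts

end

end SympLift

open SympLift

theorem mainTheorem5
    {V : Type*} [NormedAddCommGroup V] [NormedSpace ℝ V] [FiniteDimensional ℝ V]
    (Ω : SymplecticForm V) (j : PCCS Ω) (ħ : ℝ) [Fact (0 < ħ)]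
    {E : Type*} [NormedAddCommGroup E] [NormedSpace ℝ E]
    (H : Subgroup (Sp Ω)) [TopologicalSpace H] [ChartedSpace E H] (hH : IsLieSubgroup E H) :
    -- liftability
    (Nonempty (Lift E H ħ j) ↔
      ∃ f : H → ℂ, ContMDiff 𝓘(ℝ, E) 𝓘(ℝ, ℂ) ∞ f ∧
        (∀ g₁ g₂ : H, f (g₁ * g₂) =
          f g₁ * f g₂ * Complex.exp (-(1 / 2) * logDet j (oneSubZZ j g₁ g₂))) ∧
        ∀ g : H, ‖f g ^ 2 * detC j g‖ = 1) ∧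
    -- the action on the set of lifts is simply transitive
    (∀ F F' : Lift E H ħ j, ∃! χ : SmoothHom E H, χ • F = F') ∧
    -- the sufficient criterion
    ((∀ h : H, ∃ k ∈ connectedComponent h, (k : Sp Ω) ∈ unitaryGroupJ j) →
      ∀ f : H → ℂ, ContMDiff 𝓘(ℝ, E) 𝓘(ℝ, ℂ) ∞ f → (∀ g, f g ≠ 0) →
        (∀ g₁ g₂ : H, (g₁ : Sp Ω) ∈ unitaryGroupJ j → (g₂ : Sp Ω) ∈ unitaryGroupJ j →
          f (g₁ * g₂) = f g₁ * f g₂) →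
        (∃ ψ : H →* Circle, ∀ g : H, (ψ g : ℂ) = f g ^ 2 * detC j g) →
        (∀ g : H, ∃! x : Mpc ħ j, HasParameters x g (f g)) ∧
        ∃ F : Lift E H ħ j, ∀ g : H, HasParameters (F.F g) g (f g)) := by

  refine ⟨nonempty_lift_iff hH, existsUnique_smul_eq hH, fun hmeet f hf hf0 hfU ⟨ψ, hψ⟩ => ?_⟩
  have hn : ∀ g : H, ‖f g ^ 2 * detC j g‖ = 1 := fun g => by rw [← hψ, Circle.norm_coe]
  refine ⟨fun g => existsUnique_hasParameters g.1 (hn g), exists_lift hH hf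
    (mul_eq_of_unitary hH hmeet hf.continuous hf0 hfU fun g₁ g₂ => ?_) hn⟩
  have h := hψ (g₁ * g₂)
  rw [map_mul, Circle.coe_mul, hψ, hψ] at h
  exact h.symm
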